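/- Let $\Omega\subset\mathbb R^2$ be open, bounded and simply connected, and suppose that $\partial\Omega$ is a smooth curvilinear polygon: every $p\in\partial\Omega$ has an open neighbourhood $U$ with a $C^\infty$ diffeomorphism $\Phi=(\Phi_1,\Phi_2)$ from $U$ onto an open subset of $\mathbb R^2$ such that $\Omega\cap U$ is one of the sets $\{\Phi_1<0\}$, $\{\Phi_2<0\}$, $\{\Phi_1<0\text{ and }\Phi_2<0\}$, $\{\Phi_1<0\text{ or }\Phi_2<0\}$ (subsets of $U$). Suppose also that the set of corners, i.e. of the boundary points at which the inward normal does not exist, is finite and non-empty. Let $|\partial\Omega|$ be the length (one-dimensional Hausdorff measure) of $\partial\Omega$. For $b>0$ and $\varepsilon>0$ put $$E^{\mathrm{GL}}_\varepsilon=\inf_{(\psi,\mathbf A)}\left\{\int_\Omega\Big(\big|(\nabla+i\tfrac{\mathbf A}{\varepsilon^2})\psi\big|^2-\tfrac1{2b\varepsilon^2}\big(2|\psi|^2-|\psi|^4\big)\Big)\,d\mathbf r+\frac1{\varepsilon^4}\int_{\mathbb R^2}|\operatorname{curl}\mathbf A-1|^2\,d\mathbf r\right\},$$ the infimum being over all $\psi\in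 H^1(\Omega;\mathbb C)$ and $\mathbf A\in H^1_{\mathrm{loc}}(\mathbb R^2;\mathbb R^2)$ with $\operatorname{curl}\mathbf A-1\in L^2(\mathbb R^2)$. Let $\mathscr D$ be the set of real functions $f\in H^1(0,\infty)$ with $tf\in L^2(0,\infty)$, and put $$E^{\mathrm{1D}}_\star=\inf_{\alpha\in\mathbb R}\,\inf_{f\in\mathscr D}\int_0^\infty\Big(|f'|^2+(t+\alpha)^2f^2-\tfrac1{2b}\big(2f^2-f^4\big)\Big)\,dt,$$ $$\Theta_0=\inf_{\alpha\in\mathbb R}\ \inf_{f\in\mathscr D,\ \|f\|_{L^2(0,\infty)}=1}\int_0^\infty\Big(|f'|^2+(t+\alpha)^2f^2\Big)\,dt .$$ Let $1<b<\Theta_0^{-1}$. Then there are constants $C$ and $\varepsilon_0>0$, depending only on $\Omega$ and $b$, such that for all $0<\varepsilon<\varepsilon_0$ $$E^{\mathrm{GL}}_\varepsilon\le\frac{|\partial\Omega|\,E^{\mathrm{1D}}_\star}{\varepsilon}+C\,|\log\varepsilon| .$$ -/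

import Mathlib

open MeasureTheory Set Filter Topology
open scoped ContDiff

noncomputable section

namespace GinzburgLandau

/-- The Euclidean plane. -/
abbrev Plane : Type := EuclideanSpace ℝ (Fin 2)

/-- The standard basis vector `e j` of the plane. -/
def e (j : Fin 2) : Plane := EuclideanSpace.single j (1 : ℝ)

/-! ### Weak derivatives -/

/-- `g` is the weak derivative of `f` in the direction `v` on the open set `U`
(for `f`, `g` locally integrable on `U`): integration by parts holds against all smooth functions
whose support is compact and contained in `U`. -/
def HasWeakDeriv {E F : Type*} [NormedAddCommGroup E] [NormedSpace ℝ E] [MeasureSpace E]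
    [NormedAddCommGroup F] [NormedSpace ℝ F] (U : Set E) (v : E) (f g : E → F) : Prop :=
  ∀ φ : E → ℝ, ContDiff ℝ ∞ φ → HasCompactSupport φ → tsupport φ ⊆ U →
    ∫ x in U, (fderiv ℝ φ x v) • f x = - ∫ x in U, φ x • g x

/-! ### The one-dimensional effective model on the half-line -/

/-- A real function `f ∈ H¹(0, ∞)` with `t f(t) ∈ L²(0, ∞)`, together with its weak derivative
`df` (which is determined almost everywhere by `f`). -/
structure Profile where
  f : ℝ → ℝ
  df : ℝ → ℝ
  memLp_f : MemLp f 2 (volume.restrict (Ioi 0))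
  memLp_df : MemLp df 2 (volume.restrict (Ioi 0))
  memLp_mul : MemLp (fun t => t * f t) 2 (volume.restrict (Ioi 0))
  weakDeriv : HasWeakDeriv (Ioi (0 : ℝ)) 1 f df

/-- The one-dimensional functional
`∫₀^∞ (f'² + (t + α)² f² - (2 f² - f⁴) / (2 b)) dt`. -/
def oneDEnergy (b α : ℝ) (p : Profile) : ℝ :=
  ∫ t in Ioi (0 : ℝ),
    ((p.df t) ^ 2 + (t + α) ^ 2 * (p.f t) ^ 2
      - 1 / (2 * b) * (2 * (p.f t) ^ 2 - (p.f t) ^ 4))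

/-- The effective one-dimensional ground state energy: the infimum of the functional over
`α ∈ ℝ` and over all profiles. -/
def oneDGroundEnergy (b : ℝ) : ℝ := ⨅ α : ℝ, ⨅ p : Profile, oneDEnergy b α p

/-- The de Gennes constant `Θ₀`: the infimum over `α ∈ ℝ` of the lowest eigenvalue of the Neumann
realization of `-d²/dt² + (t + α)²` on the half-line, given by its variational characterization
(quadratic form over `L²`-normalized functions of the form domain). -/
def deGennes : ℝ :=
  ⨅ α : ℝ, ⨅ p : {p : Profile // ∫ t in Ioi (0 : ℝ), (p.f t) ^ 2 = 1},
    ∫ t in Ioi (0 : ℝ), ((p.1.df t) ^ 2 + (t + α) ^ 2 * (p.1.f t) ^ 2)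

/-! ### The Ginzburg-Landau functional -/

/-- A pair `(ψ, A) ∈ H¹(Ω; ℂ) × H¹_loc(ℝ²; ℝ²)` with `curl A - 1 ∈ L²(ℝ²)`. The fields `dψ j` and
`dA j` are the weak partial derivatives in the direction `e j`; they are determined almost
everywhere by `ψ` and `A`. -/
structure Config (Ω : Set Plane) where
  ψ : Plane → ℂ
  dψ : Fin 2 → Plane → ℂ
  A : Plane → Plane
  dA : Fin 2 → Plane → Plane
  memLp_ψ : MemLp ψ 2 (volume.restrict Ω)
  memLp_dψ : ∀ j, MemLp (dψ j) 2 (volume.restrict Ω)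
  weakDeriv_ψ : ∀ j, HasWeakDeriv Ω (e j) ψ (dψ j)
  memLp_A : ∀ K : Set Plane, IsCompact K → MemLp A 2 (volume.restrict K)
  memLp_dA : ∀ j, ∀ K : Set Plane, IsCompact K → MemLp (dA j) 2 (volume.restrict K)
  weakDeriv_A : ∀ j, HasWeakDeriv univ (e j) A (dA j)
  memLp_curl : MemLp (fun r => dA 0 r 1 - dA 1 r 0 - 1) 2 volume

/-- The curl `∂₁ A₂ - ∂₂ A₁` (coordinates are numbered `0, 1` in the code). -/
def Config.curl {Ω : Set Plane} (c : Config Ω) (r : Plane) : ℝ := c.dA 0 r 1 - c.dA 1 r 0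

/-- The `j`-th component of the magnetic gradient `(∇ + i A / ε²) ψ`. -/
def Config.magGrad {Ω : Set Plane} (c : Config Ω) (ε : ℝ) (j : Fin 2) (r : Plane) : ℂ :=
  c.dψ j r + Complex.I * ((c.A r j / ε ^ 2 : ℝ) : ℂ) * c.ψ r

/-- The Ginzburg-Landau functional
`∫_Ω (|(∇ + i A / ε²) ψ|² - (2 |ψ|² - |ψ|⁴) / (2 b ε²)) + ε⁻⁴ ∫_{ℝ²} |curl A - 1|²`.
All the integrals converge for every configuration when `Ω` is a bounded Lipschitz domain,
by Sobolev embedding. -/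
def Config.energy {Ω : Set Plane} (c : Config Ω) (b ε : ℝ) : ℝ :=
  (∫ r in Ω, ((∑ j : Fin 2, ‖c.magGrad ε j r‖ ^ 2)
      - 1 / (2 * b * ε ^ 2) * (2 * ‖c.ψ r‖ ^ 2 - ‖c.ψ r‖ ^ 4)))
    + 1 / ε ^ 4 * ∫ r, |c.curl r - 1| ^ 2

/-- The Ginzburg-Landau ground state energy. -/
def groundEnergy (Ω : Set Plane) (b ε : ℝ) : ℝ := ⨅ c : Config Ω, c.energy b ε

/-! ### Domains with corners -/

/-- The boundary of `Ω` is a smooth curvilinear polygon: around each boundary point there is a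
smooth diffeomorphism `Φ` from an open neighbourhood `U = Φ.source` onto an open subset of the
plane, which straightens `Ω ∩ U` to a half-plane, a quadrant (a corner with opening angle less than
`π`) or the complement of a closed quadrant (a corner with opening angle larger than `π`). -/
def IsSmoothCurvilinearPolygon (Ω : Set Plane) : Prop :=
  ∀ p ∈ frontier Ω, ∃ Φ : OpenPartialHomeomorph Plane Plane,
    p ∈ Φ.source ∧ ContDiffOn ℝ ∞ Φ Φ.source ∧ ContDiffOn ℝ ∞ Φ.symm Φ.target ∧
    (Ω ∩ Φ.source = {r ∈ Φ.source | Φ r 0 < 0} ∨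
     Ω ∩ Φ.source = {r ∈ Φ.source | Φ r 1 < 0} ∨
     Ω ∩ Φ.source = {r ∈ Φ.source | Φ r 0 < 0 ∧ Φ r 1 < 0} ∨
     Ω ∩ Φ.source = {r ∈ Φ.source | Φ r 0 < 0 ∨ Φ r 1 < 0})

/-- `ν` is the inward unit normal to the boundary of `Ω` at the boundary point `p`: rays from `p`
making an acute angle with `ν` are initially inside `Ω`, and those making an obtuse angle with `ν`
are initially outside `Ω`. -/
def IsInwardNormal (Ω : Set Plane) (p ν : Plane) : Prop :=
  ‖ν‖ = 1 ∧ ∀ v : Plane,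
    (0 < inner ℝ v ν → ∀ᶠ t : ℝ in 𝓝[>] 0, p + t • v ∈ Ω) ∧
    (inner ℝ v ν < 0 → ∀ᶠ t : ℝ in 𝓝[>] 0, p + t • v ∉ Ω)

/-- The set of corners: the boundary points at which the normal does not exist. -/
def corners (Ω : Set Plane) : Set Plane :=
  {p ∈ frontier Ω | ¬ ∃ ν : Plane, IsInwardNormal Ω p ν}

/-- Bounded simply connected planar domains whose boundary is a smooth curvilinear polygon with
finitely many, and at least one, corners. -/
structure IsCornerDomain (Ω : Set Plane) : Prop where
  isOpen : IsOpen Ω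
  isBounded : Bornology.IsBounded Ω
  simplyConnected : IsSimplyConnected Ω
  polygon : IsSmoothCurvilinearPolygon Ω
  corners_finite : (corners Ω).Finite
  corners_nonempty : (corners Ω).Nonempty

/-- The length `|∂Ω|` of the boundary: its one-dimensional Hausdorff measure. -/
def perimeter (Ω : Set Plane) : ℝ :=
  (Measure.hausdorffMeasure (1 : ℝ) (frontier Ω)).toReal

end GinzburgLandau

end

/-!
The bound is obtained by a trial state living in a boundary layer of width of order `ε |log ε|`.

If the one-dimensional ground state energy is nonnegative, the normal state `ψ = 0` with
`curl A = 1` already suffices. Suppose that it is negative. The vector potential is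
`A = (-r₁, r₀) / 2`, so that the magnetic energy vanishes.

*The profile.* A profile of negative energy is replaced by a `C¹` function `u` vanishing beyond
`K + m`, with energy within `M 2⁻ᵐ` of the infimum and with `K`, `M` and a bound on the shift `α`
not depending on `m` (`exists_truncated_near_minimizer`). The shift is bounded because the energy is
nonnegative when the potential well `(t + α)²` sits outside of the half-line or far inside it; the
decay follows from comparing a near-minimizer with its own truncations (`tail_le_pow`). With `m` of
order `|log ε|` the truncation costs less than `ε`.

*The boundary.* In the charts the boundary consists of two rays, so that it is, by compactness, a
finite union of graphs of `C²` functions over intervals, with disjoint interiors. The distance from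
a point of one arc to the rest of the boundary is at least proportional to the distance to the ends
of the arc, hence thin lenses around the arcs are disjoint and, on one side, contained in the domain
(`exists_lens_arcs`). The corners are among the ends of the arcs, and need no other treatment. The
length of the boundary is at most the sum of the lengths of the arcs (`perimeter_le_sum_arclen`),
which is the direction that is needed, the energy being negative.

*The trial state.* Over an arc `Y = g(X)` put `w = √(1 + g'²)` and `t = (Y - g(X)) / (ε w)`. The
state is `χ(X) u(t) exp(i θ)`, where the phase `θ` (`GraphArc.phase`) turns `A / ε²` into
`-(t + α) / ε` times the unit tangent, up to terms of order one. Its energy density is at most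
`ε⁻² χ² (u'² + (t + α)² u² - (2 u² - u⁴) / (2 b))` plus errors of relative order `ε`
(`GraphArc.exists_density_trial_le`), and the area element is `ε w dX dt`; so the energy is the
length of the arc times the one-dimensional energy, divided by `ε`, up to a constant. The cut-off `χ`
keeps the state inside the lens. It has to act at a distance of order `ε |log ε|` from the ends
of the arc, where it costs an energy of order `|log ε|` (`GraphArc.exists_trial_state`). As the
lenses are disjoint, the energies of the arcs add up (`groundEnergy_le_sum_density`).
-/

noncomputable section

namespace GinzburgLandau

/-! ### The absolutely continuous representative of a profile -/

/-- The support of a compactly supported function whose closed support lies in the half-line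
stays away from the origin. -/
lemma exists_Icc_of_tsupport_subset_Ioi {φ : ℝ → ℝ} (hc : HasCompactSupport φ)
    (hs : tsupport φ ⊆ Ioi 0) : ∃ a b : ℝ, 0 < a ∧ a < b ∧ ∀ t, t ∉ Icc a b → φ t = 0 := by
  rcases (tsupport φ).eq_empty_or_nonempty with h | h
  · refine ⟨1, 2, by norm_num, by norm_num, fun t _ => ?_⟩
    exact image_eq_zero_of_notMem_tsupport (by simp [h])
  · obtain ⟨a, ha⟩ := hc.isCompact.exists_isLeast h
    obtain ⟨b, hb⟩ := hc.isCompact.exists_isGreatest h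
    refine ⟨a, b + 1, hs ha.1, by linarith [ha.2 hb.1], fun t ht => ?_⟩
    apply image_eq_zero_of_notMem_tsupport
    intro h'
    exact ht ⟨ha.2 h', by linarith [hb.2 h']⟩

lemma Profile.memLp_indicator_df (p : Profile) : MemLp ((Ioi (0:ℝ)).indicator p.df) 2 volume :=
  (memLp_indicator_iff_restrict measurableSet_Ioi).2 p.memLp_df

lemma Profile.intervalIntegrable_df (p : Profile) (a b : ℝ) :
    IntervalIntegrable ((Ioi (0:ℝ)).indicator p.df) volume a b :=
  intervalIntegrable_iff.2 (((p.memLp_indicator_df.locallyIntegrable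
    (by norm_num)).integrableOn_isCompact isCompact_uIcc).mono_set uIoc_subset_uIcc)

/-- The absolutely continuous primitive of the weak derivative of a profile. -/
def Profile.primitive (p : Profile) (t : ℝ) : ℝ := ∫ s in (0:ℝ)..t, (Ioi (0:ℝ)).indicator p.df s

lemma Profile.continuous_primitive (p : Profile) : Continuous p.primitive :=
  intervalIntegral.continuous_primitive p.intervalIntegrable_df 0

lemma Profile.integral_deriv_mul_primitive (p : Profile) {φ : ℝ → ℝ} (hφ : ContDiff ℝ ∞ φ)
    (hc : HasCompactSupport φ) (hs : tsupport φ ⊆ Ioi 0) :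
    ∫ t in Ioi (0:ℝ), deriv φ t * p.primitive t = - ∫ t in Ioi (0:ℝ), φ t * p.df t := by
  obtain ⟨a, b, ha, hab, h0⟩ := exists_Icc_of_tsupport_subset_Ioi hc hs
  have hd0 : ∀ t, t ∉ Icc a b → deriv φ t = 0 := by
    intro t ht
    have : φ =ᶠ[𝓝 t] fun _ => 0 := by
      filter_upwards [isClosed_Icc.isOpen_compl.mem_nhds ht] with s hs
      exact h0 s hs
    rw [this.deriv_eq]; simp
  have key := AbsolutelyContinuousOnInterval.integral_mul_deriv_eq_deriv_mul
    (f := φ) (g := p.primitive) (a := 0) (b := b + 1) ?_ ?_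
  · have e0 : φ 0 = 0 := h0 _ (by simp [ha])
    have eb : φ (b + 1) = 0 := h0 _ (by simp)
    rw [e0, eb, zero_mul, zero_mul, sub_zero, zero_sub] at key
    have hle : (0:ℝ) ≤ b + 1 := by linarith
    have conv : ∀ F : ℝ → ℝ, (∀ t, t ∉ Icc a b → F t = 0) →
        ∫ t in Ioi (0:ℝ), F t = ∫ t in (0:ℝ)..(b+1), F t := by
      intro F hF
      rw [intervalIntegral.integral_of_le hle]
      refine setIntegral_eq_of_subset_of_forall_sdiff_eq_zero measurableSet_Ioi ?_ ?_
      · exact fun x hx => hx.1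
      · intro x hx
        apply hF
        intro hx'
        exact hx.2 ⟨hx.1, by linarith [hx'.2]⟩
    rw [conv _ (fun t ht => by rw [hd0 t ht, zero_mul]), conv _ (fun t ht => by rw [h0 t ht, zero_mul])]
    have e1 : ∫ t in (0:ℝ)..(b+1), φ t * p.df t = ∫ t in (0:ℝ)..(b+1), φ t * deriv p.primitive t := by
      apply intervalIntegral.integral_congr_ae
      have := (p.intervalIntegrable_df 0 (b+1)).ae_hasDerivAt_integral
      filter_upwards [this] with t ht hmem
      have h1 := ht (uIoc_subset_uIcc hmem) 0 (by simp)
      have h2 : deriv p.primitive t = _ := h1.deriv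
      rw [h2, indicator_of_mem]
      rw [uIoc_of_le hle] at hmem
      exact hmem.1
    rw [e1, key, neg_neg]
  · have hφ1 : φ = fun t => φ 0 + ∫ s in (0:ℝ)..t, deriv φ s := by
      ext t
      rw [intervalIntegral.integral_deriv_eq_sub (fun x _ => (hφ.differentiable (by simp)).differentiableAt)
        ((hφ.continuous_deriv (by simp)).intervalIntegrable _ _)]
      ring
    have h2 : AbsolutelyContinuousOnInterval (fun t => ∫ s in (0:ℝ)..t, deriv φ s) 0 (b+1) :=
      ((hφ.continuous_deriv (by simp)).intervalIntegrable 0 (b+1)).absolutelyContinuousOnInterval_intervalIntegral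
        (c := 0) (by simp)
    have e0 : φ 0 = 0 := h0 _ (by simp [ha])
    rw [hφ1, e0]
    simpa using h2
  · exact (p.intervalIntegrable_df 0 (b+1)).absolutelyContinuousOnInterval_intervalIntegral
        (c := 0) (by simp)

/-- The lemma of du Bois-Reymond: a profile agrees almost everywhere on the half-line with a primitive
of its weak derivative, up to a constant. -/
lemma Profile.exists_ae_eq_primitive (p : Profile) :
    ∃ c : ℝ, ∀ᵐ t ∂(volume.restrict (Ioi (0:ℝ))), p.f t = c + p.primitive t := by
  -- a normalized bump supported in the half-line
  let B : ContDiffBump (3 : ℝ) := ⟨1, 2, by norm_num, by norm_num⟩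
  let ρ : ℝ → ℝ := B.normed volume
  have hρ : ContDiff ℝ ∞ ρ := B.contDiff_normed
  have hρc : HasCompactSupport ρ := B.hasCompactSupport_normed
  have hρs : tsupport ρ ⊆ Ioi 0 := by
    rw [B.tsupport_normed_eq]
    intro x hx
    have h2 := hx
    rw [Metric.mem_closedBall, Real.dist_eq] at h2
    have : |x - 3| ≤ 2 := h2
    rw [abs_le] at this
    show 0 < x
    linarith
  have hρ1 : ∫ t, ρ t = 1 := B.integral_normed
  have hf : LocallyIntegrableOn p.f (Ioi 0) volume :=
    locallyIntegrableOn_of_locallyIntegrable_restrict (p.memLp_f.locallyIntegrable (by norm_num))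
  have hG : LocallyIntegrableOn p.primitive (Ioi 0) volume :=
    (p.continuous_primitive.locallyIntegrable).locallyIntegrableOn _
  let h : ℝ → ℝ := fun t => p.f t - p.primitive t
  have hh : LocallyIntegrableOn h (Ioi 0) volume := hf.sub hG
  have intg : ∀ φ : ℝ → ℝ, Continuous φ → HasCompactSupport φ → tsupport φ ⊆ Ioi 0 →
      ∀ F, LocallyIntegrableOn F (Ioi 0) volume →
      Integrable (fun t => φ t * F t) (volume.restrict (Ioi 0)) := by
    intro φ h1 h2 h3 F hF
    have h4 : IntegrableOn (fun t => φ t * F t) (tsupport φ) volume :=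
      (hF.integrableOn_compact_subset h3 h2).continuousOn_mul h1.continuousOn h2
    rw [integrableOn_iff_integrable_of_support_subset] at h4
    · exact h4.integrableOn
    · exact (Function.support_mul_subset_left _ _).trans subset_closure
  let c := ∫ t in Ioi (0:ℝ), ρ t * h t
  refine ⟨c, ?_⟩
  have main := IsOpen.ae_eq_zero_of_integral_contDiff_smul_eq_zero (isOpen_Ioi (a := (0:ℝ)))
    (f := fun t => h t - c) (μ := volume) (hh.sub ((locallyIntegrable_const c).locallyIntegrableOn _)) ?_
  · rw [ae_restrict_iff' measurableSet_Ioi]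
    filter_upwards [main] with t ht h1
    have := ht h1
    simp only [h] at this
    linarith
  · intro ψ hψ hψc hψs
    set m := ∫ t, ψ t with hm
    let k : ℝ → ℝ := fun t => ψ t - m * ρ t
    have hk : ContDiff ℝ ∞ k := hψ.sub (contDiff_const.mul hρ)
    obtain ⟨a, b, ha, hab, h0⟩ := exists_Icc_of_tsupport_subset_Ioi hψc hψs
    obtain ⟨a', b', ha', hab', h0'⟩ := exists_Icc_of_tsupport_subset_Ioi hρc hρs
    have hk0 : ∀ t, t ∉ Icc (min a a') (max b b') → k t = 0 := by
      intro t ht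
      have h1 : t ∉ Icc a b := fun h' => ht ⟨min_le_of_left_le h'.1, le_max_of_le_left h'.2⟩
      have h2 : t ∉ Icc a' b' := fun h' => ht ⟨min_le_of_right_le h'.1, le_max_of_le_right h'.2⟩
      simp [k, h0 t h1, h0' t h2]
    have hkint : ∫ t, k t = 0 := by
      simp only [k]
      rw [integral_sub, integral_const_mul, hρ1, mul_one, sub_self]
      · exact hψ.continuous.integrable_of_hasCompactSupport hψc
      · exact (hρ.continuous.integrable_of_hasCompactSupport hρc).const_mul m
    let φ : ℝ → ℝ := fun t => ∫ s in (0:ℝ)..t, k s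
    have hφd : ∀ t, HasDerivAt φ (k t) t := fun t =>
      intervalIntegral.integral_hasDerivAt_right (hk.continuous.intervalIntegrable _ _)
        (hk.continuous.stronglyMeasurableAtFilter _ _) hk.continuous.continuousAt
    have hφ' : deriv φ = k := funext fun t => (hφd t).deriv
    have hφ : ContDiff ℝ ∞ φ := by
      rw [contDiff_infty_iff_deriv]
      exact ⟨fun t => (hφd t).differentiableAt, hφ' ▸ hk⟩
    have hmin : 0 < min a a' := lt_min ha ha'
    have hφ0 : ∀ t, t ∉ Icc (min a a') (max b b') → φ t = 0 := by
      intro t ht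
      by_cases h1 : t < min a a'
      · apply intervalIntegral.integral_zero_ae
        refine Eventually.of_forall fun s hs => hk0 s fun h' => ?_
        rcases le_total 0 t with h2 | h2
        · rw [uIoc_of_le h2] at hs; linarith [h'.1, hs.2]
        · rw [uIoc_of_ge h2] at hs; linarith [h'.1, hs.2]
      · have h2 : max b b' < t := by
          by_contra h3
          exact ht ⟨not_lt.1 h1, not_lt.1 h3⟩
        have h3 : (0:ℝ) ≤ t := hmin.le.trans (not_lt.1 h1)
        show ∫ s in (0:ℝ)..t, k s = 0
        rw [intervalIntegral.integral_of_le h3, ← hkint]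
        apply setIntegral_eq_integral_of_forall_compl_eq_zero
        intro s hs
        apply hk0
        intro h'
        exact hs ⟨by linarith [h'.1], by linarith [h'.2]⟩
    have hφts : tsupport φ ⊆ Icc (min a a') (max b b') := by
      apply closure_minimal _ isClosed_Icc
      intro t ht
      by_contra h'
      exact ht (hφ0 t h')
    have hφc : HasCompactSupport φ := HasCompactSupport.of_support_subset_isCompact isCompact_Icc
      (subset_closure.trans hφts)
    have hφs : tsupport φ ⊆ Ioi 0 := hφts.trans fun t ht => lt_of_lt_of_le hmin ht.1
    have w := p.weakDeriv φ hφ hφc hφs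
    simp only [fderiv_eq_smul_deriv, smul_eq_mul, one_mul] at w
    have w2 := p.integral_deriv_mul_primitive hφ hφc hφs
    rw [← w, hφ'] at w2
    have hks : tsupport k ⊆ Ioi 0 := by
      have : tsupport k ⊆ Icc (min a a') (max b b') := by
        apply closure_minimal _ isClosed_Icc
        intro t ht
        by_contra h'
        exact ht (hk0 t h')
      exact this.trans fun t ht => lt_of_lt_of_le hmin ht.1
    have hkc : HasCompactSupport k := by
      apply HasCompactSupport.intro (isCompact_Icc (a := min a a') (b := max b b'))
      exact hk0
    have w3 : ∫ t in Ioi (0:ℝ), k t * h t = 0 := by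
      simp only [h, mul_sub]
      rw [integral_sub (intg k hk.continuous hkc hks _ hf) (intg k hk.continuous hkc hks _ hG), w2,
        sub_self]
    have w4 : ∫ t in Ioi (0:ℝ), ψ t * h t = m * c := by
      have : ∫ t in Ioi (0:ℝ), k t * h t =
          (∫ t in Ioi (0:ℝ), ψ t * h t) - m * ∫ t in Ioi (0:ℝ), ρ t * h t := by
        rw [← integral_const_mul, ← integral_sub (intg ψ hψ.continuous hψc hψs _ hh)
          ((intg ρ hρ.continuous hρc hρs _ hh).const_mul m)]
        congr 1; ext t; simp only [k]; ring
      rw [w3] at this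
      linarith
    have hψ0 : ∀ t, t ∉ Ioi (0:ℝ) → ψ t = 0 := fun t ht =>
      image_eq_zero_of_notMem_tsupport fun h' => ht (hψs h')
    have w5 : ∫ t in Ioi (0:ℝ), ψ t = m :=
      setIntegral_eq_integral_of_forall_compl_eq_zero hψ0
    simp only [smul_eq_mul]
    rw [← setIntegral_eq_integral_of_forall_compl_eq_zero (s := Ioi (0:ℝ))
      (fun t ht => by rw [hψ0 t ht, zero_mul])]
    simp only [mul_sub]
    rw [integral_sub (intg ψ hψ.continuous hψc hψs _ hh)
      (intg ψ hψ.continuous hψc hψs _ ((locallyIntegrable_const c).locallyIntegrableOn _)),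
      integral_mul_const, w4, w5, sub_self]

/-! ### Continuously differentiable profiles on the half-line -/

lemma deriv_smoothTransition_eq_zero {t : ℝ} (ht : t ≤ 0 ∨ 1 ≤ t) :
    deriv Real.smoothTransition t = 0 := by
  rcases ht with ht | ht
  · apply IsLocalMin.deriv_eq_zero
    filter_upwards with s
    rw [Real.smoothTransition.zero_of_nonpos ht]
    exact Real.smoothTransition.nonneg s
  · apply IsLocalMax.deriv_eq_zero
    filter_upwards with s
    rw [Real.smoothTransition.one_of_one_le ht]
    exact Real.smoothTransition.le_one s

lemma continuous_deriv_smoothTransition : Continuous (deriv Real.smoothTransition) :=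
  (Real.smoothTransition.contDiff (n := 1)).continuous_deriv le_rfl

lemma hasDerivAt_smoothTransition (t : ℝ) :
    HasDerivAt Real.smoothTransition (deriv Real.smoothTransition t) t :=
  (((Real.smoothTransition.contDiff (n := 1)).differentiable (by simp)) t).hasDerivAt

lemma exists_bound_deriv_smoothTransition :
    ∃ C : ℝ, 1 ≤ C ∧ ∀ t, |deriv Real.smoothTransition t| ≤ C := by
  obtain ⟨C, hC⟩ := (isCompact_Icc (a := (0:ℝ)) (b := 1)).exists_bound_of_continuousOn
    continuous_deriv_smoothTransition.continuousOn
  refine ⟨max C 1, le_max_right _ _, fun t => ?_⟩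
  by_cases h : t ∈ Icc (0:ℝ) 1
  · exact (hC t h).trans (le_max_left _ _)
  · rw [deriv_smoothTransition_eq_zero]
    · simp
    · by_contra h'
      push Not at h'
      exact h ⟨h'.1.le, h'.2.le⟩

/-- The one-dimensional functional on continuously differentiable functions. -/
def halfLineEnergy (b α : ℝ) (u : ℝ → ℝ) : ℝ :=
  ∫ t in Ioi (0 : ℝ),
    ((deriv u t) ^ 2 + (t + α) ^ 2 * (u t) ^ 2 - 1 / (2 * b) * (2 * (u t) ^ 2 - (u t) ^ 4))

lemma deriv_eq_zero_of_eq_zero_Ici {u : ℝ → ℝ} (hu : ContDiff ℝ 1 u) {N : ℝ}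
    (h0 : ∀ t, N ≤ t → u t = 0) : ∀ t, N ≤ t → deriv u t = 0 := by
  have hd : ∀ t, N < t → deriv u t = 0 := by
    intro t ht
    have : u =ᶠ[𝓝 t] fun _ => 0 := by
      filter_upwards [isOpen_Ioi.mem_nhds ht] with s hs
      exact h0 s (le_of_lt hs)
    rw [this.deriv_eq]; simp
  intro t ht
  have hc : Continuous (deriv u) := hu.continuous_deriv le_rfl
  have hcl : IsClosed {s | deriv u s = 0} := isClosed_eq hc continuous_const
  have : closure (Ioi N) ⊆ {s | deriv u s = 0} := closure_minimal (fun s hs => hd s hs) hcl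
  rw [closure_Ioi] at this
  exact this ht

lemma integrableOn_Ioi_of_eq_zero_Ici {F : ℝ → ℝ} (hF : Continuous F) {N : ℝ}
    (h0 : ∀ t, N ≤ t → F t = 0) : IntegrableOn F (Ioi 0) := by
  have h1 : IntegrableOn F (Icc 0 (max N 0)) := hF.continuousOn.integrableOn_compact isCompact_Icc
  refine h1.of_forall_sdiff_eq_zero measurableSet_Ioi fun t ht => h0 t ?_
  by_contra h
  exact ht.2 ⟨le_of_lt ht.1, (not_le.1 h).le.trans (le_max_left _ _)⟩

lemma memLp_Ioi_of_eq_zero_Ici {F : ℝ → ℝ} (hF : Continuous F) {N : ℝ}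
    (h0 : ∀ t, N ≤ t → F t = 0) : MemLp F 2 (volume.restrict (Ioi 0)) := by
  rw [memLp_two_iff_integrable_sq hF.aestronglyMeasurable]
  exact integrableOn_Ioi_of_eq_zero_Ici (hF.pow 2) (N := N) fun t ht => by simp [h0 t ht]

/-- A continuously differentiable function vanishing far to the right, as a profile. -/
def Profile.ofContDiff (u : ℝ → ℝ) (hu : ContDiff ℝ 1 u) (N : ℝ) (h0 : ∀ t, N ≤ t → u t = 0) :
    Profile where
  f := u
  df := deriv u
  memLp_f := memLp_Ioi_of_eq_zero_Ici hu.continuous h0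
  memLp_df := memLp_Ioi_of_eq_zero_Ici (hu.continuous_deriv le_rfl)
    (deriv_eq_zero_of_eq_zero_Ici hu h0)
  memLp_mul := memLp_Ioi_of_eq_zero_Ici (continuous_id.mul hu.continuous) (N := N)
    fun t ht => by simp [h0 t ht]
  weakDeriv := by
    intro φ hφ hc hs
    have hφd : Continuous (deriv φ) := hφ.continuous_deriv (by simp)
    have hc' : HasCompactSupport (deriv φ) := hc.deriv
    have h1 : ∀ t, t ∉ Ioi (0:ℝ) → φ t = 0 := fun t ht =>
      image_eq_zero_of_notMem_tsupport fun h' => ht (hs h')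
    have h2 : ∀ t, t ∉ Ioi (0:ℝ) → deriv φ t = 0 := fun t ht =>
      image_eq_zero_of_notMem_tsupport fun h' => ht (hs (tsupport_deriv_subset (𝕜 := ℝ) h'))
    simp only [fderiv_eq_smul_deriv, smul_eq_mul, one_mul]
    rw [setIntegral_eq_integral_of_forall_compl_eq_zero fun t ht => by rw [h2 t ht, zero_mul],
      setIntegral_eq_integral_of_forall_compl_eq_zero fun t ht => by rw [h1 t ht, zero_mul]]
    have key := integral_mul_deriv_eq_deriv_mul_of_integrable (u := φ) (v := u) (u' := deriv φ)
      (v' := deriv u)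
      (fun t _ => ((hφ.differentiable (by simp)) t).hasDerivAt)
      (fun t _ => ((hu.differentiable (by simp)) t).hasDerivAt)
      ((hφ.continuous.mul (hu.continuous_deriv le_rfl)).integrable_of_hasCompactSupport
        hc.mul_right)
      ((hφd.mul hu.continuous).integrable_of_hasCompactSupport hc'.mul_right)
      ((hφ.continuous.mul hu.continuous).integrable_of_hasCompactSupport hc.mul_right)
    rw [key, neg_neg]

/-- For `b ≥ 1` the one-dimensional functional is bounded below uniformly in `α`: its potential
part is negative only where `|t + α| ≤ 1`. -/
lemma neg_one_le_oneDEnergy {b : ℝ} (hb : 1 ≤ b) (α : ℝ) (p : Profile) :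
    -1 ≤ oneDEnergy b α p := by
  unfold oneDEnergy
  by_cases hi : IntegrableOn (fun t => (p.df t) ^ 2 + (t + α) ^ 2 * (p.f t) ^ 2
      - 1 / (2 * b) * (2 * (p.f t) ^ 2 - (p.f t) ^ 4)) (Ioi 0)
  · have h1 : IntegrableOn ((Icc (-α - 1) (-α + 1)).indicator fun _ => (-(1/2) : ℝ)) (Ioi 0) :=
      ((integrable_indicator_iff measurableSet_Icc).2
        (integrableOn_const (by simp))).integrableOn
    have h2 : (-1 : ℝ) ≤ ∫ t in Ioi 0, (Icc (-α - 1) (-α + 1)).indicator (fun _ => (-(1/2) : ℝ)) t := by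
      rw [setIntegral_indicator measurableSet_Icc, setIntegral_const, smul_eq_mul]
      have : (volume.real (Ioi 0 ∩ Icc (-α - 1) (-α + 1)) : ℝ) ≤ 2 := by
        calc _ ≤ volume.real (Icc (-α - 1) (-α + 1)) :=
              measureReal_mono inter_subset_right (by rw [Real.volume_Icc]; exact ENNReal.ofReal_ne_top)
          _ = 2 := by rw [Real.volume_real_Icc]; rw [max_eq_left] <;> linarith
      linarith
    refine h2.trans (setIntegral_mono h1 hi fun t => ?_)
    have hb0 : 0 < b := by linarith
    have hq : 1 / (2 * b) ≤ 1 / 2 := by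
      apply one_div_le_one_div_of_le <;> linarith
    have hq0 : 0 < 1 / (2 * b) := by positivity
    set q := 1 / (2 * b)
    by_cases ht : t ∈ Icc (-α - 1) (-α + 1)
    · rw [indicator_of_mem ht]
      have e1 := sq_nonneg (p.df t)
      have e2 := mul_nonneg (sq_nonneg (t + α)) (sq_nonneg (p.f t))
      nlinarith [mul_nonneg hq0.le (sq_nonneg ((p.f t) ^ 2 - 1))]
    · rw [indicator_of_notMem ht]
      have h3 : 1 ≤ (t + α) ^ 2 := by
        by_contra h4
        have := abs_lt.1 ((sq_lt_one_iff_abs_lt_one _).1 (not_le.1 h4))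
        exact ht ⟨by linarith, by linarith⟩
      have e1 := sq_nonneg (p.df t)
      have e2 := mul_le_mul_of_nonneg_right h3 (sq_nonneg (p.f t))
      have e3 := mul_nonneg hq0.le (sq_nonneg ((p.f t) ^ 2))
      nlinarith [sq_nonneg (p.f t)]
  · rw [integral_undef hi]; norm_num

lemma oneDGroundEnergy_le {b : ℝ} (hb : 1 ≤ b) (α : ℝ) (p : Profile) :
    oneDGroundEnergy b ≤ oneDEnergy b α p := by
  have h1 : ∀ α, BddBelow (range fun p : Profile => oneDEnergy b α p) := fun α =>
    ⟨-1, by rintro _ ⟨p, rfl⟩; exact neg_one_le_oneDEnergy hb α p⟩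
  have : Nonempty Profile := ⟨p⟩
  refine (ciInf_le (f := fun α => ⨅ p : Profile, oneDEnergy b α p) ?_ α).trans (ciInf_le (h1 α) p)
  refine ⟨-1, ?_⟩
  rintro _ ⟨β, rfl⟩
  exact le_ciInf fun p => neg_one_le_oneDEnergy hb β p

lemma oneDGroundEnergy_le_halfLineEnergy {b : ℝ} (hb : 1 ≤ b) (α : ℝ) {u : ℝ → ℝ}
    (hu : ContDiff ℝ 1 u) {N : ℝ} (h0 : ∀ t, N ≤ t → u t = 0) :
    oneDGroundEnergy b ≤ halfLineEnergy b α u :=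
  oneDGroundEnergy_le hb α (Profile.ofContDiff u hu N h0)

lemma exists_oneDEnergy_lt {b E : ℝ} (h : oneDGroundEnergy b < E) :
    ∃ α p, oneDEnergy b α p < E := by
  have : Nonempty Profile :=
    ⟨Profile.ofContDiff (fun _ => 0) contDiff_const 0 (fun _ _ => rfl)⟩
  obtain ⟨α, hα⟩ := exists_lt_of_ciInf_lt h
  obtain ⟨p, hp⟩ := exists_lt_of_ciInf_lt hα
  exact ⟨α, p, hp⟩

/-! ### Approximation of profiles by compactly supported functions -/

/-- A smooth cutoff, equal to `1` on `(-∞, n]` and to `0` on `[n + 1, ∞)`. -/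
def cutoffAt (n t : ℝ) : ℝ := 1 - Real.smoothTransition (t - n)

lemma hasDerivAt_cutoffAt (n t : ℝ) :
    HasDerivAt (cutoffAt n) (-deriv Real.smoothTransition (t - n)) t := by
  have := ((hasDerivAt_smoothTransition (t - n)).comp_sub_const t n).const_sub 1
  exact this

lemma continuous_cutoffAt (n : ℝ) : Continuous (cutoffAt n) :=
  continuous_iff_continuousAt.2 fun t => (hasDerivAt_cutoffAt n t).continuousAt

lemma cutoffAt_nonneg (n t : ℝ) : 0 ≤ cutoffAt n t := by
  have := Real.smoothTransition.le_one (t - n); simp only [cutoffAt]; linarith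

lemma cutoffAt_le_one (n t : ℝ) : cutoffAt n t ≤ 1 := by
  have := Real.smoothTransition.nonneg (t - n); simp only [cutoffAt]; linarith

lemma cutoffAt_eq_zero {n t : ℝ} (h : n + 1 ≤ t) : cutoffAt n t = 0 := by
  rw [cutoffAt, Real.smoothTransition.one_of_one_le (by linarith), sub_self]

lemma cutoffAt_eq_one {n t : ℝ} (h : t ≤ n) : cutoffAt n t = 1 := by
  rw [cutoffAt, Real.smoothTransition.zero_of_nonpos (by linarith), sub_zero]

/-- Cutting off the absolutely continuous representative of a profile far from the origin changes
its energy arbitrarily little. -/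
lemma exists_cutoff_energy_lt {b α E : ℝ} (hb : 0 < b) (F v : ℝ → ℝ)
    (hF : Continuous F) (hv2 : IntegrableOn (fun t => v t ^ 2) (Ioi 0))
    (hvm : AEStronglyMeasurable v (volume.restrict (Ioi 0)))
    (hF2 : IntegrableOn (fun t => F t ^ 2) (Ioi 0))
    (htF : IntegrableOn (fun t => (t + α) ^ 2 * F t ^ 2) (Ioi 0))
    (hF4 : IntegrableOn (fun t => F t ^ 4) (Ioi 0))
    (h : ∫ t in Ioi (0:ℝ), (v t ^ 2 + (t + α) ^ 2 * F t ^ 2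
      - 1 / (2 * b) * (2 * F t ^ 2 - F t ^ 4)) < E) :
    ∃ n : ℕ, ∫ t in Ioi (0:ℝ), ((-deriv Real.smoothTransition (t - n) * F t + cutoffAt n t * v t) ^ 2
      + (t + α) ^ 2 * (cutoffAt n t * F t) ^ 2
      - 1 / (2 * b) * (2 * (cutoffAt n t * F t) ^ 2 - (cutoffAt n t * F t) ^ 4)) < E := by
  obtain ⟨C, hC1, hC⟩ := exists_bound_deriv_smoothTransition
  have hq0 : 0 < 1 / (2 * b) := by positivity
  set q := 1 / (2 * b)
  have key := tendsto_integral_of_dominated_convergence (μ := volume.restrict (Ioi (0:ℝ)))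
    (F := fun (n : ℕ) t => (-deriv Real.smoothTransition (t - n) * F t + cutoffAt n t * v t) ^ 2
      + (t + α) ^ 2 * (cutoffAt n t * F t) ^ 2
      - q * (2 * (cutoffAt n t * F t) ^ 2 - (cutoffAt n t * F t) ^ 4))
    (f := fun t => v t ^ 2 + (t + α) ^ 2 * F t ^ 2 - q * (2 * F t ^ 2 - F t ^ 4))
    (fun t => 2 * C ^ 2 * F t ^ 2 + 2 * v t ^ 2 + (t + α) ^ 2 * F t ^ 2 + 2 * q * F t ^ 2 + q * F t ^ 4)
    ?_ ?_ ?_ ?_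
  · exact ((tendsto_order.1 key).2 E h).exists
  · intro n
    have h1 : Continuous (fun t => -deriv Real.smoothTransition (t - n) * F t) := by
      have := continuous_deriv_smoothTransition
      fun_prop
    have h2 := continuous_cutoffAt n
    have h3 : Continuous fun t => (t + α) ^ 2 * (cutoffAt n t * F t) ^ 2 := by fun_prop
    have h4 : Continuous fun t => q * (2 * (cutoffAt n t * F t) ^ 2 - (cutoffAt n t * F t) ^ 4) := by
      fun_prop
    exact (((h1.aestronglyMeasurable.add (h2.aestronglyMeasurable.mul hvm)).pow 2).add
      h3.aestronglyMeasurable).sub h4.aestronglyMeasurable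
  · exact ((((hF2.const_mul _).add (hv2.const_mul _)).add htF).add (hF2.const_mul _)).add
      (hF4.const_mul _)
  · intro n
    filter_upwards with t
    have c0 := cutoffAt_nonneg n t
    have c1 := cutoffAt_le_one n t
    have d1 := hC (t - n)
    set χ := cutoffAt n t
    set d := deriv Real.smoothTransition (t - n)
    have c2 : χ ^ 2 ≤ 1 := pow_le_one₀ c0 c1
    have c4 : χ ^ 4 ≤ 1 := pow_le_one₀ c0 c1
    have d2 : d ^ 2 ≤ C ^ 2 := sq_le_sq' (by linarith [(abs_le.1 d1).1]) (abs_le.1 d1).2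
    have e1 : (-d * F t + χ * v t) ^ 2 ≤ 2 * C ^ 2 * F t ^ 2 + 2 * v t ^ 2 := by
      have := mul_le_mul_of_nonneg_right d2 (sq_nonneg (F t))
      have := mul_le_mul_of_nonneg_right c2 (sq_nonneg (v t))
      nlinarith [sq_nonneg (d * F t + χ * v t)]
    have e2 : (χ * F t) ^ 2 ≤ F t ^ 2 := by
      rw [mul_pow]; exact mul_le_of_le_one_left (sq_nonneg _) c2
    have e4 : (χ * F t) ^ 4 ≤ F t ^ 4 := by
      rw [mul_pow]; exact mul_le_of_le_one_left (by positivity) c4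
    have e3 := mul_le_mul_of_nonneg_left e2 (sq_nonneg (t + α))
    have e5 := mul_le_mul_of_nonneg_left e2 hq0.le
    have e6 := mul_le_mul_of_nonneg_left e4 hq0.le
    have n1 := sq_nonneg (-d * F t + χ * v t)
    have n2 : 0 ≤ (t + α) ^ 2 * (χ * F t) ^ 2 := by positivity
    have n3 : 0 ≤ q * (χ * F t) ^ 2 := by positivity
    have n4 : 0 ≤ q * (χ * F t) ^ 4 := by positivity
    have n5 : 0 ≤ q * (F t) ^ 2 := by positivity
    have n6 : 0 ≤ q * (F t) ^ 4 := by positivity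
    have n7 : 0 ≤ (t + α) ^ 2 * (F t) ^ 2 := by positivity
    have n8 : 0 ≤ C ^ 2 * (F t) ^ 2 := by positivity
    rw [Real.norm_eq_abs, abs_le]
    constructor <;> nlinarith [sq_nonneg (v t)]
  · filter_upwards with t
    apply tendsto_const_nhds.congr'
    filter_upwards [eventually_ge_atTop ⌈t⌉₊] with n hn
    have hn' : t ≤ n := (Nat.le_ceil t).trans (by exact_mod_cast hn)
    rw [cutoffAt_eq_one hn', deriv_smoothTransition_eq_zero (Or.inl (by linarith))]
    ring

set_option maxHeartbeats 1000000 in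
/-- A square integrable function on a bounded interval, together with its primitive, is approximated
by continuous functions and their primitives, without raising the energy of the cut-off product by
more than an arbitrarily small amount. -/
lemma exists_contDiff_energy_lt {b α E c : ℝ} (n : ℕ) (p : Profile)
    (h : ∫ t in Ioi (0:ℝ), ((-deriv Real.smoothTransition (t - n) * (c + p.primitive t)
        + cutoffAt n t * p.df t) ^ 2
      + (t + α) ^ 2 * (cutoffAt n t * (c + p.primitive t)) ^ 2
      - 1 / (2 * b) * (2 * (cutoffAt n t * (c + p.primitive t)) ^ 2
        - (cutoffAt n t * (c + p.primitive t)) ^ 4)) < E) :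
    ∃ u : ℝ → ℝ, ContDiff ℝ 1 u ∧ (∀ t : ℝ, (n : ℝ) + 1 ≤ t → u t = 0) ∧
      halfLineEnergy b α u < E := by
  obtain ⟨C, hC1, hC⟩ := exists_bound_deriv_smoothTransition
  set w : ℝ → ℝ := (Ioi (0:ℝ)).indicator p.df with hw
  set N : ℝ := n + 1 with hN
  have hN0 : 0 < N := by positivity
  have hwL : MemLp w (ENNReal.ofReal 2) volume := by simpa using p.memLp_indicator_df
  have hex : ∀ k : ℕ, ∃ g : ℝ → ℝ, HasCompactSupport g ∧ (∫ x, (w x - g x) ^ 2) ≤ 1 / (k + 1) ∧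
      Continuous g ∧ MemLp g (ENNReal.ofReal 2) volume := fun k => by
    have := hwL.exists_hasCompactSupport_integral_rpow_sub_le (p := 2) (by norm_num)
      (ε := 1 / ((k : ℝ) + 1)) (by positivity)
    simpa using this
  choose g hgc hgi hgcont hgL using hex
  have hsq : ∀ k, Integrable (fun x => (w x - g k x) ^ 2) volume := fun k => by
    have : MemLp (fun x => w x - g k x) 2 volume := by
      have := hwL.sub (hgL k)
      rw [ENNReal.ofReal_ofNat] at this
      exact this
    exact this.integrable_sq
  -- the cut-off approximants
  let G : ℕ → ℝ → ℝ := fun k t => c + ∫ s in (0:ℝ)..t, g k s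
  let F : ℝ → ℝ := fun t => c + p.primitive t
  have hFc : Continuous F := continuous_const.add p.continuous_primitive
  have hGd : ∀ k t, HasDerivAt (G k) (g k t) t := fun k t =>
    (intervalIntegral.integral_hasDerivAt_right ((hgcont k).intervalIntegrable _ _)
        ((hgcont k).stronglyMeasurableAtFilter _ _) (hgcont k).continuousAt).const_add c
  have hGc : ∀ k, Continuous (G k) := fun k =>
    continuous_iff_continuousAt.2 fun t => (hGd k t).continuousAt
  let u : ℕ → ℝ → ℝ := fun k t => cutoffAt n t * G k t
  have hud : ∀ k t, HasDerivAt (u k)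
      (-deriv Real.smoothTransition (t - n) * G k t + cutoffAt n t * g k t) t := fun k t =>
    (hasDerivAt_cutoffAt n t).mul (hGd k t)
  have hst := continuous_deriv_smoothTransition
  have hcut := continuous_cutoffAt n
  have hu1 : ∀ k, ContDiff ℝ 1 (u k) := fun k => by
    rw [contDiff_one_iff_deriv]
    refine ⟨fun t => (hud k t).differentiableAt, ?_⟩
    have : deriv (u k) = fun t => -deriv Real.smoothTransition (t - n) * G k t
      + cutoffAt n t * g k t := funext fun t => (hud k t).deriv
    rw [this]
    have := hGc k; have := hgcont k
    fun_prop
  have hu0 : ∀ k t, N ≤ t → u k t = 0 := fun k t ht => by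
    simp only [u]; rw [cutoffAt_eq_zero ht, zero_mul]
  -- everything takes place on the bounded interval `(0, N]`
  let I : Set ℝ := Ioc 0 N
  have hIm : MeasurableSet I := measurableSet_Ioc
  have hIfin : volume.real I = N := by simp [I, hN0.le]
  have hIcc : ∀ Φ : ℝ → ℝ, Continuous Φ → IntegrableOn Φ I := fun Φ hΦ =>
    (hΦ.integrableOn_Icc (a := 0) (b := N)).mono_set Ioc_subset_Icc_self
  have hci : ∀ r : ℝ, Integrable (fun _ : ℝ => r) (volume.restrict I) := fun r =>
    integrableOn_const (by simp [I])
  have hred : ∀ Φ : ℝ → ℝ, (∀ t, N ≤ t → Φ t = 0) → ∫ t in Ioi (0:ℝ), Φ t = ∫ t in I, Φ t := by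
    intro Φ hΦ
    refine setIntegral_eq_of_subset_of_forall_sdiff_eq_zero measurableSet_Ioi (fun x hx => hx.1) ?_
    intro x hx
    apply hΦ
    by_contra hx'
    exact hx.2 ⟨hx.1, (not_le.1 hx').le⟩
  set q := 1 / (2 * b)
  let W : ℝ → ℝ → ℝ := fun t y => (t + α) ^ 2 * y ^ 2 - q * (2 * y ^ 2 - y ^ 4)
  let U : ℝ → ℝ := fun t => cutoffAt n t * F t
  have hUc : Continuous U := hcut.mul hFc
  let v : ℝ → ℝ := fun t => -deriv Real.smoothTransition (t - n) * F t + cutoffAt n t * w t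
  let D : ℕ → ℝ → ℝ := fun k t => -deriv Real.smoothTransition (t - n) * (G k t - F t)
    + cutoffAt n t * (g k t - w t)
  have hlow : ∫ t in I, (v t ^ 2 + W t (U t)) < E := by
    refine lt_of_eq_of_lt ?_ h
    rw [hred]
    · refine setIntegral_congr_fun hIm fun t ht => ?_
      simp only [v, W, U, F, hw, indicator_of_mem (show t ∈ Ioi (0:ℝ) from ht.1)]
      ring
    · intro t ht
      rw [cutoffAt_eq_zero ht, deriv_smoothTransition_eq_zero (Or.inr (by linarith))]
      ring
  have henergy : ∀ k, halfLineEnergy b α (u k) = ∫ t in I, ((v t + D k t) ^ 2 + W t (u k t)) := by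
    intro k
    unfold halfLineEnergy
    rw [hred]
    · refine setIntegral_congr_fun hIm fun t ht => ?_
      simp only [v, W, D, (hud k t).deriv]
      ring
    · intro t ht
      rw [hu0 k t ht, deriv_eq_zero_of_eq_zero_Ici (hu1 k) (hu0 k) t ht]
      ring
  let δ : ℕ → ℝ := fun k => √(1 / ((k:ℝ) + 1))
  have hδ0 : ∀ k, 0 < δ k := fun k => Real.sqrt_pos.2 (by positivity)
  have hδ2 : ∀ k, δ k ^ 2 = 1 / ((k:ℝ) + 1) := fun k => Real.sq_sqrt (by positivity)
  have hδlim : Tendsto δ atTop (𝓝 0) := by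
    have := (Real.continuous_sqrt.tendsto 0).comp (tendsto_one_div_add_atTop_nhds_zero_nat (𝕜 := ℝ))
    simp only [Real.sqrt_zero] at this
    exact this
  have hgw : ∀ k, ∫ t in I, (w t - g k t) ^ 2 ≤ δ k ^ 2 := fun k => by
    rw [hδ2]
    exact (setIntegral_le_integral (hsq k) (Eventually.of_forall fun t => sq_nonneg _)).trans (hgi k)
  have hwI : IntegrableOn w I :=
    ((p.memLp_indicator_df.locallyIntegrable (by norm_num)).integrableOn_isCompact
      (isCompact_Icc (a := 0) (b := N))).mono_set Ioc_subset_Icc_self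
  have hunif : ∀ k, ∀ t ∈ I, |G k t - F t| ≤ δ k * (N + 1) := by
    intro k t ht
    have e1 : G k t - F t = ∫ s in (0:ℝ)..t, (g k s - w s) := by
      simp only [G, F, Profile.primitive]
      rw [intervalIntegral.integral_sub ((hgcont k).intervalIntegrable _ _)
        (p.intervalIntegrable_df _ _)]
      ring
    rw [e1, intervalIntegral.integral_of_le ht.1.le]
    have hdiff : IntegrableOn (fun s => g k s - w s) I := (hIcc _ (hgcont k)).sub hwI
    calc |∫ s in Ioc 0 t, (g k s - w s)| ≤ ∫ s in Ioc 0 t, |g k s - w s| :=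
          abs_integral_le_integral_abs
      _ ≤ ∫ s in I, |g k s - w s| := setIntegral_mono_set hdiff.abs
          (Eventually.of_forall fun s => abs_nonneg _) (Ioc_subset_Ioc_right ht.2).eventuallyLE
      _ ≤ ∫ s in I, (δ k / 2 + (2 * δ k)⁻¹ * (w s - g k s) ^ 2) := by
          refine setIntegral_mono hdiff.abs ?_ fun s => ?_
          · exact (hci _).add ((hsq k).integrableOn.const_mul _)
          · have : (δ k / 2 + (2 * δ k)⁻¹ * (w s - g k s) ^ 2) - |g k s - w s|
                = (2 * δ k)⁻¹ * (δ k - |g k s - w s|) ^ 2 := by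
              have := (hδ0 k).ne'
              have e : (w s - g k s) ^ 2 = |g k s - w s| ^ 2 := by rw [sq_abs]; ring
              rw [e]; field_simp; ring
            have h2 : 0 ≤ (2 * δ k)⁻¹ * (δ k - |g k s - w s|) ^ 2 := by
              have := hδ0 k; positivity
            show |g k s - w s| ≤ _
            linarith
      _ = N * (δ k / 2) + (2 * δ k)⁻¹ * ∫ s in I, (w s - g k s) ^ 2 := by
          rw [integral_add (hci _) ((hsq k).integrableOn.const_mul _),
            setIntegral_const, integral_const_mul, hIfin, smul_eq_mul]
      _ ≤ N * (δ k / 2) + (2 * δ k)⁻¹ * δ k ^ 2 := by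
          have := hδ0 k
          gcongr
          exact hgw k
      _ = δ k * (N + 1) / 2 := by
          have := (hδ0 k).ne'
          field_simp
      _ ≤ δ k * (N + 1) := by
          have := hδ0 k
          have : 0 ≤ δ k * (N + 1) := by positivity
          linarith
  have hvm : AEStronglyMeasurable v (volume.restrict I) :=
    ((by fun_prop : Continuous fun t => -deriv Real.smoothTransition (t - n) * F t
      ).aestronglyMeasurable).add (hcut.aestronglyMeasurable.mul hwI.aestronglyMeasurable)
  have hw2 : IntegrableOn (fun t => w t ^ 2) I := p.memLp_indicator_df.integrable_sq.integrableOn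
  have hv2 : IntegrableOn (fun t => v t ^ 2) I := by
    have h1 : IntegrableOn (fun t => 2 * (-deriv Real.smoothTransition (t - n) * F t) ^ 2
        + 2 * w t ^ 2) I := (hIcc _ (by fun_prop)).add (hw2.const_mul 2)
    refine Integrable.mono' h1 (hvm.pow 2) (Eventually.of_forall fun t => ?_)
    rw [Real.norm_eq_abs, abs_of_nonneg (sq_nonneg _)]
    have c0 := cutoffAt_nonneg n t
    have c1 := cutoffAt_le_one n t
    have := mul_le_mul_of_nonneg_right (pow_le_one₀ (n := 2) c0 c1) (sq_nonneg (w t))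
    simp only [v]
    nlinarith [sq_nonneg (-deriv Real.smoothTransition (t - n) * F t - cutoffAt n t * w t)]
  have hDb : ∀ k, ∀ t ∈ I, D k t ^ 2 ≤ 2 * (C * (N + 1)) ^ 2 * δ k ^ 2 + 2 * (w t - g k t) ^ 2 := by
    intro k t ht
    have c0 := cutoffAt_nonneg n t
    have c1 := cutoffAt_le_one n t
    have h1 := mul_le_mul_of_nonneg_right (pow_le_one₀ (n := 2) c0 c1) (sq_nonneg (w t - g k t))
    have h2 : |deriv Real.smoothTransition (t - n) * (G k t - F t)| ≤ C * (δ k * (N + 1)) := by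
      rw [abs_mul]
      exact mul_le_mul (hC _) (hunif k t ht) (abs_nonneg _) (by linarith)
    have h3 := sq_le_sq' (by linarith [(abs_le.1 h2).1]) (abs_le.1 h2).2
    simp only [D]
    nlinarith [sq_nonneg (-deriv Real.smoothTransition (t - n) * (G k t - F t)
      - cutoffAt n t * (g k t - w t))]
  have hDm : ∀ k, AEStronglyMeasurable (D k) (volume.restrict I) := fun k =>
    ((by have := hGc k; fun_prop :
      Continuous fun t => -deriv Real.smoothTransition (t - n) * (G k t - F t)
      ).aestronglyMeasurable).add (hcut.aestronglyMeasurable.mul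
        ((hgcont k).aestronglyMeasurable.sub hwI.aestronglyMeasurable))
  have hDbi : ∀ k, IntegrableOn (fun t => 2 * (C * (N + 1)) ^ 2 * δ k ^ 2 + 2 * (w t - g k t) ^ 2) I :=
    fun k => (hci _).add ((hsq k).integrableOn.const_mul 2)
  have hD2 : ∀ k, IntegrableOn (fun t => D k t ^ 2) I := fun k => by
    refine Integrable.mono' (hDbi k) ((hDm k).pow 2) ?_
    filter_upwards [ae_restrict_mem hIm] with t ht
    rw [Real.norm_eq_abs, abs_of_nonneg (sq_nonneg _)]
    exact hDb k t ht
  have hDint : ∀ k, ∫ t in I, D k t ^ 2 ≤ (2 * (C * (N + 1)) ^ 2 * N + 2) * δ k ^ 2 := fun k => by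
    calc ∫ t in I, D k t ^ 2
        ≤ ∫ t in I, (2 * (C * (N + 1)) ^ 2 * δ k ^ 2 + 2 * (w t - g k t) ^ 2) :=
          setIntegral_mono_on (hD2 k) (hDbi k) hIm (hDb k)
      _ = N * (2 * (C * (N + 1)) ^ 2 * δ k ^ 2) + 2 * ∫ t in I, (w t - g k t) ^ 2 := by
          rw [integral_add (hci _) ((hsq k).integrableOn.const_mul _),
            setIntegral_const, integral_const_mul, hIfin, smul_eq_mul]
      _ ≤ _ := by linarith [hgw k]
  have hDlim : Tendsto (fun k => ∫ t in I, D k t ^ 2) atTop (𝓝 0) := by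
    refine squeeze_zero (fun k => integral_nonneg fun t => sq_nonneg _) hDint ?_
    simpa using (hδlim.pow 2).const_mul (2 * (C * (N + 1)) ^ 2 * N + 2)
  have hWc : Continuous fun z : ℝ × ℝ => W z.1 z.2 := by simp only [W]; fun_prop
  have hWlim : Tendsto (fun k => ∫ t in I, W t (u k t)) atTop (𝓝 (∫ t in I, W t (U t))) := by
    obtain ⟨B, hB⟩ := (isCompact_Icc (a := (0:ℝ)) (b := N)).exists_bound_of_continuousOn
      hFc.continuousOn
    obtain ⟨M, hM⟩ := ((isCompact_Icc (a := (0:ℝ)) (b := N)).prod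
      (isCompact_Icc (a := -(B + (N + 1))) (b := B + (N + 1)))).exists_bound_of_continuousOn
      hWc.continuousOn
    have hδ1 : ∀ k, δ k ≤ 1 := fun k => by
      rw [← Real.sqrt_one]
      apply Real.sqrt_le_sqrt
      rw [div_le_one (by positivity)]
      linarith [(Nat.cast_nonneg k : (0:ℝ) ≤ k)]
    refine tendsto_integral_of_dominated_convergence (fun _ => M) ?_ (hci _)
      ?_ ?_
    · intro k
      exact (hWc.comp (continuous_id.prodMk (hu1 k).continuous)).aestronglyMeasurable
    · intro k
      filter_upwards [ae_restrict_mem hIm] with t ht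
      refine hM (t, u k t) ⟨⟨ht.1.le, ht.2⟩, ?_⟩
      have h1 := hB t ⟨ht.1.le, ht.2⟩
      have h2 := hunif k t ht
      have h3 : |G k t| ≤ B + (N + 1) := by
        have h4 := abs_add_le (F t) (G k t - F t)
        rw [add_sub_cancel] at h4
        have h5 : δ k * (N + 1) ≤ 1 * (N + 1) := mul_le_mul_of_nonneg_right (hδ1 k) (by linarith)
        rw [Real.norm_eq_abs] at h1
        linarith
      have h4 : |u k t| ≤ B + (N + 1) := by
        simp only [u, abs_mul, abs_of_nonneg (cutoffAt_nonneg n t)]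
        exact (mul_le_of_le_one_left (abs_nonneg _) (cutoffAt_le_one n t)).trans h3
      exact abs_le.1 h4
    · filter_upwards [ae_restrict_mem hIm] with t ht
      have h1 : Tendsto (fun k => G k t) atTop (𝓝 (F t)) := by
        rw [tendsto_iff_dist_tendsto_zero]
        refine squeeze_zero (fun _ => dist_nonneg) (fun k => hunif k t ht) ?_
        simpa using hδlim.mul_const (N + 1)
      have h2 : Tendsto (fun k => u k t) atTop (𝓝 (U t)) := h1.const_mul _
      have h3 : Continuous fun y => W t y := by simp only [W]; fun_prop
      exact (h3.tendsto (U t)).comp h2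
  have hWi : ∀ y : ℝ → ℝ, Continuous y → IntegrableOn (fun t => W t (y t)) I := fun y hy =>
    hIcc _ (hWc.comp (continuous_id.prodMk hy))
  rw [integral_add hv2 (hWi U hUc)] at hlow
  set a := ∫ t in I, v t ^ 2 with ha
  have ha0 : 0 ≤ a := integral_nonneg fun t => sq_nonneg _
  set γ := E - (a + ∫ t in I, W t (U t)) with hγ
  have hγ0 : 0 < γ := by linarith
  set θ := γ / (4 * (a + 1)) with hθ
  have hθ0 : 0 < θ := by positivity
  have hθa : θ * a ≤ γ / 4 := by
    rw [hθ, div_mul_eq_mul_div, div_le_div_iff₀ (by positivity) (by norm_num)]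
    nlinarith
  have ev1 : ∀ᶠ k in atTop, (1 + 1 / θ) * ∫ t in I, D k t ^ 2 < γ / 4 := by
    have := hDlim.const_mul (1 + 1 / θ)
    rw [mul_zero] at this
    exact (tendsto_order.1 this).2 _ (by linarith)
  have ev2 : ∀ᶠ k in atTop, ∫ t in I, W t (u k t) < (∫ t in I, W t (U t)) + γ / 4 :=
    (tendsto_order.1 hWlim).2 _ (by linarith)
  obtain ⟨k, hk1, hk2⟩ := (ev1.and ev2).exists
  refine ⟨u k, hu1 k, hu0 k, ?_⟩
  have hvD : IntegrableOn (fun t => (1 + θ) * v t ^ 2 + (1 + 1 / θ) * D k t ^ 2) I :=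
    (hv2.const_mul _).add ((hD2 k).const_mul _)
  have hpt : ∀ t, (v t + D k t) ^ 2 ≤ (1 + θ) * v t ^ 2 + (1 + 1 / θ) * D k t ^ 2 := fun t => by
    have e : (1 + θ) * v t ^ 2 + (1 + 1 / θ) * D k t ^ 2 - (v t + D k t) ^ 2
        = (θ * v t - D k t) ^ 2 / θ := by field_simp; ring
    have : 0 ≤ (θ * v t - D k t) ^ 2 / θ := by positivity
    linarith
  have hvDi : IntegrableOn (fun t => (v t + D k t) ^ 2) I := by
    refine Integrable.mono' hvD ((hvm.add (hDm k)).pow 2) (Eventually.of_forall fun t => ?_)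
    rw [Real.norm_eq_abs, abs_of_nonneg (sq_nonneg _)]
    exact hpt t
  rw [henergy, integral_add hvDi (hWi _ (hu1 k).continuous)]
  have h1 : ∫ t in I, (v t + D k t) ^ 2 ≤ (1 + θ) * a + (1 + 1 / θ) * ∫ t in I, D k t ^ 2 := by
    rw [ha, ← integral_const_mul, ← integral_const_mul,
      ← integral_add (hv2.const_mul _) ((hD2 k).const_mul _)]
    exact setIntegral_mono hvDi hvD hpt
  linarith

/-- Profiles of negative energy can be replaced by continuously differentiable functions vanishing
far from the origin. -/
lemma exists_contDiff_of_oneDEnergy_lt {b α E : ℝ} (hb : 0 < b) (hE : E ≤ 0) (p : Profile)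
    (h : oneDEnergy b α p < E) :
    ∃ u : ℝ → ℝ, ContDiff ℝ 1 u ∧ (∃ N : ℝ, ∀ t, N ≤ t → u t = 0) ∧
      halfLineEnergy b α u < E := by
  obtain ⟨c, hc⟩ := p.exists_ae_eq_primitive
  have hq0 : 0 < 1 / (2 * b) := by positivity
  unfold oneDEnergy at h
  set q := 1 / (2 * b) with hq
  -- a negative Bochner integral is not a junk value
  have hint : IntegrableOn (fun t => (p.df t) ^ 2 + (t + α) ^ 2 * (p.f t) ^ 2
      - q * (2 * (p.f t) ^ 2 - (p.f t) ^ 4)) (Ioi 0) := by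
    by_contra hn
    rw [integral_undef hn] at h
    linarith
  have hf2 : IntegrableOn (fun t => p.f t ^ 2) (Ioi 0) := p.memLp_f.integrable_sq
  have hd2 : IntegrableOn (fun t => p.df t ^ 2) (Ioi 0) := p.memLp_df.integrable_sq
  have htf : IntegrableOn (fun t => (t + α) ^ 2 * p.f t ^ 2) (Ioi 0) := by
    have : MemLp (fun t => t * p.f t + α * p.f t) 2 (volume.restrict (Ioi 0)) :=
      p.memLp_mul.add (p.memLp_f.const_mul α)
    refine this.integrable_sq.congr (Eventually.of_forall fun t => ?_)
    simp only; ring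
  have hf4 : IntegrableOn (fun t => p.f t ^ 4) (Ioi 0) := by
    have := ((hint.sub hd2).sub htf).add (hf2.const_mul (2 * q))
    refine (this.const_mul q⁻¹).congr (Eventually.of_forall fun t => ?_)
    simp only [Pi.add_apply, Pi.sub_apply]
    field_simp
    ring
  have hF : Continuous fun t => c + p.primitive t := continuous_const.add p.continuous_primitive
  obtain ⟨n, hn⟩ := exists_cutoff_energy_lt (b := b) (α := α) (E := E) hb
    (fun t => c + p.primitive t) p.df hF hd2 p.memLp_df.aestronglyMeasurable
    (hf2.congr (by filter_upwards [hc] with t ht; rw [ht]))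
    (htf.congr (by filter_upwards [hc] with t ht; rw [ht]))
    (hf4.congr (by filter_upwards [hc] with t ht; rw [ht]))
    (by
      refine lt_of_eq_of_lt (integral_congr_ae ?_) h
      filter_upwards [hc] with t ht
      rw [ht])
  obtain ⟨u, h1, h2, h3⟩ := exists_contDiff_energy_lt n p hn
  exact ⟨u, h1, ⟨_, h2⟩, h3⟩

/-! ### Localization and energy bounds on the half-line -/

section Localization

variable {b α : ℝ} {u θ : ℝ → ℝ} {N : ℝ}

lemma integrableOn_halfLineEnergy (b α : ℝ) (hu : ContDiff ℝ 1 u) (h0 : ∀ t, N ≤ t → u t = 0) :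
    IntegrableOn (fun t => (deriv u t) ^ 2 + (t + α) ^ 2 * (u t) ^ 2
      - 1 / (2 * b) * (2 * (u t) ^ 2 - (u t) ^ 4)) (Ioi 0) := by
  have h1 := hu.continuous
  have h2 := hu.continuous_deriv le_rfl
  refine integrableOn_Ioi_of_eq_zero_Ici (N := N) (by fun_prop) fun t ht => ?_
  rw [h0 t ht, deriv_eq_zero_of_eq_zero_Ici hu h0 t ht]; ring

lemma deriv_cos_mul (hu : ContDiff ℝ 1 u) (hθ : ContDiff ℝ 1 θ) (t : ℝ) :
    deriv (fun t => Real.cos (θ t) * u t) t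
      = -Real.sin (θ t) * deriv θ t * u t + Real.cos (θ t) * deriv u t :=
  ((((hθ.differentiable (by simp)) t).hasDerivAt.cos).mul
    ((hu.differentiable (by simp)) t).hasDerivAt).deriv

lemma deriv_sin_mul (hu : ContDiff ℝ 1 u) (hθ : ContDiff ℝ 1 θ) (t : ℝ) :
    deriv (fun t => Real.sin (θ t) * u t) t
      = Real.cos (θ t) * deriv θ t * u t + Real.sin (θ t) * deriv u t :=
  ((((hθ.differentiable (by simp)) t).hasDerivAt.sin).mul
    ((hu.differentiable (by simp)) t).hasDerivAt).deriv

/-- The IMS localization estimate for the partition `cos² θ + sin² θ = 1`. The quartic term only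
helps. -/
lemma halfLineEnergy_cos_mul_le (hb : 0 < b) (hu : ContDiff ℝ 1 u) (h0 : ∀ t, N ≤ t → u t = 0)
    (hθ : ContDiff ℝ 1 θ) :
    halfLineEnergy b α (fun t => Real.cos (θ t) * u t)
        + ∫ t in Ioi (0:ℝ), ((t + α) ^ 2 - 1 / b) * (Real.sin (θ t) ^ 2 * u t ^ 2)
      ≤ halfLineEnergy b α u + ∫ t in Ioi (0:ℝ), deriv θ t ^ 2 * u t ^ 2 := by
  have c1 := hu.continuous
  have c2 := hu.continuous_deriv le_rfl
  have c3 := hθ.continuous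
  have c4 := hθ.continuous_deriv le_rfl
  have hcu : ContDiff ℝ 1 fun t => Real.cos (θ t) * u t := (Real.contDiff_cos.comp hθ).mul hu
  unfold halfLineEnergy
  rw [← integral_add, ← integral_add]
  rotate_left
  · exact integrableOn_halfLineEnergy b α hu h0
  · exact integrableOn_Ioi_of_eq_zero_Ici (N := N) (by fun_prop) fun t ht => by simp [h0 t ht]
  · exact integrableOn_halfLineEnergy b α hcu (N := N) fun t ht => by simp [h0 t ht]
  · exact integrableOn_Ioi_of_eq_zero_Ici (N := N) (by fun_prop) fun t ht => by simp [h0 t ht]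
  refine setIntegral_mono
    ((integrableOn_halfLineEnergy b α hcu (N := N) fun t ht => by simp [h0 t ht]).add
      (integrableOn_Ioi_of_eq_zero_Ici (N := N) (by fun_prop) fun t ht => by simp [h0 t ht]))
    ((integrableOn_halfLineEnergy b α hu h0).add
      (integrableOn_Ioi_of_eq_zero_Ici (N := N) (by fun_prop) fun t ht => by simp [h0 t ht]))
    fun t => ?_
  simp only [deriv_cos_mul hu hθ]
  have hq : (1:ℝ) / b = 2 * (1 / (2 * b)) := by field_simp
  have hq0 : 0 < 1 / (2 * b) := by positivity
  rw [hq]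
  set q := 1 / (2 * b)
  have hs : Real.sin (θ t) ^ 2 = 1 - Real.cos (θ t) ^ 2 := by
    linarith [Real.sin_sq_add_cos_sq (θ t)]
  have hc1 : Real.cos (θ t) ^ 4 ≤ 1 := by
    have := Real.cos_sq_le_one (θ t)
    nlinarith [sq_nonneg (Real.cos (θ t))]
  have h4 := mul_nonneg (mul_nonneg hq0.le (sub_nonneg.2 hc1)) (by positivity : 0 ≤ u t ^ 4)
  have hsq := sq_nonneg (Real.sin (θ t) * deriv u t + Real.cos (θ t) * deriv θ t * u t)
  set s := Real.sin (θ t)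
  set c := Real.cos (θ t)
  set d := deriv θ t
  set v := u t
  set v' := deriv u t
  have e : (v' ^ 2 + (t + α) ^ 2 * v ^ 2 - q * (2 * v ^ 2 - v ^ 4) + d ^ 2 * v ^ 2)
      - ((-s * d * v + c * v') ^ 2 + (t + α) ^ 2 * (c * v) ^ 2
        - q * (2 * (c * v) ^ 2 - (c * v) ^ 4) + ((t + α) ^ 2 - 2 * q) * (s ^ 2 * v ^ 2))
      = (s * v' + c * d * v) ^ 2 + q * (1 - c ^ 4) * v ^ 4
        + (1 - (s ^ 2 + c ^ 2)) * (v' ^ 2 + d ^ 2 * v ^ 2 + ((t + α) ^ 2 - 2 * q) * v ^ 2) := by ring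
  rw [hs] at e
  have e' : (1 - (1 - c ^ 2 + c ^ 2)) = (0:ℝ) := by ring
  rw [e', zero_mul, add_zero] at e
  rw [hs]
  linarith

/-- The ground state energy of the harmonic oscillator is `1`; on the half-line this bound holds
for functions vanishing at the origin. -/
lemma integral_sq_le_oscillator (α : ℝ) (hu : ContDiff ℝ 1 u) (h0 : ∀ t, N ≤ t → u t = 0)
    (hz : u 0 = 0) :
    ∫ t in Ioi (0:ℝ), u t ^ 2 ≤ ∫ t in Ioi (0:ℝ), (deriv u t ^ 2 + (t + α) ^ 2 * u t ^ 2) := by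
  have c1 := hu.continuous
  have c2 := hu.continuous_deriv le_rfl
  have hd0 := deriv_eq_zero_of_eq_zero_Ici hu h0
  have key : ∫ t in Ioi (0:ℝ), (u t ^ 2 + 2 * ((t + α) * (u t * deriv u t))) = 0 := by
    have hD : ∀ t ∈ Ici (0:ℝ), HasDerivAt (fun t => (t + α) * u t ^ 2)
        (u t ^ 2 + 2 * ((t + α) * (u t * deriv u t))) t := by
      intro t _
      have := ((hasDerivAt_id t).add_const α).mul
        (((hu.differentiable (by simp)) t).hasDerivAt.pow 2)
      convert! this using 1
      simp only [id, Nat.cast_ofNat, Pi.pow_apply]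
      ring
    have := integral_Ioi_of_hasDerivAt_of_tendsto' (m := 0) hD
      (integrableOn_Ioi_of_eq_zero_Ici (N := N) (by fun_prop) fun t ht => by simp [h0 t ht])
      (tendsto_const_nhds.congr' (by
        filter_upwards [eventually_ge_atTop N] with t ht
        simp [h0 t ht]))
    rw [this, hz]; ring
  have h1 : IntegrableOn (fun t => u t ^ 2) (Ioi 0) :=
    integrableOn_Ioi_of_eq_zero_Ici (N := N) (by fun_prop) fun t ht => by simp [h0 t ht]
  have h2 : IntegrableOn (fun t => deriv u t ^ 2 + (t + α) ^ 2 * u t ^ 2) (Ioi 0) :=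
    integrableOn_Ioi_of_eq_zero_Ici (N := N) (by fun_prop) fun t ht => by simp [h0 t ht, hd0 t ht]
  have h3 : IntegrableOn (fun t => u t ^ 2 + 2 * ((t + α) * (u t * deriv u t))) (Ioi 0) :=
    integrableOn_Ioi_of_eq_zero_Ici (N := N) (by fun_prop) fun t ht => by simp [h0 t ht]
  have h4 : ∫ t in Ioi (0:ℝ), (u t ^ 2 - (u t ^ 2 + 2 * ((t + α) * (u t * deriv u t))))
      ≤ ∫ t in Ioi (0:ℝ), (deriv u t ^ 2 + (t + α) ^ 2 * u t ^ 2) := by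
    refine setIntegral_mono (h1.sub h3) h2 fun t => ?_
    show u t ^ 2 - (u t ^ 2 + 2 * ((t + α) * (u t * deriv u t)))
      ≤ deriv u t ^ 2 + (t + α) ^ 2 * u t ^ 2
    nlinarith [sq_nonneg (deriv u t + (t + α) * u t)]
  rw [integral_sub h1 h3, key, sub_zero] at h4
  exact h4

lemma halfLineEnergy_nonneg_of_one_le (hb : 1 ≤ b) (hα : 1 ≤ α) (u : ℝ → ℝ) :
    0 ≤ halfLineEnergy b α u := by
  refine setIntegral_nonneg measurableSet_Ioi fun t ht => ?_
  have ht' : 0 < t := ht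
  have h1 : 1 ≤ (t + α) ^ 2 := by nlinarith
  have hq : 1 / (2 * b) ≤ 1 / 2 := by apply one_div_le_one_div_of_le <;> linarith
  have hq0 : 0 < 1 / (2 * b) := by positivity
  set q := 1 / (2 * b)
  nlinarith [sq_nonneg (deriv u t), mul_le_mul_of_nonneg_right h1 (sq_nonneg (u t)),
    mul_le_mul_of_nonneg_right hq (sq_nonneg (u t)), mul_nonneg hq0.le (by positivity : 0 ≤ u t ^ 4)]

/-- If the potential well sits far inside the half-line, the energy is nonnegative, because for
`b > 1` the harmonic oscillator energy `1` exceeds `1 / b`. -/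
lemma exists_halfLineEnergy_nonneg (hb : 1 < b) :
    ∃ a : ℝ, 0 < a ∧ ∀ α ≤ -a, ∀ (u : ℝ → ℝ) (N : ℝ), ContDiff ℝ 1 u →
      (∀ t, N ≤ t → u t = 0) → 0 ≤ halfLineEnergy b α u := by
  obtain ⟨C, hC1, hC⟩ := exists_bound_deriv_smoothTransition
  have hκ : 0 < 1 - 1 / b := by
    rw [sub_pos, div_lt_one (by linarith)]; exact hb
  set κ := 1 - 1 / b with hκdef
  -- the length of the transition region makes the localization error smaller than `κ`
  obtain ⟨l, hl0, hl⟩ : ∃ l : ℝ, 0 < l ∧ (2 * C / l) ^ 2 ≤ κ := by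
    refine ⟨2 * C / √κ, by positivity, ?_⟩
    have : 2 * C / (2 * C / √κ) = √κ := by
      have := (Real.sqrt_pos.2 hκ).ne'; field_simp
    rw [this, Real.sq_sqrt hκ.le]
  refine ⟨l + 1, by linarith, fun α hα u N hu h0 => ?_⟩
  let θ : ℝ → ℝ := fun t => Real.pi / 2 * Real.smoothTransition (t / l)
  have hθ : ContDiff ℝ 1 θ :=
    contDiff_const.mul (Real.smoothTransition.contDiff.comp (contDiff_id.div_const l))
  have hθd : ∀ t, deriv θ t = Real.pi / 2 * (deriv Real.smoothTransition (t / l) / l) := fun t => by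
    have h1 : HasDerivAt (fun t => t / l) (1 / l) t := (hasDerivAt_id t).div_const l
    have := ((hasDerivAt_smoothTransition (t / l)).comp t h1).const_mul (Real.pi / 2)
    rw [show deriv θ t = _ from this.deriv]; ring
  have hθ2 : ∀ t, deriv θ t ^ 2 ≤ κ := fun t => by
    refine le_trans ?_ hl
    rw [hθd]
    have h1 := hC (t / l)
    have hp := Real.pi_lt_four
    have hp0 := Real.pi_pos
    have h2 : |Real.pi / 2 * (deriv Real.smoothTransition (t / l) / l)| ≤ 2 * C / l := by
      rw [abs_mul, abs_of_pos (by positivity : 0 < Real.pi / 2), abs_div, abs_of_pos hl0, mul_div_assoc]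
      exact mul_le_mul (by linarith) (by gcongr) (by positivity) (by norm_num)
    exact sq_le_sq' (by linarith [(abs_le.1 h2).1]) (abs_le.1 h2).2
  have c1 := hu.continuous
  have c2 := hu.continuous_deriv le_rfl
  have c3 := hθ.continuous
  have c4 := hθ.continuous_deriv le_rfl
  have hsu : ContDiff ℝ 1 fun t => Real.sin (θ t) * u t := (Real.contDiff_sin.comp hθ).mul hu
  have hosc := integral_sq_le_oscillator (N := N) α hsu (fun t ht => by simp [h0 t ht])
    (by simp [θ])
  have c5 := hsu.continuous_deriv le_rfl
  have i1 : IntegrableOn (fun t => (Real.sin (θ t) * u t) ^ 2) (Ioi 0) :=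
    integrableOn_Ioi_of_eq_zero_Ici (N := N) (by fun_prop) fun t ht => by simp [h0 t ht]
  have hd0 := deriv_eq_zero_of_eq_zero_Ici hsu (N := N) (fun t ht => by simp [h0 t ht])
  have i2 : IntegrableOn (fun t => deriv (fun t => Real.sin (θ t) * u t) t ^ 2
      + (t + α) ^ 2 * (Real.sin (θ t) * u t) ^ 2) (Ioi 0) :=
    integrableOn_Ioi_of_eq_zero_Ici (N := N) (by fun_prop) fun t ht => by
      simp [h0 t ht, hd0 t ht]
  have i3 := integrableOn_halfLineEnergy b α hu h0
  have : (0:ℝ) ≤ halfLineEnergy b α u - ∫ t in Ioi (0:ℝ), ((deriv (fun t => Real.sin (θ t) * u t) t ^ 2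
      + (t + α) ^ 2 * (Real.sin (θ t) * u t) ^ 2) - (Real.sin (θ t) * u t) ^ 2) := by
    unfold halfLineEnergy
    have i4 : IntegrableOn (fun t => deriv (fun t => Real.sin (θ t) * u t) t ^ 2
      + (t + α) ^ 2 * (Real.sin (θ t) * u t) ^ 2 - (Real.sin (θ t) * u t) ^ 2) (Ioi 0) := i2.sub i1
    rw [← integral_sub i3 i4]
    refine setIntegral_nonneg measurableSet_Ioi fun t ht => ?_
    have ht' : 0 < t := ht
    simp only [deriv_sin_mul hu hθ]
    have hq : 2 * (1 / (2 * b)) = 1 - κ := by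
      rw [hκdef]; field_simp; ring
    have hq0 : 0 < 1 / (2 * b) := by positivity
    set q := 1 / (2 * b)
    have hcs : Real.cos (θ t) ^ 2 * (t + α) ^ 2 ≥ Real.cos (θ t) ^ 2 := by
      rcases le_total t l with h | h
      · have : 1 ≤ (t + α) ^ 2 := by nlinarith
        exact le_mul_of_one_le_right (sq_nonneg _) this
      · have : Real.cos (θ t) = 0 := by
          simp only [θ]
          rw [Real.smoothTransition.one_of_one_le ((one_le_div hl0).2 h), mul_one, Real.cos_pi_div_two]
        rw [this]; norm_num
    have hd2 := hθ2 t
    have hs : Real.sin (θ t) ^ 2 = 1 - Real.cos (θ t) ^ 2 := by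
      linarith [Real.sin_sq_add_cos_sq (θ t)]
    have hsq := sq_nonneg (Real.cos (θ t) * deriv u t - Real.sin (θ t) * deriv θ t * u t)
    set s := Real.sin (θ t)
    set c := Real.cos (θ t)
    set d := deriv θ t
    set v := u t
    set v' := deriv u t
    have e : v' ^ 2 + (t + α) ^ 2 * v ^ 2 - q * (2 * v ^ 2 - v ^ 4)
        - ((c * d * v + s * v') ^ 2 + (t + α) ^ 2 * (s * v) ^ 2 - (s * v) ^ 2)
        = (c * v' - s * d * v) ^ 2 + (c ^ 2 * (t + α) ^ 2 - c ^ 2) * v ^ 2 + (κ - d ^ 2) * v ^ 2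
          + q * v ^ 4 + (1 - (s ^ 2 + c ^ 2)) * (v' ^ 2 + d ^ 2 * v ^ 2 + (t + α) ^ 2 * v ^ 2 - v ^ 2)
          + (1 - κ - 2 * q) * v ^ 2 := by ring
    have e' : (1 - (s ^ 2 + c ^ 2)) = (0:ℝ) := by rw [hs]; ring
    have e'' : 1 - κ - 2 * q = 0 := by rw [hq]; ring
    rw [e', e'', zero_mul, zero_mul, add_zero, add_zero] at e
    rw [e]
    have a1 : 0 ≤ (c ^ 2 * (t + α) ^ 2 - c ^ 2) * v ^ 2 := mul_nonneg (by linarith) (sq_nonneg _)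
    have a2 : 0 ≤ (κ - d ^ 2) * v ^ 2 := mul_nonneg (by linarith) (sq_nonneg _)
    have a3 : 0 ≤ q * v ^ 4 := by positivity
    linarith
  rw [integral_sub i2 i1] at this
  linarith

/-- The energy controls the `H¹` norm, up to a constant not depending on `α`. -/
lemma exists_integral_sq_le_halfLineEnergy (hb : 1 ≤ b) :
    ∃ K : ℝ, 0 ≤ K ∧ ∀ (α : ℝ) (u : ℝ → ℝ) (N : ℝ), ContDiff ℝ 1 u → (∀ t, N ≤ t → u t = 0) →
      ∫ t in Ioi (0:ℝ), (deriv u t ^ 2 + u t ^ 2) ≤ halfLineEnergy b α u + K := by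
  have hb0 : 0 < b := by linarith
  have hq0 : 0 < 1 / (2 * b) := by positivity
  have hq : 1 / (2 * b) ≤ 1 / 2 := by apply one_div_le_one_div_of_le <;> linarith
  set q := 1 / (2 * b) with hqdef
  set k := (2 * q + 1) ^ 2 / (4 * q) with hk
  have hk0 : 0 ≤ k := by positivity
  refine ⟨k * 4, by positivity, fun α u N hu h0 => ?_⟩
  have c1 := hu.continuous
  have c2 := hu.continuous_deriv le_rfl
  have hd0 := deriv_eq_zero_of_eq_zero_Ici hu h0
  have i0 : IntegrableOn ((Icc (-α - 2) (-α + 2)).indicator fun _ => k) (Ioi 0) :=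
    ((integrable_indicator_iff measurableSet_Icc).2
      (integrableOn_const (by simp))).integrableOn
  have i1 := integrableOn_halfLineEnergy b α hu h0
  have h1 : ∫ t in Ioi (0:ℝ), (Icc (-α - 2) (-α + 2)).indicator (fun _ => k) t ≤ k * 4 := by
    rw [setIntegral_indicator measurableSet_Icc, setIntegral_const, smul_eq_mul, mul_comm]
    apply mul_le_mul_of_nonneg_left _ hk0
    calc _ ≤ volume.real (Icc (-α - 2) (-α + 2)) :=
          measureReal_mono inter_subset_right (by rw [Real.volume_Icc]; exact ENNReal.ofReal_ne_top)
      _ = 4 := by rw [Real.volume_real_Icc]; rw [max_eq_left] <;> linarith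
  refine le_trans ?_ (add_le_add_right h1 _)
  unfold halfLineEnergy
  rw [← integral_add i1 i0]
  refine setIntegral_mono
    (integrableOn_Ioi_of_eq_zero_Ici (N := N) (by fun_prop) fun t ht => by simp [h0 t ht, hd0 t ht])
    (i1.add i0) fun t => ?_
  show deriv u t ^ 2 + u t ^ 2 ≤ (deriv u t ^ 2 + (t + α) ^ 2 * u t ^ 2
      - q * (2 * u t ^ 2 - u t ^ 4)) + (Icc (-α - 2) (-α + 2)).indicator (fun _ => k) t
  by_cases ht : t ∈ Icc (-α - 2) (-α + 2)
  · rw [indicator_of_mem ht]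
    have e : q * u t ^ 4 - (2 * q + 1) * u t ^ 2 + k = q * (u t ^ 2 - (2 * q + 1) / (2 * q)) ^ 2 := by
      rw [hk]; field_simp; ring
    have : 0 ≤ q * (u t ^ 2 - (2 * q + 1) / (2 * q)) ^ 2 := by positivity
    have h3 : 0 ≤ (t + α) ^ 2 * u t ^ 2 := by positivity
    linarith
  · rw [indicator_of_notMem ht]
    have h3 : 2 ≤ (t + α) ^ 2 := by
      by_contra h4
      rw [not_le] at h4
      exact ht ⟨by nlinarith, by nlinarith⟩
    have h4 := mul_le_mul_of_nonneg_right h3 (sq_nonneg (u t))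
    have h5 := mul_le_mul_of_nonneg_right hq (sq_nonneg (u t))
    have h6 : 0 ≤ q * u t ^ 4 := by positivity
    linarith

end Localization

/-! ### Exponentially localized near-minimizers -/

/-- A smooth angle, rising from `0` to `π / 2` on the interval `[n, n + 1]`. -/
def cutoffAngle (n t : ℝ) : ℝ := Real.pi / 2 * Real.smoothTransition (t - n)

lemma contDiff_cutoffAngle (n : ℝ) : ContDiff ℝ 1 (cutoffAngle n) :=
  contDiff_const.mul (Real.smoothTransition.contDiff.comp (contDiff_id.sub contDiff_const))

lemma sin_cutoffAngle_of_le {n t : ℝ} (h : t ≤ n) : Real.sin (cutoffAngle n t) = 0 := by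
  rw [cutoffAngle, Real.smoothTransition.zero_of_nonpos (by linarith), mul_zero, Real.sin_zero]

lemma cos_cutoffAngle_of_ge {n t : ℝ} (h : n + 1 ≤ t) : Real.cos (cutoffAngle n t) = 0 := by
  rw [cutoffAngle, Real.smoothTransition.one_of_one_le (by linarith), mul_one, Real.cos_pi_div_two]

lemma sin_cutoffAngle_of_ge {n t : ℝ} (h : n + 1 ≤ t) : Real.sin (cutoffAngle n t) = 1 := by
  rw [cutoffAngle, Real.smoothTransition.one_of_one_le (by linarith), mul_one, Real.sin_pi_div_two]

lemma deriv_cutoffAngle (n t : ℝ) :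
    deriv (cutoffAngle n) t = Real.pi / 2 * deriv Real.smoothTransition (t - n) :=
  (((hasDerivAt_smoothTransition (t - n)).comp_sub_const t n).const_mul (Real.pi / 2)).deriv

lemma exists_bound_deriv_cutoffAngle :
    ∃ c : ℝ, 1 ≤ c ∧ ∀ n t, deriv (cutoffAngle n) t ^ 2 ≤ (Ioi n).indicator (fun _ => c) t := by
  obtain ⟨C, hC1, hC⟩ := exists_bound_deriv_smoothTransition
  refine ⟨(2 * C) ^ 2, by nlinarith, fun n t => ?_⟩
  by_cases ht : t ∈ Ioi n
  · rw [indicator_of_mem ht, deriv_cutoffAngle]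
    have h1 := hC (t - n)
    have hp := Real.pi_lt_four
    have hp0 := Real.pi_pos
    have h2 : |Real.pi / 2 * deriv Real.smoothTransition (t - n)| ≤ 2 * C := by
      rw [abs_mul, abs_of_pos (by positivity : 0 < Real.pi / 2)]
      exact mul_le_mul (by linarith) h1 (by positivity) (by norm_num)
    exact sq_le_sq' (by linarith [(abs_le.1 h2).1]) (abs_le.1 h2).2
  · rw [indicator_of_notMem ht, deriv_cutoffAngle,
      deriv_smoothTransition_eq_zero (Or.inl (by linarith [not_lt.1 (show ¬ n < t from ht)]))]
    norm_num

/-- One step of the Agmon-type decay estimate, by comparison of a near-minimizer with its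
truncation: `T (n + 1)` is controlled by `T n`, where `T s` is the mass on `(s, ∞)`. -/
lemma tail_succ_le {b α c δ N : ℝ} {u : ℝ → ℝ} (hb : 1 ≤ b) (hc : 1 ≤ c)
    (hcθ : ∀ n t, deriv (cutoffAngle n) t ^ 2 ≤ (Ioi n).indicator (fun _ => c) t)
    (hu : ContDiff ℝ 1 u) (h0 : ∀ t, N ≤ t → u t = 0)
    (hE : halfLineEnergy b α u ≤ oneDGroundEnergy b + δ) {n : ℝ} (hn0 : 0 ≤ n)
    (hn : ∀ t, n ≤ t → 2 * c + 2 ≤ (t + α) ^ 2) :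
    (2 * c + 1) * ∫ t in Ioi (n + 1), u t ^ 2 ≤ δ + c * ∫ t in Ioi n, u t ^ 2 ∧
    halfLineEnergy b α (fun t => Real.cos (cutoffAngle n t) * u t)
      ≤ halfLineEnergy b α u + c * ∫ t in Ioi n, u t ^ 2 := by
  have hθ := contDiff_cutoffAngle n
  have c1 := hu.continuous
  have c3 := hθ.continuous
  have c4 := hθ.continuous_deriv le_rfl
  have ims := halfLineEnergy_cos_mul_le (α := α) (by linarith : 0 < b) hu h0 hθ
  have hcu : ContDiff ℝ 1 fun t => Real.cos (cutoffAngle n t) * u t :=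
    (Real.contDiff_cos.comp hθ).mul hu
  have hlow := oneDGroundEnergy_le_halfLineEnergy hb α hcu (N := N) fun t ht => by simp [h0 t ht]
  have hb1 : 1 / b ≤ 1 := by rw [div_le_one (by linarith)]; exact hb
  have i0 : IntegrableOn (fun t => u t ^ 2) (Ioi 0) :=
    integrableOn_Ioi_of_eq_zero_Ici (N := N) (by fun_prop) fun t ht => by simp [h0 t ht]
  have i1 : IntegrableOn (fun t => deriv (cutoffAngle n) t ^ 2 * u t ^ 2) (Ioi 0) :=
    integrableOn_Ioi_of_eq_zero_Ici (N := N) (by fun_prop) fun t ht => by simp [h0 t ht]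
  have i2 : IntegrableOn (fun t => ((t + α) ^ 2 - 1 / b) *
      (Real.sin (cutoffAngle n t) ^ 2 * u t ^ 2)) (Ioi 0) :=
    integrableOn_Ioi_of_eq_zero_Ici (N := N) (by fun_prop) fun t ht => by simp [h0 t ht]
  have tail : ∀ s, 0 ≤ s → ∀ r : ℝ, ∫ t in Ioi (0:ℝ), (Ioi s).indicator (fun t => r * u t ^ 2) t
      = r * ∫ t in Ioi s, u t ^ 2 := fun s hs r => by
    rw [setIntegral_indicator measurableSet_Ioi, Ioi_inter_Ioi, sup_of_le_right hs,
      integral_const_mul]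
  have itail : ∀ s r : ℝ, IntegrableOn ((Ioi s).indicator (fun t => r * u t ^ 2)) (Ioi 0) :=
    fun s r => (i0.const_mul r).indicator measurableSet_Ioi
  have h1 : ∫ t in Ioi (0:ℝ), deriv (cutoffAngle n) t ^ 2 * u t ^ 2 ≤ c * ∫ t in Ioi n, u t ^ 2 := by
    rw [← tail n hn0]
    refine setIntegral_mono i1 (itail n c) fun t => ?_
    have := mul_le_mul_of_nonneg_right (hcθ n t) (sq_nonneg (u t))
    by_cases ht : t ∈ Ioi n
    · simpa [indicator_of_mem ht] using this
    · simpa [indicator_of_notMem ht] using this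
  have h2 : (2 * c + 1) * ∫ t in Ioi (n + 1), u t ^ 2 ≤ ∫ t in Ioi (0:ℝ), ((t + α) ^ 2 - 1 / b) *
      (Real.sin (cutoffAngle n t) ^ 2 * u t ^ 2) := by
    rw [← tail (n + 1) (by linarith)]
    refine setIntegral_mono (itail _ _) i2 fun t => ?_
    show (Ioi (n + 1)).indicator (fun t => (2 * c + 1) * u t ^ 2) t ≤ ((t + α) ^ 2 - 1 / b) *
      (Real.sin (cutoffAngle n t) ^ 2 * u t ^ 2)
    rcases le_or_gt t n with h | h
    · rw [indicator_of_notMem (by simp; linarith), sin_cutoffAngle_of_le h]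
      simp
    · have h3 := hn t h.le
      by_cases ht : t ∈ Ioi (n + 1)
      · rw [indicator_of_mem ht, sin_cutoffAngle_of_ge (le_of_lt ht), one_pow, one_mul]
        exact mul_le_mul_of_nonneg_right (by linarith) (sq_nonneg _)
      · rw [indicator_of_notMem ht]
        exact mul_nonneg (by linarith) (by positivity)
  have h3 : 0 ≤ (2 * c + 1) * ∫ t in Ioi (n + 1), u t ^ 2 :=
    mul_nonneg (by linarith) (integral_nonneg fun t => sq_nonneg _)
  constructor <;> linarith

/-- Exponential decay of the mass of near-minimizers, up to the defect `δ` from minimality. -/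
lemma tail_le_pow {b α c δ N n₀ M : ℝ} {u : ℝ → ℝ} (hb : 1 ≤ b) (hc : 1 ≤ c) (hδ : 0 ≤ δ)
    (hcθ : ∀ n t, deriv (cutoffAngle n) t ^ 2 ≤ (Ioi n).indicator (fun _ => c) t)
    (hu : ContDiff ℝ 1 u) (h0 : ∀ t, N ≤ t → u t = 0)
    (hE : halfLineEnergy b α u ≤ oneDGroundEnergy b + δ) (hn0 : 0 ≤ n₀)
    (hn : ∀ t, n₀ ≤ t → 2 * c + 2 ≤ (t + α) ^ 2) (hM : ∫ t in Ioi n₀, u t ^ 2 ≤ M) (k : ℕ) :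
    ∫ t in Ioi (n₀ + k), u t ^ 2 ≤ (1 / 2) ^ k * M + 2 * δ := by
  induction k with
  | zero => simp; linarith
  | succ k ih =>
    have h := (tail_succ_le hb hc hcθ hu h0 hE (n := n₀ + k) (by positivity)
      (fun t ht => hn t (by linarith [(Nat.cast_nonneg k : (0:ℝ) ≤ k)]))).1
    have e : n₀ + ((k + 1 : ℕ) : ℝ) = n₀ + k + 1 := by push_cast; ring
    rw [e]
    set A := ∫ t in Ioi (n₀ + k), u t ^ 2
    set B := ∫ t in Ioi (n₀ + k + 1), u t ^ 2
    have hA : 0 ≤ A := integral_nonneg fun t => sq_nonneg _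
    have h2 : B ≤ A / 2 + δ := by
      have : (2 * c + 1) * B ≤ (2 * c + 1) * (A / 2 + δ) := by nlinarith
      exact le_of_mul_le_mul_left this (by linarith)
    rw [pow_succ]
    linarith

/-- Near-minimizers of the one-dimensional problem with support in `[0, K + m]`, energy within
`M 2⁻ᵐ` of the infimum, and uniformly bounded moments. -/
lemma exists_truncated_near_minimizer {b : ℝ} (hb : 1 < b) (hneg : oneDGroundEnergy b < 0) :
    ∃ K M : ℝ, 0 < K ∧ 0 < M ∧ ∀ m : ℕ, ∃ (α : ℝ) (u : ℝ → ℝ), |α| ≤ M ∧ ContDiff ℝ 1 u ∧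
      (∀ t, K + m ≤ t → u t = 0) ∧
      halfLineEnergy b α u ≤ oneDGroundEnergy b + M * (1 / 2) ^ m ∧
      ∫ t in Ioi (0:ℝ), deriv u t ^ 2 ≤ M ∧ ∫ t in Ioi (0:ℝ), (1 + t) ^ 4 * u t ^ 2 ≤ M := by
  obtain ⟨a, ha0, ha⟩ := exists_halfLineEnergy_nonneg hb
  obtain ⟨L, hL0, hL⟩ := exists_integral_sq_le_halfLineEnergy hb.le
  obtain ⟨c, hc1, hcθ⟩ := exists_bound_deriv_cutoffAngle
  obtain ⟨n₀, hn₀⟩ := exists_nat_ge (a + 1 + (2 * c + 2))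
  have hsum : Summable fun k : ℕ => ((n₀ : ℝ) + k + 2) ^ 4 * (1 / 2 : ℝ) ^ k := by
    have h1 : Summable fun k : ℕ => ((k:ℝ)) ^ 4 * (1 / 2 : ℝ) ^ k :=
      summable_pow_mul_geometric_of_norm_lt_one 4 (by norm_num)
    have h2 : Summable fun k : ℕ => (1 / 2 : ℝ) ^ k :=
      summable_geometric_of_lt_one (by norm_num) (by norm_num)
    refine Summable.of_nonneg_of_le (fun k => by positivity) (fun k => ?_)
      ((h1.mul_left 8).add (h2.mul_left (8 * ((n₀ : ℝ) + 2) ^ 4)))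
    have : ((n₀ : ℝ) + k + 2) ^ 4 ≤ 8 * (k:ℝ) ^ 4 + 8 * ((n₀ : ℝ) + 2) ^ 4 := by
      have h := add_pow_le (a := (k:ℝ)) (b := (n₀:ℝ) + 2) (by positivity) (by positivity) 4
      have e : (n₀ : ℝ) + k + 2 = k + (n₀ + 2) := by ring
      rw [e]; norm_num at h; linarith
    have := mul_le_mul_of_nonneg_right this (by positivity : 0 ≤ (1 / 2 : ℝ) ^ k)
    linarith
  set S := ∑' k : ℕ, ((n₀ : ℝ) + k + 2) ^ 4 * (1 / 2 : ℝ) ^ k with hS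
  have hS0 : 0 ≤ S := tsum_nonneg fun k => by positivity
  set M := a + 1 + (1 + c * (L + 2)) + (L + 1 + c * (L + 2)) + ((1 + (n₀ : ℝ)) ^ 4 * L + (L + 2) * S)
    with hM
  have hcL : 0 ≤ c * (L + 2) := by positivity
  have hMS : 0 ≤ (1 + (n₀ : ℝ)) ^ 4 * L + (L + 2) * S := by positivity
  refine ⟨n₀ + 1, M, by positivity, by positivity, fun m => ?_⟩
  set κ := min 1 (-oneDGroundEnergy b) with hκ
  have hκ0 : 0 < κ := lt_min one_pos (by linarith)
  have hpow : (0:ℝ) < (1 / 2) ^ m := by positivity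
  have hpow1 : (1 / 2 : ℝ) ^ m ≤ 1 := pow_le_one₀ (by norm_num) (by norm_num)
  set δ := κ * (1 / 2 : ℝ) ^ m with hδ
  have hδ0 : 0 < δ := by positivity
  have hδ1 : δ ≤ (1 / 2) ^ m := mul_le_of_le_one_left hpow.le (min_le_left _ _)
  have hδ2 : oneDGroundEnergy b + δ ≤ 0 := by
    have : δ ≤ κ := mul_le_of_le_one_right hκ0.le hpow1
    linarith [min_le_right 1 (-oneDGroundEnergy b)]
  obtain ⟨α, p, hp⟩ := exists_oneDEnergy_lt (b := b) (E := oneDGroundEnergy b + δ) (by linarith)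
  obtain ⟨u, hu, ⟨N, h0⟩, hE⟩ := exists_contDiff_of_oneDEnergy_lt (by linarith) hδ2 p hp
  have hα1 : α < 1 := by
    by_contra h
    have := halfLineEnergy_nonneg_of_one_le hb.le (not_lt.1 h) u
    linarith
  have hα2 : -a < α := by
    by_contra h
    have := ha α (not_lt.1 h) u N hu h0
    linarith
  have c1 := hu.continuous
  have c2 := hu.continuous_deriv le_rfl
  have hd0 := deriv_eq_zero_of_eq_zero_Ici hu h0
  have iu : IntegrableOn (fun t => u t ^ 2) (Ioi 0) :=
    integrableOn_Ioi_of_eq_zero_Ici (N := N) (by fun_prop) fun t ht => by simp [h0 t ht]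
  have hn : ∀ t, (n₀:ℝ) ≤ t → 2 * c + 2 ≤ (t + α) ^ 2 := fun t ht => by nlinarith
  have hmass : ∫ t in Ioi (n₀:ℝ), u t ^ 2 ≤ L := by
    have h1 := hL α u N hu h0
    have h2 : ∫ t in Ioi (0:ℝ), u t ^ 2 ≤ ∫ t in Ioi (0:ℝ), (deriv u t ^ 2 + u t ^ 2) := by
      refine setIntegral_mono iu (integrableOn_Ioi_of_eq_zero_Ici (N := N) (by fun_prop)
        fun t ht => by simp [h0 t ht, hd0 t ht]) fun t => ?_
      show u t ^ 2 ≤ deriv u t ^ 2 + u t ^ 2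
      linarith [sq_nonneg (deriv u t)]
    have h3 : ∫ t in Ioi (n₀:ℝ), u t ^ 2 ≤ ∫ t in Ioi (0:ℝ), u t ^ 2 :=
      setIntegral_mono_set iu (Eventually.of_forall fun t => sq_nonneg _)
        (Ioi_subset_Ioi (by positivity)).eventuallyLE
    linarith
  have hmass0 : ∫ t in Ioi (0:ℝ), u t ^ 2 ≤ L := by
    have h1 := hL α u N hu h0
    have h2 : ∫ t in Ioi (0:ℝ), u t ^ 2 ≤ ∫ t in Ioi (0:ℝ), (deriv u t ^ 2 + u t ^ 2) := by
      refine setIntegral_mono iu (integrableOn_Ioi_of_eq_zero_Ici (N := N) (by fun_prop)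
        fun t ht => by simp [h0 t ht, hd0 t ht]) fun t => ?_
      show u t ^ 2 ≤ deriv u t ^ 2 + u t ^ 2
      linarith [sq_nonneg (deriv u t)]
    linarith
  have htail := tail_le_pow hb.le hc1 hδ0.le hcθ hu h0 hE.le (Nat.cast_nonneg n₀) hn hmass
  have htail' : ∀ k : ℕ, k ≤ m → ∫ t in Ioi ((n₀:ℝ) + k), u t ^ 2 ≤ (L + 2) * (1 / 2) ^ k := by
    intro k hk
    have h1 : (1 / 2 : ℝ) ^ m ≤ (1 / 2) ^ k := pow_le_pow_of_le_one (by norm_num) (by norm_num) hk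
    linarith [htail k]
  -- truncate at distance `n₀ + m`
  set n : ℝ := n₀ + m with hndef
  let ũ : ℝ → ℝ := fun t => Real.cos (cutoffAngle n t) * u t
  have hũ : ContDiff ℝ 1 ũ := (Real.contDiff_cos.comp (contDiff_cutoffAngle n)).mul hu
  have hũ0 : ∀ t, (n₀:ℝ) + 1 + m ≤ t → ũ t = 0 := fun t ht => by
    simp only [ũ]; rw [cos_cutoffAngle_of_ge (by rw [hndef]; linarith), zero_mul]
  have hũu : ∀ t, ũ t ^ 2 ≤ u t ^ 2 := fun t => by
    simp only [ũ]; rw [mul_pow]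
    exact mul_le_of_le_one_left (sq_nonneg _) (Real.cos_sq_le_one _)
  have hEũ : halfLineEnergy b α ũ ≤ halfLineEnergy b α u + c * ((L + 2) * (1 / 2) ^ m) := by
    have := (tail_succ_le hb.le hc1 hcθ hu h0 hE.le (n := n) (by positivity)
      (fun t ht => hn t (by
        have : (0:ℝ) ≤ m := Nat.cast_nonneg m
        rw [hndef] at ht; linarith))).2
    have h2 := mul_le_mul_of_nonneg_left (htail' m le_rfl) (by linarith : 0 ≤ c)
    linarith
  refine ⟨α, ũ, ?_, hũ, hũ0, ?_, ?_, ?_⟩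
  · rw [abs_le]; constructor <;> linarith
  · have h1 : c * ((L + 2) * (1 / 2) ^ m) + δ ≤ M * (1 / 2) ^ m := by
      have : (1 + c * (L + 2)) * (1 / 2) ^ m ≤ M * (1 / 2) ^ m :=
        mul_le_mul_of_nonneg_right (by linarith) hpow.le
      linarith
    linarith
  · have h1 := hL α ũ _ hũ hũ0
    have cu1 := hũ.continuous
    have cu2 := hũ.continuous_deriv le_rfl
    have hdũ0 := deriv_eq_zero_of_eq_zero_Ici hũ hũ0
    have h2 : ∫ t in Ioi (0:ℝ), deriv ũ t ^ 2 ≤ ∫ t in Ioi (0:ℝ), (deriv ũ t ^ 2 + ũ t ^ 2) := by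
      refine setIntegral_mono
        (integrableOn_Ioi_of_eq_zero_Ici (N := n₀ + 1 + m) (by fun_prop)
          fun t ht => by simp [hdũ0 t ht])
        (integrableOn_Ioi_of_eq_zero_Ici (N := n₀ + 1 + m) (by fun_prop)
          fun t ht => by simp [hdũ0 t ht, hũ0 t ht]) fun t => ?_
      show deriv ũ t ^ 2 ≤ deriv ũ t ^ 2 + ũ t ^ 2
      linarith [sq_nonneg (ũ t)]
    have h3 : c * ((L + 2) * (1 / 2) ^ m) ≤ c * (L + 2) := by
      rw [← mul_assoc]; exact mul_le_of_le_one_right hcL hpow1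
    linarith
  · have cu1 := hũ.continuous
    have iw : IntegrableOn (fun t => (1 + t) ^ 4 * ũ t ^ 2) (Ioi 0) :=
      integrableOn_Ioi_of_eq_zero_Ici (N := n₀ + 1 + m) (by fun_prop) fun t ht => by simp [hũ0 t ht]
    -- the fourth moment is summed over unit intervals beyond `n₀`
    have hmom : ∀ j : ℕ, j ≤ m + 1 → ∫ t in Ioc (0:ℝ) (n₀ + j), (1 + t) ^ 4 * ũ t ^ 2
        ≤ (1 + (n₀:ℝ)) ^ 4 * L
          + (L + 2) * ∑ k ∈ Finset.range j, ((n₀ : ℝ) + k + 2) ^ 4 * (1 / 2 : ℝ) ^ k := by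
      intro j
      induction j with
      | zero =>
        intro _
        simp only [Nat.cast_zero, add_zero, Finset.range_zero, Finset.sum_empty, mul_zero]
        calc ∫ t in Ioc (0:ℝ) n₀, (1 + t) ^ 4 * ũ t ^ 2
            ≤ ∫ t in Ioc (0:ℝ) n₀, (1 + (n₀:ℝ)) ^ 4 * u t ^ 2 := by
              refine setIntegral_mono_on (iw.mono_set fun x hx => hx.1)
                ((iu.mono_set fun x hx => hx.1).const_mul _) measurableSet_Ioc fun t ht => ?_
              have h1 : (1 + t) ^ 4 ≤ (1 + (n₀:ℝ)) ^ 4 :=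
                pow_le_pow_left₀ (by linarith [ht.1]) (by linarith [ht.2]) 4
              exact mul_le_mul h1 (hũu t) (sq_nonneg _) (by positivity)
          _ ≤ (1 + (n₀:ℝ)) ^ 4 * L := by
              rw [integral_const_mul]
              apply mul_le_mul_of_nonneg_left _ (by positivity)
              exact (setIntegral_mono_set iu (Eventually.of_forall fun t => sq_nonneg _)
                (show Ioc (0:ℝ) n₀ ⊆ Ioi 0 from fun x hx => hx.1).eventuallyLE).trans hmass0
      | succ j ih =>
        intro hj
        have ih' := ih (by omega)
        rw [Finset.sum_range_succ, mul_add]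
        have hj0 : (0:ℝ) ≤ j := Nat.cast_nonneg j
        have hn00 : (0:ℝ) ≤ n₀ := Nat.cast_nonneg n₀
        have hsplit : Ioc (0:ℝ) (n₀ + ((j + 1 : ℕ) : ℝ)) = Ioc 0 ((n₀:ℝ) + j) ∪ Ioc (n₀ + j) (n₀ + j + 1) := by
          rw [Ioc_union_Ioc_eq_Ioc (by positivity) (by linarith)]
          push_cast; ring_nf
        rw [hsplit, setIntegral_union (Ioc_disjoint_Ioc_of_le le_rfl) measurableSet_Ioc
          (iw.mono_set fun x hx => hx.1)
          (iw.mono_set fun x hx => lt_of_le_of_lt (by positivity) hx.1)]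
        have h2 : ∫ t in Ioc ((n₀:ℝ) + j) (n₀ + j + 1), (1 + t) ^ 4 * ũ t ^ 2
            ≤ ((n₀ : ℝ) + j + 2) ^ 4 * ((L + 2) * (1 / 2 : ℝ) ^ j) := by
          have hsub : Ioc ((n₀:ℝ) + j) (n₀ + j + 1) ⊆ Ioi 0 :=
            fun x hx => lt_of_le_of_lt (by positivity) hx.1
          calc ∫ t in Ioc ((n₀:ℝ) + j) (n₀ + j + 1), (1 + t) ^ 4 * ũ t ^ 2
              ≤ ∫ t in Ioc ((n₀:ℝ) + j) (n₀ + j + 1), ((n₀ : ℝ) + j + 2) ^ 4 * u t ^ 2 := by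
                refine setIntegral_mono_on (iw.mono_set hsub)
                  ((iu.mono_set hsub).const_mul _) measurableSet_Ioc fun t ht => ?_
                have h1 : (1 + t) ^ 4 ≤ ((n₀ : ℝ) + j + 2) ^ 4 :=
                  pow_le_pow_left₀ (by linarith [ht.1]) (by linarith [ht.2]) 4
                exact mul_le_mul h1 (hũu t) (sq_nonneg _) (by positivity)
            _ ≤ _ := by
                rw [integral_const_mul]
                apply mul_le_mul_of_nonneg_left _ (by positivity)
                refine (setIntegral_mono_set (iu.mono_set (Ioi_subset_Ioi (by positivity)))
                  (Eventually.of_forall fun t => sq_nonneg _)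
                  (show Ioc ((n₀:ℝ) + j) (n₀ + j + 1) ⊆ Ioi (n₀ + j) from
                    fun x hx => hx.1).eventuallyLE).trans (htail' j (by omega))
        linarith
    have hfin := hmom (m + 1) le_rfl
    have hle : ∑ k ∈ Finset.range (m + 1), ((n₀ : ℝ) + k + 2) ^ 4 * (1 / 2 : ℝ) ^ k ≤ S :=
      hsum.sum_le_tsum _ fun k _ => by positivity
    have heq : ∫ t in Ioi (0:ℝ), (1 + t) ^ 4 * ũ t ^ 2
        = ∫ t in Ioc (0:ℝ) (n₀ + ((m + 1 : ℕ) : ℝ)), (1 + t) ^ 4 * ũ t ^ 2 := by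
      refine setIntegral_eq_of_subset_of_forall_sdiff_eq_zero measurableSet_Ioi (fun x hx => hx.1) ?_
      intro t ht
      have : (n₀:ℝ) + 1 + m ≤ t := by
        by_contra h
        refine ht.2 ⟨ht.1, ?_⟩
        push_cast
        linarith
      rw [hũ0 t this]; ring
    rw [heq]
    have := mul_le_mul_of_nonneg_left hle (by linarith : 0 ≤ L + 2)
    linarith

/-! ### The boundary of a curvilinear polygon in a chart -/

/-- The plane as a product of two lines. -/
def planeHomeo : Plane ≃ₜ ℝ × ℝ :=
  (EuclideanSpace.equiv (Fin 2) ℝ).toHomeomorph.trans (Homeomorph.finTwoArrow)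

@[simp] lemma planeHomeo_apply (r : Plane) : planeHomeo r = (r 0, r 1) := rfl

lemma mem_frontier_halfPlane₀ (q : Plane) : q ∈ frontier {r : Plane | r 0 < 0} ↔ q 0 = 0 := by
  have : {r : Plane | r 0 < 0} = planeHomeo ⁻¹' (Iio 0 ×ˢ univ) := by ext; simp
  rw [this, ← planeHomeo.preimage_frontier, frontier_prod_eq]
  simp

lemma mem_frontier_halfPlane₁ (q : Plane) : q ∈ frontier {r : Plane | r 1 < 0} ↔ q 1 = 0 := by
  have : {r : Plane | r 1 < 0} = planeHomeo ⁻¹' (univ ×ˢ Iio 0) := by ext; simp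
  rw [this, ← planeHomeo.preimage_frontier, frontier_prod_eq]
  simp

lemma mem_frontier_quadrant (q : Plane) : q ∈ frontier {r : Plane | r 0 < 0 ∧ r 1 < 0} ↔
    (q 0 ≤ 0 ∧ q 1 = 0) ∨ (q 0 = 0 ∧ q 1 ≤ 0) := by
  have : {r : Plane | r 0 < 0 ∧ r 1 < 0} = planeHomeo ⁻¹' (Iio 0 ×ˢ Iio 0) := by ext; simp
  rw [this, ← planeHomeo.preimage_frontier, frontier_prod_eq]
  simp

lemma mem_frontier_coquadrant (q : Plane) : q ∈ frontier {r : Plane | r 0 < 0 ∨ r 1 < 0} ↔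
    (0 ≤ q 0 ∧ q 1 = 0) ∨ (q 0 = 0 ∧ 0 ≤ q 1) := by
  have : {r : Plane | r 0 < 0 ∨ r 1 < 0}ᶜ = planeHomeo ⁻¹' (Ici 0 ×ˢ Ici 0) := by ext; simp
  rw [← frontier_compl, this, ← planeHomeo.preimage_frontier, frontier_prod_eq]
  simp

/-- Near `q₀`, the set `T` is the union of the two rays starting at `q₀` in the directions of the
unit vectors `v₁` and `v₂`, which make an angle of at least `π / 2`. -/
def IsTwoRaysNear (T : Set Plane) (q₀ : Plane) (v : Fin 2 → Plane) (δ : ℝ) : Prop :=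
  (∀ k, ‖v k‖ = 1) ∧ inner ℝ (v 0) (v 1) ≤ 0 ∧
    ∀ q ∈ Metric.ball q₀ δ, q ∈ T ↔ ∃ k, ∃ s : ℝ, 0 ≤ s ∧ q = q₀ + s • v k

lemma abs_coord_sub_lt {q q₀ : Plane} {δ : ℝ} (h : q ∈ Metric.ball q₀ δ) (j : Fin 2) :
    |q j - q₀ j| < δ := by
  have h1 := PiLp.norm_apply_le (p := 2) (q - q₀) j
  rw [Metric.mem_ball, dist_eq_norm] at h
  exact lt_of_le_of_lt h1 h

lemma e_apply (i j : Fin 2) : e i j = if j = i then 1 else 0 := by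
  simp [e]

lemma norm_e (j : Fin 2) : ‖e j‖ = 1 := by simp [e]

/-- If `T` is, near `q₀`, the coordinate line through `q₀` in direction `e j`, it consists of two
opposite rays. -/
lemma isTwoRaysNear_of_line {T : Set Plane} {q₀ : Plane} {δ : ℝ} (i j : Fin 2) (hij : i ≠ j)
    (h : ∀ q ∈ Metric.ball q₀ δ, q ∈ T ↔ q i = q₀ i) :
    IsTwoRaysNear T q₀ ![e j, -e j] δ := by
  refine ⟨?_, ?_, fun q hq => ?_⟩
  · intro k; fin_cases k <;> simp [norm_e]
  · simp [norm_e]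
  · rw [h q hq]
    constructor
    · intro hi
      rcases le_total 0 (q j - q₀ j) with h0 | h0
      · refine ⟨0, q j - q₀ j, h0, ?_⟩
        ext k
        rcases eq_or_ne k j with rfl | hk
        · simp [e_apply]
        · have : k = i := by omega
          subst this
          simp [e_apply, hij, hi]
      · refine ⟨1, q₀ j - q j, by linarith, ?_⟩
        ext k
        rcases eq_or_ne k j with rfl | hk
        · simp [e_apply]
        · have : k = i := by omega
          subst this
          simp [e_apply, hij, hi]
    · rintro ⟨k, s, -, rfl⟩
      fin_cases k <;> simp [e_apply, hij]

/-- If `T` is, near the origin, the union of the two coordinate half-axes on the side given by the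
sign `a`, it consists of two orthogonal rays. -/
lemma isTwoRaysNear_of_corner {T : Set Plane} {q₀ : Plane} {a : ℝ} (ha : a = 1 ∨ a = -1)
    (h0 : q₀ 0 = 0) (h1 : q₀ 1 = 0)
    (h : ∀ q : Plane, q ∈ T ↔ (0 ≤ a * q 0 ∧ q 1 = 0) ∨ (q 0 = 0 ∧ 0 ≤ a * q 1)) :
    IsTwoRaysNear T q₀ ![a • e 0, a • e 1] 1 := by
  have ha2 : a * a = 1 := by rcases ha with rfl | rfl <;> norm_num
  have haa : |a| = 1 := by rcases ha with rfl | rfl <;> norm_num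
  refine ⟨?_, ?_, fun q hq => ?_⟩
  · intro k; fin_cases k <;> simp [norm_e, norm_smul, haa]
  · simp [inner_smul_left, inner_smul_right, e, EuclideanSpace.inner_single_left]
  · rw [h q]
    constructor
    · rintro (⟨p1, p2⟩ | ⟨p1, p2⟩)
      · refine ⟨0, a * q 0, p1, ?_⟩
        ext k
        fin_cases k
        · simp [e_apply, h0]; linear_combination (-q 0) * ha2
        · simp [e_apply, h1, p2]
      · refine ⟨1, a * q 1, p2, ?_⟩
        ext k
        fin_cases k
        · simp [e_apply, h0, p1]
        · simp [e_apply, h1]; linear_combination (-q 1) * ha2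
    · rintro ⟨k, s, hs, rfl⟩
      fin_cases k
      · left
        simp only [Fin.zero_eta, Matrix.cons_val_zero, PiLp.add_apply, PiLp.smul_apply, h0, h1,
          smul_eq_mul]
        simp [e_apply]
        have : a * (s * a) = s := by linear_combination s * ha2
        rw [this]; exact hs
      · right
        simp only [Fin.mk_one, Matrix.cons_val_one, PiLp.add_apply, PiLp.smul_apply, h0, h1,
          smul_eq_mul]
        simp [e_apply]
        have : a * (s * a) = s := by linear_combination s * ha2
        rw [this]; exact hs

/-- The boundary of the union of two half-axes on the side of the sign `a`, seen from any of its
points. -/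
lemma exists_isTwoRaysNear_of_axes {T : Set Plane} {a : ℝ} (ha : a = 1 ∨ a = -1)
    (h : ∀ q : Plane, q ∈ T ↔ (0 ≤ a * q 0 ∧ q 1 = 0) ∨ (q 0 = 0 ∧ 0 ≤ a * q 1))
    {q₀ : Plane} (hq : q₀ ∈ T) : ∃ v δ, 0 < δ ∧ IsTwoRaysNear T q₀ v δ := by
  have haa : |a| = 1 := by rcases ha with rfl | rfl <;> norm_num
  by_cases h0 : q₀ 0 = 0
  · by_cases h1 : q₀ 1 = 0
    · exact ⟨_, 1, one_pos, isTwoRaysNear_of_corner ha h0 h1 h⟩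
    · have hpos : 0 < a * q₀ 1 := by
        rcases (h q₀).1 hq with hh | hh
        · exact absurd hh.2 h1
        · refine lt_of_le_of_ne hh.2 (Ne.symm (mul_ne_zero ?_ h1))
          rcases ha with rfl | rfl <;> norm_num
      refine ⟨_, a * q₀ 1, hpos, isTwoRaysNear_of_line 0 1 (by decide) fun q hq => ?_⟩
      have hc := abs_coord_sub_lt hq 1
      have hp : 0 < a * q 1 := by
        have h2 : |a * (q 1 - q₀ 1)| < a * q₀ 1 := by rwa [abs_mul, haa, one_mul]
        have := (abs_lt.1 h2).1
        linarith
      rw [h q, h0]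
      constructor
      · rintro (hh | hh)
        · rw [hh.2, mul_zero] at hp; exact absurd hp (lt_irrefl _)
        · exact hh.1
      · intro hh; exact Or.inr ⟨hh, hp.le⟩
  · have hpos : 0 < a * q₀ 0 ∧ q₀ 1 = 0 := by
      rcases (h q₀).1 hq with hh | hh
      · refine ⟨lt_of_le_of_ne hh.1 (Ne.symm (mul_ne_zero ?_ h0)), hh.2⟩
        rcases ha with rfl | rfl <;> norm_num
      · exact absurd hh.1 h0
    refine ⟨_, a * q₀ 0, hpos.1, isTwoRaysNear_of_line 1 0 (by decide) fun q hq => ?_⟩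
    have hc := abs_coord_sub_lt hq 0
    have hp : 0 < a * q 0 := by
      have h2 : |a * (q 0 - q₀ 0)| < a * q₀ 0 := by rwa [abs_mul, haa, one_mul]
      have := (abs_lt.1 h2).1
      linarith
    rw [h q, hpos.2]
    constructor
    · rintro (hh | hh)
      · exact hh.2
      · rw [hh.1, mul_zero] at hp; exact absurd hp (lt_irrefl _)
    · intro hh; exact Or.inl ⟨hp.le, hh⟩

/-- Around every boundary point of a smooth curvilinear polygon, a chart takes the boundary to
two straight rays. -/
lemma IsSmoothCurvilinearPolygon.exists_twoRays {Ω : Set Plane} (h : IsSmoothCurvilinearPolygon Ω)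
    {p : Plane} (hp : p ∈ frontier Ω) :
    ∃ (Φ : OpenPartialHomeomorph Plane Plane) (v : Fin 2 → Plane) (δ : ℝ), p ∈ Φ.source ∧
      ContDiffOn ℝ ∞ Φ Φ.source ∧ ContDiffOn ℝ ∞ Φ.symm Φ.target ∧ 0 < δ ∧
      Metric.ball (Φ p) δ ⊆ Φ.target ∧
      IsTwoRaysNear (Φ.target ∩ Φ.symm ⁻¹' frontier Ω) (Φ p) v δ := by
  obtain ⟨Φ, hpS, h1, h2, hcase⟩ := h p hp
  obtain ⟨T, hT, v, δ₁, hδ₁, hrays⟩ : ∃ T : Set Plane, Ω ∩ Φ.source = {r ∈ Φ.source | Φ r ∈ T} ∧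
      ∃ v δ, 0 < δ ∧ (Φ p ∈ frontier T → IsTwoRaysNear (frontier T) (Φ p) v δ) := by
    rcases hcase with hc | hc | hc | hc
    · refine ⟨{r | r 0 < 0}, hc, ![e 1, -e 1], 1, one_pos, fun hq => ?_⟩
      refine isTwoRaysNear_of_line 0 1 (by decide) fun q _ => ?_
      rw [mem_frontier_halfPlane₀] at hq ⊢
      rw [hq]
    · refine ⟨{r | r 1 < 0}, hc, ![e 0, -e 0], 1, one_pos, fun hq => ?_⟩
      refine isTwoRaysNear_of_line 1 0 (by decide) fun q _ => ?_
      rw [mem_frontier_halfPlane₁] at hq ⊢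
      rw [hq]
    · refine ⟨{r | r 0 < 0 ∧ r 1 < 0}, hc, ?_⟩
      by_cases hq : Φ p ∈ frontier {r : Plane | r 0 < 0 ∧ r 1 < 0}
      · obtain ⟨v, δ, hδ, hv⟩ := exists_isTwoRaysNear_of_axes (a := -1) (Or.inr rfl)
          (fun q => by rw [mem_frontier_quadrant]; simp) hq
        exact ⟨v, δ, hδ, fun _ => hv⟩
      · exact ⟨![0, 0], 1, one_pos, fun h' => absurd h' hq⟩
    · refine ⟨{r | r 0 < 0 ∨ r 1 < 0}, hc, ?_⟩
      by_cases hq : Φ p ∈ frontier {r : Plane | r 0 < 0 ∨ r 1 < 0}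
      · obtain ⟨v, δ, hδ, hv⟩ := exists_isTwoRaysNear_of_axes (a := 1) (Or.inl rfl)
          (fun q => by rw [mem_frontier_coquadrant]; simp) hq
        exact ⟨v, δ, hδ, fun _ => hv⟩
      · exact ⟨![0, 0], 1, one_pos, fun h' => absurd h' hq⟩
  have him : Φ.IsImage Ω T := by
    intro r hr
    have := Set.ext_iff.1 hT r
    simp only [mem_inter_iff, mem_ofPred_eq, hr, and_true, true_and] at this
    exact this.symm
  have hfr := him.frontier
  have hq : Φ p ∈ frontier T := (hfr hpS).2 hp
  obtain ⟨δ₂, hδ₂, hball⟩ := Metric.isOpen_iff.1 Φ.open_target (Φ p) (Φ.map_source hpS)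
  refine ⟨Φ, v, min δ₁ δ₂, hpS, h1, h2, lt_min hδ₁ hδ₂,
    (Metric.ball_subset_ball (min_le_right _ _)).trans hball, ?_⟩
  obtain ⟨g1, g2, g3⟩ := hrays hq
  refine ⟨g1, g2, fun q hqb => ?_⟩
  have hqt : q ∈ Φ.target := hball (Metric.ball_subset_ball (min_le_right _ _) hqb)
  rw [← g3 q (Metric.ball_subset_ball (min_le_left _ _) hqb)]
  constructor
  · rintro ⟨-, hh⟩
    have := (hfr (Φ.map_target hqt)).2 hh
    rwa [Φ.right_inv hqt] at this
  · intro hh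
    refine ⟨hqt, (hfr (Φ.map_target hqt)).1 ?_⟩
    rwa [Φ.right_inv hqt]

/-! ### Boundary arcs as graphs -/

/-- The point with coordinates `x`, `y` in the orthonormal frame `(c, s)`, `(-s, c)`. -/
def framePt (c s x y : ℝ) : Plane := !₂[c * x - s * y, s * x + c * y]

@[simp] lemma framePt_zero (c s x y : ℝ) : framePt c s x y 0 = c * x - s * y := rfl
@[simp] lemma framePt_one (c s x y : ℝ) : framePt c s x y 1 = s * x + c * y := rfl

/-- A boundary arc: the graph of a `C²` function over an interval `[a, b]`, in a positively oriented
orthonormal frame whose first vector is `(c, s)`. -/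
structure GraphArc where
  c : ℝ
  s : ℝ
  unit : c ^ 2 + s ^ 2 = 1
  g : ℝ → ℝ
  contDiff_g : ContDiff ℝ 2 g
  a : ℝ
  b : ℝ
  lt : a < b

namespace GraphArc

/-- First coordinate in the frame of the arc. -/
def X (Γ : GraphArc) (r : Plane) : ℝ := Γ.c * r 0 + Γ.s * r 1

/-- Second coordinate in the frame of the arc. -/
def Y (Γ : GraphArc) (r : Plane) : ℝ := -Γ.s * r 0 + Γ.c * r 1

/-- The point lying above `x` at height `σ` over the graph. -/
def pt (Γ : GraphArc) (x σ : ℝ) : Plane := framePt Γ.c Γ.s x (Γ.g x + σ)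

/-- The parametrization of the graph by the first coordinate. -/
def curve (Γ : GraphArc) (x : ℝ) : Plane := Γ.pt x 0

/-- The closed arc. -/
def image (Γ : GraphArc) : Set Plane := Γ.curve '' Icc Γ.a Γ.b

/-- The open arc, without its endpoints. -/
def openImage (Γ : GraphArc) : Set Plane := Γ.curve '' Ioo Γ.a Γ.b

@[simp] lemma X_pt (Γ : GraphArc) (x σ : ℝ) : Γ.X (Γ.pt x σ) = x := by
  simp only [X, pt, framePt_zero, framePt_one]
  linear_combination x * Γ.unit

@[simp] lemma Y_pt (Γ : GraphArc) (x σ : ℝ) : Γ.Y (Γ.pt x σ) = Γ.g x + σ := by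
  simp only [Y, pt, framePt_zero, framePt_one]
  linear_combination (Γ.g x + σ) * Γ.unit

lemma pt_X_Y (Γ : GraphArc) (r : Plane) : Γ.pt (Γ.X r) (Γ.Y r - Γ.g (Γ.X r)) = r := by
  ext j
  fin_cases j
  · simp only [X, Y, pt, Fin.zero_eta, framePt_zero]
    linear_combination r 0 * Γ.unit
  · simp only [X, Y, pt, Fin.mk_one, framePt_one]
    linear_combination r 1 * Γ.unit

lemma norm_sq_eq (r : Plane) : ‖r‖ ^ 2 = r 0 ^ 2 + r 1 ^ 2 := by
  simp [EuclideanSpace.norm_sq_eq, Fin.sum_univ_two]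

lemma norm_sub_sq (Γ : GraphArc) (r r' : Plane) :
    ‖r - r'‖ ^ 2 = (Γ.X r - Γ.X r') ^ 2 + (Γ.Y r - Γ.Y r') ^ 2 := by
  rw [norm_sq_eq]
  simp only [X, Y, PiLp.sub_apply]
  linear_combination (-((r 0 - r' 0) ^ 2 + (r 1 - r' 1) ^ 2)) * Γ.unit

lemma abs_X_sub_le (Γ : GraphArc) (r r' : Plane) : |Γ.X r - Γ.X r'| ≤ ‖r - r'‖ := by
  apply abs_le_of_sq_le_sq _ (norm_nonneg _)
  rw [Γ.norm_sub_sq]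
  linarith [sq_nonneg (Γ.Y r - Γ.Y r')]

lemma continuous_X (Γ : GraphArc) : Continuous Γ.X := by unfold X; fun_prop
lemma continuous_Y (Γ : GraphArc) : Continuous Γ.Y := by unfold Y; fun_prop

lemma continuous_pt (Γ : GraphArc) : Continuous fun z : ℝ × ℝ => Γ.pt z.1 z.2 := by
  have := Γ.contDiff_g.continuous
  unfold pt framePt
  refine (PiLp.continuous_toLp 2 _).comp (continuous_pi fun j => ?_)
  fin_cases j <;> simp <;> fun_prop

lemma continuous_curve (Γ : GraphArc) : Continuous Γ.curve :=
  Γ.continuous_pt.comp (continuous_id.prodMk continuous_const)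

@[simp] lemma X_curve (Γ : GraphArc) (x : ℝ) : Γ.X (Γ.curve x) = x := Γ.X_pt x 0

lemma injective_curve (Γ : GraphArc) : Function.Injective Γ.curve := fun x y h => by
  rw [← Γ.X_curve x, h, Γ.X_curve]

lemma isCompact_image (Γ : GraphArc) : IsCompact Γ.image :=
  isCompact_Icc.image Γ.continuous_curve

lemma norm_pt_sub_curve (Γ : GraphArc) (x σ : ℝ) : ‖Γ.pt x σ - Γ.curve x‖ = |σ| := by
  have h : ‖Γ.pt x σ - Γ.curve x‖ ^ 2 = |σ| ^ 2 := by
    rw [Γ.norm_sub_sq, X_pt, X_curve, Y_pt, curve, Y_pt, sq_abs]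
    ring
  exact (pow_left_inj₀ (norm_nonneg _) (abs_nonneg _) two_ne_zero).1 h

end GraphArc

/-- A regular curve is, near the origin of the parameter, a graph over its tangent. -/
lemma exists_graphArc_of_curve {γ : ℝ → Plane} (hγ : ContDiffAt ℝ ∞ γ 0) (hd : deriv γ 0 ≠ 0) :
    ∃ r₀ : ℝ, 0 < r₀ ∧ ∀ r, 0 < r → r ≤ r₀ → ∃ Γ : GraphArc,
      γ '' Icc 0 r = Γ.image ∧ γ '' Ioo 0 r = Γ.openImage := by
  set d := deriv γ 0 with hddef
  have hn : 0 < ‖d‖ := norm_pos_iff.2 hd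
  set c := d 0 / ‖d‖
  set s := d 1 / ‖d‖
  have hunit : c ^ 2 + s ^ 2 = 1 := by
    simp only [c, s, div_pow]
    rw [← add_div, ← GraphArc.norm_sq_eq, div_self (by positivity)]
  have hγj : ∀ j : Fin 2, ContDiffAt ℝ ∞ (fun t => γ t j) 0 := fun j =>
    (contDiffAt_piLp 2).1 hγ j
  let f : ℝ → ℝ := fun t => c * γ t 0 + s * γ t 1
  let y : ℝ → ℝ := fun t => -s * γ t 0 + c * γ t 1
  have hf : ContDiffAt ℝ ∞ f 0 := (contDiffAt_const.mul (hγj 0)).add (contDiffAt_const.mul (hγj 1))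
  have hy : ContDiffAt ℝ ∞ y 0 := (contDiffAt_const.mul (hγj 0)).add (contDiffAt_const.mul (hγj 1))
  have hγd : HasDerivAt γ d 0 := (hγ.differentiableAt (by simp)).hasDerivAt
  have hγdj : ∀ j : Fin 2, HasDerivAt (fun t => γ t j) (d j) 0 := fun j =>
    (EuclideanSpace.proj j : Plane →L[ℝ] ℝ).hasFDerivAt.comp_hasDerivAt (0:ℝ) hγd
  have hfd : HasDerivAt f ‖d‖ 0 := by
    have h1 := ((hγdj 0).const_mul c).add ((hγdj 1).const_mul s)
    convert! h1 using 1
    simp only [c, s]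
    have := GraphArc.norm_sq_eq d
    field_simp
    linarith
  -- the inverse of the tangential coordinate
  have hfd' : HasFDerivAt f ((ContinuousLinearEquiv.unitsEquivAut ℝ (Units.mk0 ‖d‖ hn.ne') : ℝ ≃L[ℝ] ℝ)
      : ℝ →L[ℝ] ℝ) 0 := by
    have := hfd.hasFDerivAt
    convert! this using 1
  let φ := hf.toOpenPartialHomeomorph f hfd' (by simp)
  have hφ : (φ : ℝ → ℝ) = f := hf.toOpenPartialHomeomorph_coe hfd' (by simp)
  have hφ0 : (0:ℝ) ∈ φ.source := hf.mem_toOpenPartialHomeomorph_source hfd' (by simp)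
  have hφinv : ContDiffAt ℝ ∞ φ.symm (f 0) := hf.to_localInverse hfd' (by simp)
  have hφsymm0 : φ.symm (f 0) = 0 := by rw [← hφ]; exact φ.left_inv hφ0
  have hg : ContDiffAt ℝ 2 (y ∘ φ.symm) (f 0) := by
    refine ContDiffAt.comp (f 0) ?_ (hφinv.of_le (WithTop.coe_le_coe.2 (le_top : (2 : ℕ∞) ≤ ⊤)))
    rw [hφsymm0]; exact hy.of_le (WithTop.coe_le_coe.2 (le_top : (2 : ℕ∞) ≤ ⊤))
  obtain ⟨ρ, hρ, hgρ⟩ := Metric.eventually_nhds_iff_ball.1 (hg.eventually (by simp))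
  let B : ContDiffBump (f 0) := ⟨ρ / 3, ρ / 2, by positivity, by linarith⟩
  let g : ℝ → ℝ := fun x => B x * (y ∘ φ.symm) x
  have hgc : ContDiff ℝ 2 g := by
    rw [contDiff_iff_contDiffAt]
    intro x
    by_cases hx : x ∈ Metric.ball (f 0) ρ
    · exact B.contDiff.contDiffAt.mul (hgρ x hx)
    · have hxs : x ∉ tsupport B := by
        rw [B.tsupport_eq]
        intro h'
        apply hx
        exact Metric.closedBall_subset_ball (by show ρ / 2 < ρ; linarith) h'
      have : g =ᶠ[𝓝 x] fun _ => 0 := by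
        filter_upwards [notMem_tsupport_iff_eventuallyEq.1 hxs] with z hz
        simp only [g, hz]; simp
      exact contDiffAt_const.congr_of_eventuallyEq this
  -- near the origin everything is under control
  have ev1 : ∀ᶠ t in 𝓝 (0:ℝ), t ∈ φ.source := φ.open_source.mem_nhds hφ0
  have hf1 : ∀ᶠ t in 𝓝 (0:ℝ), ContDiffAt ℝ 1 f t :=
    (hf.of_le (by exact_mod_cast le_top) : ContDiffAt ℝ 1 f 0).eventually (by simp)
  have ev2 : ∀ᶠ t in 𝓝 (0:ℝ), 0 < deriv f t := by
    have h1 : ContinuousAt (deriv f) 0 := by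
      have h2 : ContDiffAt ℝ 1 f 0 := hf.of_le (by exact_mod_cast le_top)
      have h3 := h2.fderiv_right (m := 0) (by simp)
      have h4 := h3.continuousAt.clm_apply (continuousAt_const (y := (1:ℝ)))
      simpa [fderiv_eq_smul_deriv] using h4
    apply h1.eventually_const_lt
    rw [hfd.deriv]; exact hn
  have ev3 : ∀ᶠ t in 𝓝 (0:ℝ), f t ∈ Metric.ball (f 0) (ρ / 3) :=
    hfd.continuousAt.eventually_mem (Metric.ball_mem_nhds _ (by positivity))
  obtain ⟨r₁, hr₁, hall⟩ := Metric.eventually_nhds_iff_ball.1 (ev1.and (hf1.and (ev2.and ev3)))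
  refine ⟨r₁ / 2, by positivity, fun r hr hrr => ?_⟩
  have hin : ∀ t ∈ Icc 0 r, t ∈ Metric.ball (0:ℝ) r₁ := fun t ht => by
    rw [Metric.mem_ball, Real.dist_eq, sub_zero, abs_of_nonneg ht.1]
    linarith [ht.2]
  have hfc : ContinuousOn f (Icc 0 r) := fun t ht =>
    ((hall t (hin t ht)).2.1.continuousAt).continuousWithinAt
  have hmono : StrictMonoOn f (Icc 0 r) := by
    apply strictMonoOn_of_deriv_pos (convex_Icc 0 r) hfc
    intro t ht
    rw [interior_Icc] at ht
    exact (hall t (hin t (Ioo_subset_Icc_self ht))).2.2.1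
  have h0r : (0:ℝ) ∈ Icc 0 r := ⟨le_rfl, hr.le⟩
  have hrr' : r ∈ Icc 0 r := ⟨hr.le, le_rfl⟩
  let Γ : GraphArc := ⟨c, s, hunit, g, hgc, f 0, f r, hmono h0r hrr' hr⟩
  have hcurve : ∀ t ∈ Icc 0 r, Γ.curve (f t) = γ t := by
    intro t ht
    obtain ⟨a1, -, -, a4⟩ := hall t (hin t ht)
    have hinv : φ.symm (f t) = t := by rw [← hφ]; exact φ.left_inv a1
    have hgt : g (f t) = y t := by
      simp only [g, Function.comp, hinv]
      rw [B.one_of_mem_closedBall (Metric.ball_subset_closedBall a4), one_mul]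
    ext j
    simp only [GraphArc.curve, GraphArc.pt, Γ, hgt, add_zero]
    fin_cases j
    · simp only [Fin.zero_eta, framePt_zero, f, y]
      linear_combination γ t 0 * hunit
    · simp only [Fin.mk_one, framePt_one, f, y]
      linear_combination γ t 1 * hunit
  have himg : ∀ S ⊆ Icc 0 r, γ '' S = Γ.curve '' (f '' S) := fun S hS => by
    rw [image_image]
    exact image_congr fun t ht => (hcurve t (hS ht)).symm
  have hIcc : f '' Icc 0 r = Icc (f 0) (f r) := by
    apply Subset.antisymm
    · rintro _ ⟨t, ht, rfl⟩
      exact ⟨hmono.monotoneOn h0r ht ht.1, hmono.monotoneOn ht hrr' ht.2⟩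
    · exact intermediate_value_Icc hr.le hfc
  have hIoo : f '' Ioo 0 r = Ioo (f 0) (f r) := by
    apply Subset.antisymm
    · rintro _ ⟨t, ht, rfl⟩
      have ht' := Ioo_subset_Icc_self ht
      exact ⟨hmono h0r ht' ht.1, hmono ht' hrr' ht.2⟩
    · exact intermediate_value_Ioo hr.le hfc
  refine ⟨Γ, ?_, ?_⟩
  · rw [himg _ Subset.rfl, hIcc]; rfl
  · rw [himg _ Ioo_subset_Icc_self, hIoo]; rfl

/-- Near each of its points the boundary is covered by two closed graph arcs whose interiors are
relatively open in it. -/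
lemma IsSmoothCurvilinearPolygon.exists_local_arcs {Ω : Set Plane}
    (hΩ : IsSmoothCurvilinearPolygon Ω) {p : Plane} (hp : p ∈ frontier Ω) :
    ∃ Γ : Fin 2 → GraphArc, (∀ k, (Γ k).image ⊆ frontier Ω) ∧
      (∀ k, ∃ O, IsOpen O ∧ O ∩ frontier Ω = (Γ k).openImage) ∧
      ∃ V, IsOpen V ∧ p ∈ V ∧ frontier Ω ∩ V ⊆ ⋃ k, (Γ k).image := by
  obtain ⟨Φ, v, δ, hpS, hΦ, hΦs, hδ, hball, hnorm, hinner, hrays⟩ := hΩ.exists_twoRays hp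
  set q₀ := Φ p with hq₀
  have hq₀t : q₀ ∈ Φ.target := Φ.map_source hpS
  have hΦp : ContDiffAt ℝ ∞ Φ p := hΦ.contDiffAt (Φ.open_source.mem_nhds hpS)
  have hΦq : ContDiffAt ℝ ∞ Φ.symm q₀ := hΦs.contDiffAt (Φ.open_target.mem_nhds hq₀t)
  have hvv : ∀ k, inner ℝ (v k) (v k) = 1 := fun k => by
    rw [real_inner_self_eq_norm_sq, hnorm]; norm_num
  have hvne : ∀ j k, j ≠ k → inner ℝ (v j) (v k) ≤ 0 := by
    intro j k hjk
    fin_cases j <;> fin_cases k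
    · exact absurd rfl hjk
    · exact hinner
    · rw [real_inner_comm]; exact hinner
    · exact absurd rfl hjk
  have hsymmp : Φ.symm q₀ = p := Φ.left_inv hpS
  let γ : Fin 2 → ℝ → Plane := fun k t => Φ.symm (q₀ + t • v k)
  have hlin : ∀ k, ContDiff ℝ ∞ fun t : ℝ => q₀ + t • v k := fun k => by fun_prop
  have hγ : ∀ k, ContDiffAt ℝ ∞ (γ k) 0 := fun k => by
    refine ContDiffAt.comp (0:ℝ) (g := Φ.symm) ?_ (hlin k).contDiffAt
    simpa using hΦq
  have hind : ∀ k (t : ℝ), 0 ≤ t → t < δ → q₀ + t • v k ∈ Metric.ball q₀ δ := fun k t h0 h1 => by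
    rw [Metric.mem_ball, dist_eq_norm, add_sub_cancel_left, norm_smul, hnorm, mul_one,
      Real.norm_eq_abs, abs_of_nonneg h0]
    exact h1
  have hγd : ∀ k, deriv (γ k) 0 ≠ 0 := by
    intro k h0
    have h1 : HasDerivAt (γ k) 0 0 := h0 ▸ ((hγ k).differentiableAt (by simp)).hasDerivAt
    have hγ0 : γ k 0 = p := by simp [γ, hsymmp]
    have h2 : HasFDerivAt Φ (fderiv ℝ Φ p) (γ k 0) := by
      rw [hγ0]; exact (hΦp.differentiableAt (by simp)).hasFDerivAt
    have h3 := h2.comp_hasDerivAt (0:ℝ) h1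
    rw [map_zero] at h3
    have h4 : HasDerivAt (fun t : ℝ => q₀ + t • v k) (v k) 0 := by
      simpa using ((hasDerivAt_id (0:ℝ)).smul_const (v k)).const_add q₀
    have h5 : (Φ ∘ γ k) =ᶠ[𝓝 0] fun t : ℝ => q₀ + t • v k := by
      have : ∀ᶠ t : ℝ in 𝓝 0, q₀ + t • v k ∈ Φ.target := by
        apply (hlin k).continuous.continuousAt.eventually_mem
        apply Φ.open_target.mem_nhds
        simpa using hq₀t
      filter_upwards [this] with t ht
      exact Φ.right_inv ht
    have h6 := (h4.congr_of_eventuallyEq h5).unique h3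
    have := hnorm k
    rw [h6, norm_zero] at this
    exact zero_ne_one this
  choose r₀ hr₀ harc using fun k => exists_graphArc_of_curve (hγ k) (hγd k)
  obtain ⟨r, hr, hrδ, hrk⟩ : ∃ r : ℝ, 0 < r ∧ r < δ ∧ ∀ k, r ≤ r₀ k := by
    refine ⟨min (δ / 2) (min (r₀ 0) (r₀ 1)), lt_min (by positivity) (lt_min (hr₀ 0) (hr₀ 1)), ?_, ?_⟩
    · exact (min_le_left _ _).trans_lt (by linarith)
    · intro k; fin_cases k
      · exact (min_le_right _ _).trans (min_le_left _ _)
      · exact (min_le_right _ _).trans (min_le_right _ _)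
  choose Γ hΓ1 hΓ2 using fun k => harc k r hr (hrk k)
  have hγM : ∀ k, ∀ t ∈ Icc 0 r, γ k t ∈ frontier Ω := fun k t ht =>
    ((hrays _ (hind k t ht.1 (ht.2.trans_lt hrδ))).2 ⟨k, t, ht.1, rfl⟩).2
  have hray : ∀ z ∈ frontier Ω, z ∈ Φ.source → Φ z ∈ Metric.ball q₀ δ →
      ∃ k, ∃ s : ℝ, 0 ≤ s ∧ Φ z = q₀ + s • v k := fun z hz hzs hzb =>
    (hrays _ hzb).1 ⟨Φ.map_source hzs, by rw [mem_preimage, Φ.left_inv hzs]; exact hz⟩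
  refine ⟨Γ, fun k => ?_, fun k => ?_, ?_⟩
  · rw [← hΓ1 k]
    rintro _ ⟨t, ht, rfl⟩
    exact hγM k t ht
  · refine ⟨Φ.source ∩ Φ ⁻¹' (Metric.ball q₀ δ ∩ {q | inner ℝ (q - q₀) (v k) ∈ Ioo 0 r}), ?_, ?_⟩
    · apply Φ.isOpen_inter_preimage
      refine Metric.isOpen_ball.inter (isOpen_Ioo.preimage ?_)
      fun_prop
    · rw [← hΓ2 k]
      ext z
      constructor
      · rintro ⟨⟨hzs, hzb, hzi⟩, hzM⟩
        obtain ⟨j, s, hs, hz⟩ := hray z hzM hzs hzb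
        have hzi' : inner ℝ (Φ z - q₀) (v k) ∈ Ioo 0 r := hzi
        rw [hz, add_sub_cancel_left, inner_smul_left] at hzi'
        simp only [conj_trivial] at hzi'
        by_cases hjk : j = k
        · subst hjk
          rw [hvv, mul_one] at hzi'
          refine ⟨s, hzi', ?_⟩
          simp only [γ]
          rw [← hz, Φ.left_inv hzs]
        · exact absurd hzi'.1 (not_lt.2 (mul_nonpos_of_nonneg_of_nonpos hs (hvne j k hjk)))
      · rintro ⟨t, ht, rfl⟩
        have htb := hind k t ht.1.le (ht.2.trans hrδ)
        have hΦt : Φ (γ k t) = q₀ + t • v k := Φ.right_inv (hball htb)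
        refine ⟨⟨Φ.map_target (hball htb), ?_, ?_⟩, hγM k t (Ioo_subset_Icc_self ht)⟩
        · rw [hΦt]; exact htb
        · show inner ℝ (Φ (γ k t) - q₀) (v k) ∈ Ioo 0 r
          rw [hΦt, add_sub_cancel_left, inner_smul_left, hvv]
          simpa using ht
  · refine ⟨Φ.source ∩ Φ ⁻¹' Metric.ball q₀ r, Φ.isOpen_inter_preimage Metric.isOpen_ball,
      ⟨hpS, by rw [mem_preimage, ← hq₀]; exact Metric.mem_ball_self hr⟩, ?_⟩
    rintro z ⟨hzM, hzs, hzb⟩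
    obtain ⟨k, s, hs, hz⟩ := hray z hzM hzs (Metric.ball_subset_ball hrδ.le hzb)
    have hsr : s < r := by
      have : Φ z ∈ Metric.ball q₀ r := hzb
      rw [hz, Metric.mem_ball, dist_eq_norm, add_sub_cancel_left, norm_smul, hnorm, mul_one,
        Real.norm_eq_abs, abs_of_nonneg hs] at this
      exact this
    refine mem_iUnion.2 ⟨k, ?_⟩
    rw [← hΓ1 k]
    refine ⟨s, ⟨hs, hsr.le⟩, ?_⟩
    simp only [γ]
    rw [← hz, Φ.left_inv hzs]

/-- Near each of its points the boundary embeds into the line by a bi-Lipschitz map: in a chart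
one ray is sent to the positive and the other one to the negative half-line. -/
lemma IsSmoothCurvilinearPolygon.exists_bilipschitz {Ω : Set Plane}
    (hΩ : IsSmoothCurvilinearPolygon Ω) {p : Plane} (hp : p ∈ frontier Ω) :
    ∃ U ∈ 𝓝 p, ∃ (h : Plane → ℝ) (C : ℝ), 0 < C ∧
      ∀ q ∈ frontier Ω ∩ U, ∀ q' ∈ frontier Ω ∩ U,
        |h q - h q'| ≤ C * ‖q - q'‖ ∧ ‖q - q'‖ ≤ C * |h q - h q'| := by
  obtain ⟨Φ, v, δ, hpS, hΦ, hΦs, hδ, hball, hnorm, hinner, hrays⟩ := hΩ.exists_twoRays hp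
  set q₀ := Φ p with hq₀
  have hq₀t : q₀ ∈ Φ.target := Φ.map_source hpS
  have hΦp : ContDiffAt ℝ ∞ Φ p := hΦ.contDiffAt (Φ.open_source.mem_nhds hpS)
  have hΦq : ContDiffAt ℝ ∞ Φ.symm q₀ := hΦs.contDiffAt (Φ.open_target.mem_nhds hq₀t)
  have hvv : ∀ k, inner ℝ (v k) (v k) = 1 := fun k => by
    rw [real_inner_self_eq_norm_sq, hnorm]; norm_num
  have hvne : ∀ j k, j ≠ k → inner ℝ (v j) (v k) ≤ 0 := by
    intro j k hjk
    fin_cases j <;> fin_cases k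
    · exact absurd rfl hjk
    · exact hinner
    · rw [real_inner_comm]; exact hinner
    · exact absurd rfl hjk
  have hsymmp : Φ.symm q₀ = p := Φ.left_inv hpS
  let h₀ : Plane → ℝ := fun q => max (inner ℝ (q - q₀) (v 0)) 0 - max (inner ℝ (q - q₀) (v 1)) 0
  have hval : ∀ (k : Fin 2) (s : ℝ), 0 ≤ s → h₀ (q₀ + s • v k) = if k = 0 then s else -s := by
    intro k s hs
    simp only [h₀, add_sub_cancel_left, inner_smul_left, conj_trivial]
    have h01 := mul_nonpos_of_nonneg_of_nonpos hs (hvne 0 1 (by decide))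
    have h10 := mul_nonpos_of_nonneg_of_nonpos hs (hvne 1 0 (by decide))
    fin_cases k
    · simp [hnorm, hs, h01]
    · simp [hnorm, hs, h10]
  have hlip : ∀ q q', |h₀ q - h₀ q'| ≤ 2 * ‖q - q'‖ := by
    intro q q'
    have hk : ∀ k, |max (inner ℝ (q - q₀) (v k)) 0 - max (inner ℝ (q' - q₀) (v k)) 0|
        ≤ ‖q - q'‖ := fun k => by
      refine (abs_max_sub_max_le_abs _ _ _).trans ?_
      rw [← inner_sub_left, sub_sub_sub_cancel_right]
      have := abs_real_inner_le_norm (q - q') (v k)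
      rwa [hnorm, mul_one] at this
    have e : h₀ q - h₀ q' = (max (inner ℝ (q - q₀) (v 0)) 0 - max (inner ℝ (q' - q₀) (v 0)) 0)
        - (max (inner ℝ (q - q₀) (v 1)) 0 - max (inner ℝ (q' - q₀) (v 1)) 0) := by
      simp only [h₀]; ring
    rw [e]
    have := abs_sub (max (inner ℝ (q - q₀) (v 0)) 0 - max (inner ℝ (q' - q₀) (v 0)) 0)
      (max (inner ℝ (q - q₀) (v 1)) 0 - max (inner ℝ (q' - q₀) (v 1)) 0)
    linarith [hk 0, hk 1]
  have hanti : ∀ (j k : Fin 2) (s t : ℝ), 0 ≤ s → 0 ≤ t →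
      ‖(q₀ + s • v j) - (q₀ + t • v k)‖ ≤ |h₀ (q₀ + s • v j) - h₀ (q₀ + t • v k)| := by
    intro j k s t hs ht
    rw [hval j s hs, hval k t ht, add_sub_add_left_eq_sub]
    by_cases hjk : j = k
    · subst hjk
      rw [← sub_smul, norm_smul, hnorm, mul_one, Real.norm_eq_abs]
      split_ifs
      · exact le_rfl
      · rw [abs_sub_comm]; apply le_of_eq; congr 1; ring
    · have h1 : ‖s • v j - t • v k‖ ≤ s + t := by
        refine (norm_sub_le _ _).trans ?_
        rw [norm_smul, norm_smul, hnorm, hnorm, Real.norm_eq_abs, Real.norm_eq_abs,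
          abs_of_nonneg hs, abs_of_nonneg ht]
        linarith
      refine h1.trans ?_
      fin_cases j <;> fin_cases k
      · exact absurd rfl hjk
      · simp only [Fin.zero_eta, Fin.mk_one, if_true, one_ne_zero, if_false]
        exact le_trans (by linarith) (le_abs_self _)
      · simp only [Fin.zero_eta, Fin.mk_one, if_true, one_ne_zero, if_false]
        exact le_trans (by linarith) (neg_le_abs _)
      · exact absurd rfl hjk
  obtain ⟨K₁, N₁, hN₁, hK₁⟩ := ContDiffAt.exists_lipschitzOnWith
    (hΦp.of_le (by exact_mod_cast le_top) : ContDiffAt ℝ 1 Φ p)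
  obtain ⟨K₂, N₂, hN₂, hK₂⟩ := ContDiffAt.exists_lipschitzOnWith
    (hΦq.of_le (by exact_mod_cast le_top) : ContDiffAt ℝ 1 Φ.symm q₀)
  have hcont : ContinuousAt Φ p := hΦp.continuousAt
  refine ⟨N₁ ∩ (Φ.source ∩ Φ ⁻¹' (N₂ ∩ Metric.ball q₀ δ)), ?_, fun z => h₀ (Φ z),
    2 * K₁ + K₂ + 1, by positivity, ?_⟩
  · refine inter_mem hN₁ (inter_mem (Φ.open_source.mem_nhds hpS) (hcont.preimage_mem_nhds ?_))
    exact inter_mem hN₂ (Metric.ball_mem_nhds _ hδ)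
  · rintro z ⟨hzM, hz1, hzs, hz2, hzb⟩ z' ⟨hzM', hz1', hzs', hz2', hzb'⟩
    have hray : ∀ z ∈ frontier Ω, z ∈ Φ.source → Φ z ∈ Metric.ball q₀ δ →
        ∃ k, ∃ s : ℝ, 0 ≤ s ∧ Φ z = q₀ + s • v k := fun z hz hzs hzb =>
      (hrays _ hzb).1 ⟨Φ.map_source hzs, by rw [mem_preimage, Φ.left_inv hzs]; exact hz⟩
    have l1 := hK₁.dist_le_mul z hz1 z' hz1'
    have l2 := hK₂.dist_le_mul (Φ z) hz2 (Φ z') hz2'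
    rw [Φ.left_inv hzs, Φ.left_inv hzs'] at l2
    simp only [dist_eq_norm] at l1 l2
    have hK₁0 : (0:ℝ) ≤ K₁ := K₁.2
    have hK₂0 : (0:ℝ) ≤ K₂ := K₂.2
    have n0 := norm_nonneg (z - z')
    constructor
    · have := hlip (Φ z) (Φ z')
      nlinarith [mul_nonneg hK₂0 n0]
    · obtain ⟨j, s, hs, hz⟩ := hray z hzM hzs hzb
      obtain ⟨k, t, ht, hz'⟩ := hray z' hzM' hzs' hzb'
      have h3 := hanti j k s t hs ht
      rw [← hz, ← hz'] at h3
      have h4 := abs_nonneg (h₀ (Φ z) - h₀ (Φ z'))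
      have h5 := mul_le_mul_of_nonneg_left h3 hK₂0
      nlinarith [mul_nonneg hK₁0 h4]

/-! ### Decomposition of the boundary into arcs with disjoint interiors -/

namespace GraphArc

/-- The part of an arc lying over a smaller interval. -/
def sub (Γ : GraphArc) (c d : ℝ) (h : c < d) : GraphArc := { Γ with a := c, b := d, lt := h }

lemma openImage_sub (Γ : GraphArc) {c d : ℝ} (h : c < d) :
    (Γ.sub c d h).openImage = Γ.curve '' Ioo c d := rfl

lemma closure_openImage (Γ : GraphArc) : closure Γ.openImage = Γ.image := by
  apply Subset.antisymm
  · exact closure_minimal (image_mono Ioo_subset_Icc_self) Γ.isCompact_image.isClosed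
  · unfold image openImage
    rw [← closure_Ioo Γ.lt.ne]
    exact image_closure_subset_closure_image Γ.continuous_curve

lemma openImage_subset (Γ : GraphArc) : Γ.openImage ⊆ Γ.image := image_mono Ioo_subset_Icc_self

lemma isPreconnected_openImage (Γ : GraphArc) : IsPreconnected Γ.openImage :=
  isPreconnected_Ioo.image _ Γ.continuous_curve.continuousOn

lemma exists_isOpen_sub {M : Set Plane} (Γ : GraphArc)
    (hO : ∃ O, IsOpen O ∧ O ∩ M = Γ.openImage) {c d : ℝ} (h : c < d) (hc : Γ.a ≤ c) (hd : d ≤ Γ.b) :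
    ∃ O, IsOpen O ∧ O ∩ M = (Γ.sub c d h).openImage := by
  obtain ⟨O, hO, hOM⟩ := hO
  refine ⟨O \ (Γ.curve '' (Icc Γ.a c ∪ Icc d Γ.b)), hO.sdiff ?_, ?_⟩
  · exact ((isCompact_Icc.union isCompact_Icc).image Γ.continuous_curve).isClosed
  · rw [openImage_sub]
    ext z
    constructor
    · rintro ⟨⟨hzO, hz⟩, hzM⟩
      have : z ∈ Γ.openImage := hOM ▸ ⟨hzO, hzM⟩
      obtain ⟨x, hx, rfl⟩ := this
      refine ⟨x, ⟨?_, ?_⟩, rfl⟩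
      · by_contra h'
        exact hz ⟨x, Or.inl ⟨hx.1.le, not_lt.1 h'⟩, rfl⟩
      · by_contra h'
        exact hz ⟨x, Or.inr ⟨not_lt.1 h', hx.2.le⟩, rfl⟩
    · rintro ⟨x, hx, rfl⟩
      have : Γ.curve x ∈ O ∩ M := by
        rw [hOM]
        exact ⟨x, ⟨hc.trans_lt hx.1, hx.2.trans_le hd⟩, rfl⟩
      refine ⟨⟨this.1, ?_⟩, this.2⟩
      rintro ⟨y, hy, hxy⟩
      rw [Γ.injective_curve hxy] at hy
      rcases hy with hy | hy
      · exact absurd hy.2 (not_le.2 hx.1)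
      · exact absurd hy.1 (not_le.2 hx.2)

end GraphArc

/-- Two consecutive points of a finite set enclosing a given point. -/
lemma exists_consecutive {Q : Set ℝ} (hQ : Q.Finite) {a b x : ℝ} (ha : a ∈ Q) (hb : b ∈ Q)
    (hab : a < b) (hx : x ∈ Icc a b) :
    ∃ c ∈ Q, ∃ d ∈ Q, c < d ∧ Ioo c d ∩ Q = ∅ ∧ x ∈ Icc c d := by
  rcases hx.2.lt_or_eq with hlt | rfl
  · obtain ⟨c, ⟨hcQ, hcx⟩, hc⟩ := (hQ.subset (sep_subset Q (· ≤ x))).exists_maximal ⟨a, ha, hx.1⟩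
    obtain ⟨d, ⟨hdQ, hdx⟩, hd⟩ := (hQ.subset (sep_subset Q (x < ·))).exists_minimal ⟨b, hb, hlt⟩
    refine ⟨c, hcQ, d, hdQ, lt_of_le_of_lt hcx hdx, ?_, hcx, le_of_lt hdx⟩
    ext q
    simp only [mem_inter_iff, mem_empty_iff_false, iff_false]
    rintro ⟨⟨h1, h2⟩, hq⟩
    rcases le_or_gt q x with h | h
    · exact absurd (hc ⟨hq, h⟩ h1.le) (not_le.2 h1)
    · exact absurd (hd ⟨hq, h⟩ h2.le) (not_le.2 h2)
  · obtain ⟨c, ⟨hcQ, hcx⟩, hc⟩ := (hQ.subset (sep_subset Q (· < x))).exists_maximal ⟨a, ha, hab⟩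
    refine ⟨c, hcQ, x, hb, hcx, ?_, le_of_lt hcx, le_rfl⟩
    ext q
    simp only [mem_inter_iff, mem_empty_iff_false, iff_false]
    rintro ⟨⟨h1, h2⟩, hq⟩
    exact absurd (hc ⟨hq, h2⟩ h1.le) (not_le.2 h1)

/-- A family of arcs covering `M`, with relatively open interiors, can be cut at all the endpoints
into finitely many arcs with pairwise disjoint interiors: two pieces either coincide or have
disjoint interiors, since the interior of each is connected and contains no endpoint of the other. -/
lemma exists_disjoint_arcs {M : Set Plane} {ι : Type*} [Finite ι] (Γ : ι → GraphArc)
    (hM : ∀ i, (Γ i).image ⊆ M) (hO : ∀ i, ∃ O, IsOpen O ∧ O ∩ M = (Γ i).openImage)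
    (hcov : M ⊆ ⋃ i, (Γ i).image) :
    ∃ (κ : Type) (_ : Finite κ) (Γ' : κ → GraphArc), (∀ k, (Γ' k).image ⊆ M) ∧
      (∀ k, ∃ O, IsOpen O ∧ O ∩ M = (Γ' k).openImage) ∧ M ⊆ (⋃ k, (Γ' k).image) ∧
      ∀ k l, k ≠ l → Disjoint (Γ' k).openImage (Γ' l).openImage := by
  let P : Set Plane := ⋃ i, {(Γ i).curve (Γ i).a, (Γ i).curve (Γ i).b}
  have hP : P.Finite := finite_iUnion fun i => by simp
  let Q : ι → Set ℝ := fun i => Icc (Γ i).a (Γ i).b ∩ (Γ i).curve ⁻¹' P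
  have hQ : ∀ i, (Q i).Finite := fun i =>
    (hP.preimage ((Γ i).injective_curve.injOn)).subset inter_subset_right
  have hQa : ∀ i, (Γ i).a ∈ Q i := fun i =>
    ⟨⟨le_rfl, (Γ i).lt.le⟩, mem_iUnion.2 ⟨i, by simp⟩⟩
  have hQb : ∀ i, (Γ i).b ∈ Q i := fun i =>
    ⟨⟨(Γ i).lt.le, le_rfl⟩, mem_iUnion.2 ⟨i, by simp⟩⟩
  let T : Set (ι × ℝ × ℝ) := {z | z.2.1 ∈ Q z.1 ∧ z.2.2 ∈ Q z.1 ∧ z.2.1 < z.2.2 ∧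
    Ioo z.2.1 z.2.2 ∩ Q z.1 = ∅}
  have hT : T.Finite := by
    have : T ⊆ ⋃ i, (({i} : Set ι) ×ˢ (Q i ×ˢ Q i)) := fun z hz =>
      mem_iUnion.2 ⟨z.1, rfl, hz.1, hz.2.1⟩
    exact (finite_iUnion fun i => (finite_singleton i).prod ((hQ i).prod (hQ i))).subset this
  let arc : T → GraphArc := fun z => (Γ z.1.1).sub z.1.2.1 z.1.2.2 z.2.2.2.1
  have hrel : ∀ z : T, ∃ O, IsOpen O ∧ O ∩ M = (arc z).openImage := fun z =>
    (Γ z.1.1).exists_isOpen_sub (hO z.1.1) z.2.2.2.1 z.2.1.1.1 z.2.2.1.1.2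
  have himg : ∀ z : T, (arc z).image ⊆ M := fun z =>
    (image_mono (Icc_subset_Icc z.2.1.1.1 z.2.2.1.1.2)).trans (hM z.1.1)
  have key : ∀ z w : T, ((arc z).openImage ∩ (arc w).openImage).Nonempty →
      (arc z).openImage ⊆ (arc w).openImage := by
    intro z w hne
    obtain ⟨O, hOo, hOM⟩ := hrel w
    have hzP : ∀ r ∈ (arc z).openImage, r ∉ P := by
      rintro _ ⟨x, hx, rfl⟩ hxP
      have hx' : x ∈ Icc (Γ z.1.1).a (Γ z.1.1).b :=
        ⟨z.2.1.1.1.trans (le_of_lt hx.1), (le_of_lt hx.2).trans z.2.2.1.1.2⟩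
      have : x ∈ Ioo z.1.2.1 z.1.2.2 ∩ Q z.1.1 := ⟨hx, hx', hxP⟩
      rw [z.2.2.2.2] at this
      exact this
    have hwP : ∀ r ∈ (arc w).image, r ∉ (arc w).openImage → r ∈ P := by
      rintro _ ⟨x, hx, rfl⟩ hxn
      by_cases h1 : x = w.1.2.1
      · rw [h1]; exact w.2.1.2
      by_cases h2 : x = w.1.2.2
      · rw [h2]; exact w.2.2.1.2
      exact absurd ⟨x, ⟨lt_of_le_of_ne hx.1 (Ne.symm h1), lt_of_le_of_ne hx.2 h2⟩, rfl⟩ hxn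
    have hsub : (arc z).openImage ⊆ O ∪ ((arc w).image)ᶜ := by
      intro r hr
      by_cases h1 : r ∈ (arc w).image
      · left
        by_contra h2
        refine hzP r hr (hwP r h1 fun h3 => h2 ?_)
        rw [← hOM] at h3
        exact h3.1
      · exact Or.inr h1
    have hzM : (arc z).openImage ⊆ M := (arc z).openImage_subset.trans (himg z)
    have hOw : ∀ r ∈ (arc z).openImage, r ∈ O → r ∈ (arc w).openImage := fun r hr hrO => by
      rw [← hOM]; exact ⟨hrO, hzM hr⟩
    rcases isPreconnected_iff_subset_of_disjoint.1 (arc z).isPreconnected_openImage O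
      ((arc w).image)ᶜ hOo (arc w).isCompact_image.isClosed.isOpen_compl hsub (by
        ext r
        simp only [mem_inter_iff, mem_compl_iff, mem_empty_iff_false, iff_false]
        rintro ⟨hr, hrO, hrw⟩
        exact hrw ((arc w).openImage_subset (hOw r hr hrO))) with h | h
    · exact fun r hr => hOw r hr (h hr)
    · obtain ⟨r, hr1, hr2⟩ := hne
      exact absurd ((arc w).openImage_subset hr2) (h hr1)
  -- one representative for each set occurring as the interior of a piece
  let S : Set (Set Plane) := range fun z : T => (arc z).openImage
  have : Finite T := hT
  have hS : S.Finite := finite_range _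
  choose rep hrep using fun s : S => s.2
  refine ⟨S, hS, fun s => arc (rep s), fun s => himg _, fun s => hrel _, ?_, ?_⟩
  · intro m hm
    obtain ⟨i, x, hx, rfl⟩ := mem_iUnion.1 (hcov hm)
    obtain ⟨c, hc, d, hd, hcd, hemp, hxcd⟩ := exists_consecutive (hQ i) (hQa i) (hQb i) (Γ i).lt hx
    let z : T := ⟨(i, c, d), hc, hd, hcd, hemp⟩
    let s : S := ⟨(arc z).openImage, z, rfl⟩
    refine mem_iUnion.2 ⟨s, ?_⟩
    have h1 : (arc (rep s)).image = (arc z).image := by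
      rw [← GraphArc.closure_openImage, ← GraphArc.closure_openImage]
      congr 1
      exact hrep s
    rw [h1]
    exact ⟨x, hxcd, rfl⟩
  · intro s t hst
    rw [disjoint_iff_inter_eq_empty]
    by_contra hne
    have hne' := nonempty_iff_ne_empty.2 hne
    apply hst
    apply Subtype.ext
    have h1 : (arc (rep s)).openImage = s.1 := hrep s
    have h2 : (arc (rep t)).openImage = t.1 := hrep t
    rw [← h1, ← h2]
    exact Subset.antisymm (key _ _ hne') (key _ _ (by rwa [inter_comm]))

lemma disjoint_openImage_image {M : Set Plane} {Γ Γ' : GraphArc} (hM : Γ'.image ⊆ M)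
    (hO : ∃ O, IsOpen O ∧ O ∩ M = Γ.openImage) (hd : Disjoint Γ.openImage Γ'.openImage) :
    Disjoint Γ.openImage Γ'.image := by
  obtain ⟨O, hOo, hOM⟩ := hO
  rw [Set.disjoint_left]
  intro r hr hr'
  rw [← hOM] at hr
  rw [← Γ'.closure_openImage] at hr'
  obtain ⟨q, hqO, hq⟩ := mem_closure_iff.1 hr' O hOo hr.1
  have : q ∈ Γ.openImage := hOM ▸ ⟨hqO, hM (Γ'.openImage_subset hq)⟩
  exact Set.disjoint_left.1 hd this hq

/-- The boundary of a bounded smooth curvilinear polygon is a finite union of graph arcs with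
disjoint interiors. -/
lemma IsSmoothCurvilinearPolygon.exists_finite_arcs {Ω : Set Plane}
    (hΩ : IsSmoothCurvilinearPolygon Ω) (hb : Bornology.IsBounded Ω) :
    ∃ (κ : Type) (_ : Finite κ) (Γ : κ → GraphArc), (∀ k, (Γ k).image ⊆ frontier Ω) ∧
      (frontier Ω ⊆ ⋃ k, (Γ k).image) ∧
      ∀ k l, k ≠ l → Disjoint (Γ k).openImage (Γ l).image := by
  have hcpt : IsCompact (frontier Ω) :=
    Metric.isCompact_of_isClosed_isBounded isClosed_frontier
      (hb.closure.subset frontier_subset_closure)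
  choose Γ hM hO V hVo hpV hV using fun p : frontier Ω => hΩ.exists_local_arcs p.2
  obtain ⟨t, ht⟩ := hcpt.elim_finite_subcover V hVo
    (fun p hp => mem_iUnion.2 ⟨⟨p, hp⟩, hpV ⟨p, hp⟩⟩)
  obtain ⟨κ, hκ, Γ', h1, h2, h3, h4⟩ := exists_disjoint_arcs (M := frontier Ω)
    (fun z : t × Fin 2 => Γ z.1 z.2) (fun z => hM _ _) (fun z => hO _ _) (by
      intro p hp
      obtain ⟨q, hq, hpq⟩ := mem_iUnion₂.1 (ht hp)
      obtain ⟨k, hk⟩ := mem_iUnion.1 (hV q ⟨hp, hpq⟩)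
      exact mem_iUnion.2 ⟨(⟨q, hq⟩, k), hk⟩)
  exact ⟨κ, hκ, Γ', h1, h3, fun k l hkl => disjoint_openImage_image (h1 l) (h2 k) (h4 k l hkl)⟩

/-! ### Disjoint lenses around the arcs -/

namespace GraphArc

/-- The distance from `x` to the endpoints of the base interval. -/
def endDist (Γ : GraphArc) (x : ℝ) : ℝ := min (x - Γ.a) (Γ.b - x)

lemma endDist_pos (Γ : GraphArc) {x : ℝ} : 0 < Γ.endDist x ↔ x ∈ Ioo Γ.a Γ.b := by
  simp [endDist, sub_pos]

lemma endDist_le_abs (Γ : GraphArc) {x x₀ : ℝ} (h : x₀ = Γ.a ∨ x₀ = Γ.b) :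
    Γ.endDist x ≤ |x - x₀| := by
  rcases h with rfl | rfl
  · exact (min_le_left _ _).trans (le_abs_self _)
  · refine (min_le_right _ _).trans ?_
    rw [abs_sub_comm]; exact le_abs_self _

lemma continuous_endDist (Γ : GraphArc) : Continuous Γ.endDist := by
  unfold endDist; fun_prop

end GraphArc

/-- Two boundary arcs meeting only at a common endpoint `p` lie on different sides of `p` in the
bi-Lipschitz coordinate `h`: otherwise, by the intermediate value theorem, they would have interior
points in common. -/
lemma not_both_pos_of_disjoint {M U : Set Plane} {Γ Γ' : GraphArc} {h : Plane → ℝ} {C x₀ y₀ : ℝ}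
    (hh : ∀ q ∈ M ∩ U, ∀ q' ∈ M ∩ U, |h q - h q'| ≤ C * ‖q - q'‖ ∧ ‖q - q'‖ ≤ C * |h q - h q'|)
    (hM : Γ.image ⊆ M) (hM' : Γ'.image ⊆ M) (hd : Disjoint Γ.openImage Γ'.image)
    (hx₀ : x₀ = Γ.a ∨ x₀ = Γ.b) (hp : Γ.curve x₀ = Γ'.curve y₀)
    {S S' : Set ℝ} (hS : S ⊆ Icc Γ.a Γ.b) (hS' : S' ⊆ Icc Γ'.a Γ'.b) (hSc : S.OrdConnected)
    (hSc' : S'.OrdConnected) (hSU : MapsTo Γ.curve S U) (hSU' : MapsTo Γ'.curve S' U)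
    (hx₀S : x₀ ∈ S) (hy₀S : y₀ ∈ S') (hdiam : ∀ x ∈ S, |x - x₀| < Γ.b - Γ.a)
    {x y : ℝ} (hx : x ∈ S) (hy : y ∈ S') :
    ¬(0 < h (Γ.curve x) - h (Γ.curve x₀) ∧ 0 < h (Γ'.curve y) - h (Γ.curve x₀)) := by
  rintro ⟨h1, h2⟩
  have hmem : ∀ x ∈ S, Γ.curve x ∈ M ∩ U := fun x hx => ⟨hM ⟨x, hS hx, rfl⟩, hSU hx⟩
  have hmem' : ∀ y ∈ S', Γ'.curve y ∈ M ∩ U := fun y hy => ⟨hM' ⟨y, hS' hy, rfl⟩, hSU' hy⟩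
  have hhc : ContinuousOn h (M ∩ U) := by
    intro q hq
    rw [ContinuousWithinAt, tendsto_iff_dist_tendsto_zero]
    have h3 : Tendsto (fun z => C * ‖z - q‖) (𝓝[M ∩ U] q) (𝓝 0) := by
      have : Tendsto (fun z => C * ‖z - q‖) (𝓝 q) (𝓝 (C * ‖q - q‖)) :=
        (by fun_prop : Continuous fun z => C * ‖z - q‖).tendsto q
      rw [sub_self, norm_zero, mul_zero] at this
      exact this.mono_left nhdsWithin_le_nhds
    refine squeeze_zero' (Eventually.of_forall fun _ => dist_nonneg) ?_ h3
    filter_upwards [self_mem_nhdsWithin] with z hz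
    exact (hh z hz q hq).1
  have hc : ContinuousOn (fun x => h (Γ.curve x)) S :=
    hhc.comp Γ.continuous_curve.continuousOn hmem
  have hc' : ContinuousOn (fun x => h (Γ'.curve x)) S' :=
    hhc.comp Γ'.continuous_curve.continuousOn hmem'
  set v := min (h (Γ.curve x)) (h (Γ'.curve y)) with hv
  have hv0 : h (Γ.curve x₀) < v := lt_min (by linarith) (by linarith)
  obtain ⟨x₁, hx₁, hvx⟩ := hSc.isPreconnected.intermediate_value hx₀S hx hc
    (show v ∈ Icc _ _ from ⟨hv0.le, min_le_left _ _⟩)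
  obtain ⟨y₁, hy₁, hvy⟩ := hSc'.isPreconnected.intermediate_value hy₀S hy hc'
    (show v ∈ Icc _ _ from ⟨by rw [← hp]; exact hv0.le, min_le_right _ _⟩)
  have hne : x₁ ≠ x₀ := by
    rintro rfl
    simp only at hvx
    linarith
  have hin : x₁ ∈ Ioo Γ.a Γ.b := by
    have h3 := hS hx₁
    have h4 := abs_lt.1 (hdiam x₁ hx₁)
    rcases hx₀ with rfl | rfl
    · exact ⟨lt_of_le_of_ne h3.1 hne.symm, by linarith⟩
    · exact ⟨by linarith, lt_of_le_of_ne h3.2 hne⟩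
  have heq : Γ.curve x₁ = Γ'.curve y₁ := by
    have := (hh _ (hmem x₁ hx₁) _ (hmem' y₁ hy₁)).2
    simp only at hvx hvy
    rw [hvx, hvy, sub_self, abs_zero, mul_zero] at this
    exact sub_eq_zero.1 (norm_eq_zero.1 (le_antisymm this (norm_nonneg _)))
  exact Set.disjoint_left.1 hd ⟨x₁, hin, rfl⟩ (heq ▸ ⟨y₁, hS' hy₁, rfl⟩)

/-- Quantitative separation of two boundary arcs: the distance from a point of one to the other is
at least proportional to its distance from the endpoints. -/
lemma exists_separation {M : Set Plane} (Γ Γ' : GraphArc)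
    (hbil : ∀ p ∈ M, ∃ U ∈ 𝓝 p, ∃ (h : Plane → ℝ) (C : ℝ), 0 < C ∧
      ∀ q ∈ M ∩ U, ∀ q' ∈ M ∩ U, |h q - h q'| ≤ C * ‖q - q'‖ ∧ ‖q - q'‖ ≤ C * |h q - h q'|)
    (hM : Γ.image ⊆ M) (hM' : Γ'.image ⊆ M) (hd : Disjoint Γ.openImage Γ'.image) :
    ∃ c : ℝ, 0 < c ∧ ∀ x ∈ Icc Γ.a Γ.b, ∀ y ∈ Icc Γ'.a Γ'.b,
      c * Γ.endDist x ≤ ‖Γ.curve x - Γ'.curve y‖ := by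
  suffices h : ∃ c : ℝ, 0 < c ∧ ∀ z ∈ Icc Γ.a Γ.b ×ˢ Icc Γ'.a Γ'.b,
      c * Γ.endDist z.1 ≤ ‖Γ.curve z.1 - Γ'.curve z.2‖ by
    obtain ⟨c, hc, h⟩ := h
    exact ⟨c, hc, fun x hx y hy => h (x, y) ⟨hx, hy⟩⟩
  have hdpos : ∀ z ∈ Icc Γ.a Γ.b ×ˢ Icc Γ'.a Γ'.b, 0 ≤ Γ.endDist z.1 := fun z hz =>
    le_min (sub_nonneg.2 hz.1.1) (sub_nonneg.2 hz.1.2)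
  refine (isCompact_Icc.prod isCompact_Icc).induction_on
    (p := fun S => ∃ c : ℝ, 0 < c ∧ ∀ z ∈ (Icc Γ.a Γ.b ×ˢ Icc Γ'.a Γ'.b) ∩ S,
      c * Γ.endDist z.1 ≤ ‖Γ.curve z.1 - Γ'.curve z.2‖) ⟨1, one_pos, by simp⟩ ?_ ?_ ?_ |>.imp
      fun c hc => ⟨hc.1, fun z hz => hc.2 z ⟨hz, hz⟩⟩
  · rintro S T hST ⟨c, hc, h⟩
    exact ⟨c, hc, fun z hz => h z ⟨hz.1, hST hz.2⟩⟩
  · rintro S T ⟨c, hc, h⟩ ⟨c', hc', h'⟩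
    refine ⟨min c c', lt_min hc hc', fun z hz => ?_⟩
    have hp := hdpos z hz.1
    rcases hz.2 with h2 | h2
    · exact (mul_le_mul_of_nonneg_right (min_le_left _ _) hp).trans (h z ⟨hz.1, h2⟩)
    · exact (mul_le_mul_of_nonneg_right (min_le_right _ _) hp).trans (h' z ⟨hz.1, h2⟩)
  · rintro ⟨x₀, y₀⟩ ⟨hx₀, hy₀⟩
    simp only at hx₀ hy₀
    by_cases hp : Γ.curve x₀ = Γ'.curve y₀
    · have hx₀' : x₀ = Γ.a ∨ x₀ = Γ.b := by
        by_contra hcon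
        push Not at hcon
        exact Set.disjoint_left.1 hd
          ⟨x₀, ⟨lt_of_le_of_ne hx₀.1 (Ne.symm hcon.1), lt_of_le_of_ne hx₀.2 hcon.2⟩, rfl⟩
          (hp ▸ ⟨y₀, hy₀, rfl⟩)
      obtain ⟨U, hU, h, C, hC, hh⟩ := hbil (Γ.curve x₀) (hM ⟨x₀, hx₀, rfl⟩)
      obtain ⟨δ, hδ, hδU⟩ := Metric.mem_nhds_iff.1
        (Γ.continuous_curve.continuousAt.preimage_mem_nhds hU)
      obtain ⟨δ', hδ', hδU'⟩ := Metric.mem_nhds_iff.1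
        (Γ'.continuous_curve.continuousAt.preimage_mem_nhds (by rw [← hp]; exact hU))
      set η := min δ (Γ.b - Γ.a)
      have hη : 0 < η := lt_min hδ (sub_pos.2 Γ.lt)
      let S := Icc Γ.a Γ.b ∩ Metric.ball x₀ η
      let S' := Icc Γ'.a Γ'.b ∩ Metric.ball y₀ δ'
      have hball : ∀ (z r : ℝ), (Metric.ball z r).OrdConnected := fun z r => by
        rw [Real.ball_eq_Ioo]; exact ordConnected_Ioo
      have hSc : S.OrdConnected := ordConnected_Icc.inter (hball _ _)
      have hSc' : S'.OrdConnected := ordConnected_Icc.inter (hball _ _)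
      have hSU : MapsTo Γ.curve S U := fun x hx =>
        hδU (Metric.ball_subset_ball (min_le_left _ _) hx.2)
      have hSU' : MapsTo Γ'.curve S' U := fun x hx => hδU' hx.2
      have hx₀S : x₀ ∈ S := ⟨hx₀, Metric.mem_ball_self hη⟩
      have hy₀S : y₀ ∈ S' := ⟨hy₀, Metric.mem_ball_self hδ'⟩
      have hdiam : ∀ x ∈ S, |x - x₀| < Γ.b - Γ.a := fun x hx => by
        have := Metric.mem_ball.1 hx.2
        rw [Real.dist_eq] at this
        exact this.trans_le (min_le_right _ _)
      refine ⟨S ×ˢ S', ?_, 1 / C ^ 2, by positivity, ?_⟩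
      · rw [nhdsWithin_prod_eq]
        exact prod_mem_prod (inter_mem_nhdsWithin _ (Metric.ball_mem_nhds _ hη))
          (inter_mem_nhdsWithin _ (Metric.ball_mem_nhds _ hδ'))
      · rintro ⟨x, y⟩ ⟨-, hx, hy⟩
        simp only at hx hy ⊢
        have n1 := not_both_pos_of_disjoint hh hM hM' hd hx₀' hp inter_subset_left inter_subset_left
          hSc hSc' hSU hSU' hx₀S hy₀S hdiam hx hy
        have n2 := not_both_pos_of_disjoint (h := fun q => -h q) (C := C) (fun q hq q' hq' => by
            have e : |-h q - -h q'| = |h q - h q'| := by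
              rw [← abs_neg]; congr 1; ring
            rw [e]; exact hh q hq q' hq')
          hM hM' hd hx₀' hp inter_subset_left inter_subset_left
          hSc hSc' hSU hSU' hx₀S hy₀S hdiam hx hy
        have hxm : Γ.curve x ∈ M ∩ U := ⟨hM ⟨x, hx.1, rfl⟩, hSU hx⟩
        have hx₀m : Γ.curve x₀ ∈ M ∩ U := ⟨hM ⟨x₀, hx₀, rfl⟩, hSU hx₀S⟩
        have hym : Γ'.curve y ∈ M ∩ U := ⟨hM' ⟨y, hy.1, rfl⟩, hSU' hy⟩
        have e1 := (hh _ hxm _ hym).1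
        have e2 := (hh _ hxm _ hx₀m).2
        have e3 : |h (Γ.curve x) - h (Γ.curve x₀)| ≤ |h (Γ.curve x) - h (Γ'.curve y)| := by
          rcases le_total 0 (h (Γ.curve x) - h (Γ.curve x₀)) with hs | hs
          · rw [abs_of_nonneg hs]
            rcases hs.lt_or_eq with hs' | hs'
            · have : h (Γ'.curve y) - h (Γ.curve x₀) ≤ 0 := by
                by_contra hcon; exact n1 ⟨hs', not_le.1 hcon⟩
              exact le_trans (by linarith) (le_abs_self _)
            · rw [← hs']; exact abs_nonneg _
          · rw [abs_of_nonpos hs]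
            rcases hs.lt_or_eq with hs' | hs'
            · have : 0 ≤ h (Γ'.curve y) - h (Γ.curve x₀) := by
                by_contra hcon; exact n2 ⟨by linarith, by linarith⟩
              exact le_trans (by linarith) (neg_le_abs _)
            · rw [hs']; simp
        have e4 := Γ.abs_X_sub_le (Γ.curve x) (Γ.curve x₀)
        rw [Γ.X_curve, Γ.X_curve] at e4
        have e5 := Γ.endDist_le_abs (x := x) hx₀'
        have e6 : Γ.endDist x ≤ C ^ 2 * ‖Γ.curve x - Γ'.curve y‖ := by
          calc Γ.endDist x ≤ C * |h (Γ.curve x) - h (Γ.curve x₀)| := e5.trans (e4.trans e2)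
            _ ≤ C * (C * ‖Γ.curve x - Γ'.curve y‖) :=
              mul_le_mul_of_nonneg_left (e3.trans e1) hC.le
            _ = _ := by ring
        rw [one_div, inv_mul_le_iff₀ (by positivity)]
        exact e6
    · have hpos : 0 < ‖Γ.curve x₀ - Γ'.curve y₀‖ := norm_pos_iff.2 (sub_ne_zero.2 hp)
      set n := ‖Γ.curve x₀ - Γ'.curve y₀‖
      have hcont : Continuous fun z : ℝ × ℝ => ‖Γ.curve z.1 - Γ'.curve z.2‖ := by
        have := Γ.continuous_curve; have := Γ'.continuous_curve
        fun_prop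
      have hab := sub_pos.2 Γ.lt
      refine ⟨{z | n / 2 < ‖Γ.curve z.1 - Γ'.curve z.2‖}, ?_, n / 2 / (Γ.b - Γ.a), by positivity, ?_⟩
      · apply mem_nhdsWithin_of_mem_nhds
        exact (isOpen_lt continuous_const hcont).mem_nhds (by show n / 2 < n; linarith)
      · rintro z ⟨hz, hz'⟩
        refine le_trans ?_ (le_of_lt hz')
        rw [div_mul_eq_mul_div, div_le_iff₀ hab]
        apply mul_le_mul_of_nonneg_left _ (by positivity)
        refine (min_le_left _ _).trans ?_
        linarith [hz.1.2]

namespace GraphArc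

/-- The same arc seen from the other side: the frame is rotated by `π`. -/
def flip (Γ : GraphArc) : GraphArc where
  c := -Γ.c
  s := -Γ.s
  unit := by linarith [Γ.unit, neg_sq Γ.c, neg_sq Γ.s]
  g := fun x => -Γ.g (-x)
  contDiff_g := (Γ.contDiff_g.comp contDiff_neg).neg
  a := -Γ.b
  b := -Γ.a
  lt := neg_lt_neg Γ.lt

lemma flip_pt (Γ : GraphArc) (x σ : ℝ) : Γ.flip.pt x σ = Γ.pt (-x) (-σ) := by
  ext j
  fin_cases j
  · simp only [flip, pt, Fin.zero_eta, framePt_zero]; ring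
  · simp only [flip, pt, Fin.mk_one, framePt_one]; ring

lemma flip_curve (Γ : GraphArc) (x : ℝ) : Γ.flip.curve x = Γ.curve (-x) := by
  rw [curve, flip_pt, neg_zero, curve]

lemma flip_image (Γ : GraphArc) : Γ.flip.image = Γ.image := by
  ext r
  constructor
  · rintro ⟨x, hx, rfl⟩
    exact ⟨-x, ⟨by have := hx.2; simp only [flip] at this; linarith,
      by have := hx.1; simp only [flip] at this; linarith⟩, (Γ.flip_curve x).symm⟩
  · rintro ⟨x, hx, rfl⟩
    refine ⟨-x, ⟨neg_le_neg hx.2, neg_le_neg hx.1⟩, ?_⟩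
    rw [flip_curve, neg_neg]

lemma flip_endDist (Γ : GraphArc) (x : ℝ) : Γ.flip.endDist x = Γ.endDist (-x) := by
  simp only [endDist, flip]
  rw [min_comm]
  congr 1 <;> ring

end GraphArc

/-- If the lens of opening `ρ` around a boundary arc meets the boundary only in the arc, then one of
its two halves lies in the domain, being connected and disjoint from the boundary. -/
lemma upper_or_lower_lens_subset {Ω : Set Plane} (hΩ : IsOpen Ω) (Γ : GraphArc) {ρ : ℝ} (hρ : 0 < ρ)
    (hM : Γ.image ⊆ frontier Ω)
    (h : ∀ x σ, |σ| < ρ * Γ.endDist x → Γ.pt x σ ∈ frontier Ω → σ = 0) :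
    (∀ x σ, 0 < σ → σ < ρ * Γ.endDist x → Γ.pt x σ ∈ Ω) ∨
    (∀ x σ, σ < 0 → -σ < ρ * Γ.endDist x → Γ.pt x σ ∈ Ω) := by
  have hfr : Ω ∩ frontier Ω = ∅ := hΩ.inter_frontier_eq
  -- the set of lens coordinates on a given side is convex
  have hconv : ∀ τ : ℝ, Convex ℝ {z : ℝ × ℝ | 0 < τ * z.2 ∧ τ * z.2 < ρ * Γ.endDist z.1} := by
    intro τ
    rintro ⟨x, σ⟩ ⟨h1, h2⟩ ⟨x', σ'⟩ ⟨h1', h2'⟩ a b ha hb hab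
    simp only [GraphArc.endDist, mul_min_of_nonneg _ _ hρ.le, lt_min_iff] at h1 h2 h1' h2'
    have hb' : b = 1 - a := by linarith
    have key : ∀ p q p' q' : ℝ, p < q → p' < q' → a * p + b * p' < a * q + b * q' := by
      intro p q p' q' hp hq
      rcases ha.lt_or_eq with ha' | ha'
      · have := mul_lt_mul_of_pos_left hp ha'
        have := mul_le_mul_of_nonneg_left hq.le hb
        linarith
      · rw [← ha', sub_zero] at hb'
        rw [← ha', hb']; linarith
    refine ⟨?_, ?_⟩
    · have := key _ _ _ _ h1 h1'
      simp only [Prod.smul_mk, Prod.mk_add_mk, smul_eq_mul]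
      linarith
    · simp only [Prod.smul_mk, Prod.mk_add_mk, smul_eq_mul, GraphArc.endDist,
        mul_min_of_nonneg _ _ hρ.le, lt_min_iff]
      constructor
      · have := key _ _ _ _ h2.1 h2'.1
        rw [hb'] at this ⊢; linarith
      · have := key _ _ _ _ h2.2 h2'.2
        rw [hb'] at this ⊢; linarith
  have hside : ∀ τ : ℝ, (τ = 1 ∨ τ = -1) →
      (∃ z : ℝ × ℝ, (0 < τ * z.2 ∧ τ * z.2 < ρ * Γ.endDist z.1) ∧ Γ.pt z.1 z.2 ∈ Ω) →
      ∀ z : ℝ × ℝ, (0 < τ * z.2 ∧ τ * z.2 < ρ * Γ.endDist z.1) → Γ.pt z.1 z.2 ∈ Ω := by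
    rintro τ hτ ⟨w, hw, hwΩ⟩ z hz
    by_contra hzΩ
    have hpre := ((hconv τ).isPreconnected.image (fun z : ℝ × ℝ => Γ.pt z.1 z.2)
      Γ.continuous_pt.continuousOn)
    have hnf : ∀ y ∈ {z : ℝ × ℝ | 0 < τ * z.2 ∧ τ * z.2 < ρ * Γ.endDist z.1},
        Γ.pt y.1 y.2 ∉ frontier Ω := by
      intro y hy hr
      have habs : |y.2| = τ * y.2 := by
        have := hy.1
        rcases hτ with rfl | rfl
        · rw [one_mul] at this ⊢; exact abs_of_pos this
        · rw [neg_one_mul] at this ⊢; exact abs_of_neg (by linarith)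
      have := h y.1 y.2 (habs ▸ hy.2) hr
      have h0 := hy.1
      rw [this, mul_zero] at h0
      exact lt_irrefl _ h0
    have hsub := isPreconnected_iff_subset_of_disjoint.1 hpre Ω (closure Ω)ᶜ hΩ
      isClosed_closure.isOpen_compl (by
        rintro _ ⟨y, hy, rfl⟩
        by_contra hcon
        rw [mem_union, mem_compl_iff, not_or, not_not] at hcon
        exact hnf y hy (by rw [hΩ.frontier_eq]; exact ⟨hcon.2, hcon.1⟩))
      (by
        rw [(disjoint_compl_right_iff_subset.2 subset_closure).inter_eq, inter_empty])
    rcases hsub with hsub | hsub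
    · exact hzΩ (hsub ⟨z, hz, rfl⟩)
    · exact hsub ⟨w, hw, rfl⟩ (subset_closure hwΩ)
  -- some point of the lens lies in the domain
  set x₀ := (Γ.a + Γ.b) / 2 with hx₀
  have hlt := Γ.lt
  have hx₀m : x₀ ∈ Ioo Γ.a Γ.b := ⟨by rw [hx₀]; linarith, by rw [hx₀]; linarith⟩
  have hcl : Γ.curve x₀ ∈ closure Ω := frontier_subset_closure (hM ⟨x₀, Ioo_subset_Icc_self hx₀m, rfl⟩)
  have hopen : IsOpen {r : Plane | |Γ.Y r - Γ.g (Γ.X r)| < ρ * Γ.endDist (Γ.X r)} := by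
    have h1 := Γ.continuous_X
    have h2 := Γ.continuous_Y
    have h3 := Γ.contDiff_g.continuous
    have h4 := Γ.continuous_endDist
    exact isOpen_lt (by fun_prop) (by fun_prop)
  obtain ⟨r, hr, hrΩ⟩ := mem_closure_iff.1 hcl _ hopen (by
    show |Γ.Y (Γ.curve x₀) - Γ.g (Γ.X (Γ.curve x₀))| < ρ * Γ.endDist (Γ.X (Γ.curve x₀))
    rw [Γ.X_curve, GraphArc.curve, Γ.Y_pt, add_zero, sub_self, abs_zero]
    exact mul_pos hρ (Γ.endDist_pos.2 hx₀m))
  set x := Γ.X r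
  set σ := Γ.Y r - Γ.g x with hσ
  have hrpt : Γ.pt x σ = r := Γ.pt_X_Y r
  have hr' : |σ| < ρ * Γ.endDist x := hr
  rcases lt_trichotomy σ 0 with h0 | h0 | h0
  · right
    have := hside (-1) (Or.inr rfl) ⟨(x, σ), ⟨by simpa using h0, by
      rw [abs_of_neg h0] at hr'; simpa using hr'⟩, by rw [hrpt]; exact hrΩ⟩
    intro x' σ' h1 h2
    exact this (x', σ') ⟨by simpa using h1, by simpa using h2⟩
  · exfalso
    have hx : x ∈ Ioo Γ.a Γ.b := by
      rw [← Γ.endDist_pos]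
      rw [h0, abs_zero] at hr'
      exact (mul_pos_iff_of_pos_left hρ).1 hr'
    have h1 : r ∈ frontier Ω := hM ⟨x, Ioo_subset_Icc_self hx, by rw [← hrpt, h0]; rfl⟩
    have : r ∈ Ω ∩ frontier Ω := ⟨hrΩ, h1⟩
    rw [hfr] at this
    exact this
  · left
    have := hside 1 (Or.inl rfl) ⟨(x, σ), ⟨by simpa using h0, by
      rw [abs_of_pos h0] at hr'; simpa using hr'⟩, by rw [hrpt]; exact hrΩ⟩
    intro x' σ' h1 h2
    exact this (x', σ') ⟨by simpa using h1, by simpa using h2⟩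

/-- The boundary of a bounded smooth curvilinear polygon is covered by finitely many graph arcs with
the domain above each of them, in such a way that the lenses of opening `ρ` above the arcs are
contained in the domain and pairwise disjoint. -/
theorem exists_lens_arcs {Ω : Set Plane} (hopen : IsOpen Ω) (hb : Bornology.IsBounded Ω)
    (hΩ : IsSmoothCurvilinearPolygon Ω) :
    ∃ (κ : Type) (_ : Finite κ) (Γ : κ → GraphArc) (ρ : ℝ), 0 < ρ ∧
      (frontier Ω ⊆ ⋃ k, (Γ k).image) ∧ (∀ k, (Γ k).image ⊆ frontier Ω) ∧
      (∀ k x σ, 0 < σ → σ < ρ * (Γ k).endDist x → (Γ k).pt x σ ∈ Ω) ∧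
      ∀ k l x y σ τ, |σ| < ρ * (Γ k).endDist x → |τ| < ρ * (Γ l).endDist y →
        (Γ k).pt x σ = (Γ l).pt y τ → k = l := by
  obtain ⟨κ, hκ, Γ, hM, hcov, hdisj⟩ := hΩ.exists_finite_arcs hb
  have hsep : ∀ z : κ × κ, ∃ c : ℝ, 0 < c ∧ (z.1 ≠ z.2 → ∀ x ∈ Icc (Γ z.1).a (Γ z.1).b,
      ∀ y ∈ Icc (Γ z.2).a (Γ z.2).b,
      c * (Γ z.1).endDist x ≤ ‖(Γ z.1).curve x - (Γ z.2).curve y‖) := by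
    intro z
    by_cases hz : z.1 = z.2
    · exact ⟨1, one_pos, fun h => absurd hz h⟩
    · obtain ⟨c, hc, h⟩ := exists_separation (M := frontier Ω) (Γ z.1) (Γ z.2)
        (fun p hp => hΩ.exists_bilipschitz hp) (hM _) (hM _) (hdisj _ _ hz)
      exact ⟨c, hc, fun _ => h⟩
  choose c hc hcsep using hsep
  obtain ⟨ρ, hρ, hρc⟩ : ∃ ρ : ℝ, 0 < ρ ∧ ∀ z, 2 * ρ ≤ c z := by
    have hfin : (range c).Finite := finite_range c
    rcases (range c).eq_empty_or_nonempty with he | hne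
    · refine ⟨1, one_pos, fun z => absurd (mem_range_self (f := c) z) (by rw [he]; simp)⟩
    · obtain ⟨m, ⟨z₀, rfl⟩, hm⟩ := exists_min_image _ id hfin hne
      refine ⟨c z₀ / 2, by linarith [hc z₀], fun z => ?_⟩
      have := hm (c z) (mem_range_self z)
      simp only [id] at this
      linarith
  have hIoo : ∀ k x σ, |σ| < ρ * (Γ k).endDist x → x ∈ Ioo (Γ k).a (Γ k).b := fun k x σ h => by
    rw [← GraphArc.endDist_pos]
    exact (mul_pos_iff_of_pos_left hρ).1 ((abs_nonneg σ).trans_lt h)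
  have hlens : ∀ k l x y σ τ, |σ| < ρ * (Γ k).endDist x → |τ| < ρ * (Γ l).endDist y →
        (Γ k).pt x σ = (Γ l).pt y τ → k = l := by
    -- it suffices to treat the case where `x` is the point farther from the endpoints
    have aux : ∀ k l x y σ τ, |σ| < ρ * (Γ k).endDist x → |τ| < ρ * (Γ l).endDist y →
        (Γ l).endDist y ≤ (Γ k).endDist x → (Γ k).pt x σ = (Γ l).pt y τ → k = l := by
      intro k l x y σ τ hσ hτ hle heq
      by_contra hkl
      have h1 := hcsep (k, l) hkl x (Ioo_subset_Icc_self (hIoo k x σ hσ)) y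
        (Ioo_subset_Icc_self (hIoo l y τ hτ))
      simp only at h1
      have h2 : ‖(Γ k).curve x - (Γ l).curve y‖ ≤ |σ| + |τ| := by
        have e : (Γ k).curve x - (Γ l).curve y
            = ((Γ l).pt y τ - (Γ l).curve y) - ((Γ k).pt x σ - (Γ k).curve x) := by
          rw [heq]; abel
        rw [e]
        refine (norm_sub_le _ _).trans ?_
        rw [GraphArc.norm_pt_sub_curve, GraphArc.norm_pt_sub_curve]
        linarith
      have h3 := mul_le_mul_of_nonneg_right (hρc (k, l))
        ((Γ k).endDist_pos.2 (hIoo k x σ hσ)).le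
      have h4 := mul_le_mul_of_nonneg_left hle hρ.le
      linarith
    intro k l x y σ τ hσ hτ heq
    rcases le_total ((Γ l).endDist y) ((Γ k).endDist x) with h | h
    · exact aux k l x y σ τ hσ hτ h heq
    · exact (aux l k y x τ σ hτ hσ h heq.symm).symm
  have hfront : ∀ k x σ, |σ| < ρ * (Γ k).endDist x → (Γ k).pt x σ ∈ frontier Ω → σ = 0 := by
    intro k x σ hσ hfr
    obtain ⟨l, y, hy, hyx⟩ := mem_iUnion.1 (hcov hfr)
    by_cases hkl : k = l
    · subst hkl
      have h1 := congrArg (Γ k).X hyx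
      have h2 := congrArg (Γ k).Y hyx
      rw [GraphArc.X_curve, GraphArc.X_pt] at h1
      rw [GraphArc.curve, GraphArc.Y_pt, GraphArc.Y_pt, h1] at h2
      linarith
    · exfalso
      have hx := hIoo k x σ hσ
      have h1 := hcsep (k, l) hkl x (Ioo_subset_Icc_self hx) y hy
      simp only at h1
      rw [hyx, ← norm_neg, neg_sub, GraphArc.norm_pt_sub_curve] at h1
      have hp := (Γ k).endDist_pos.2 hx
      have h3 := mul_le_mul_of_nonneg_right (hρc (k, l)) hp.le
      have := mul_pos hρ hp
      linarith
  have hor := fun k => upper_or_lower_lens_subset hopen (Γ k) hρ (hM k) (hfront k)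
  classical
  let up : κ → Prop := fun k => ∀ x σ, 0 < σ → σ < ρ * (Γ k).endDist x → (Γ k).pt x σ ∈ Ω
  let Γ' : κ → GraphArc := fun k => if up k then Γ k else (Γ k).flip
  have himg : ∀ k, (Γ' k).image = (Γ k).image := fun k => by
    simp only [Γ']; split_ifs
    · rfl
    · exact (Γ k).flip_image
  have hpt : ∀ k x σ, |σ| < ρ * (Γ' k).endDist x →
      ∃ x' σ', |σ'| < ρ * (Γ k).endDist x' ∧ (Γ' k).pt x σ = (Γ k).pt x' σ' := by
    intro k x σ h
    simp only [Γ'] at h ⊢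
    split_ifs at h ⊢
    · exact ⟨x, σ, h, rfl⟩
    · refine ⟨-x, -σ, ?_, (Γ k).flip_pt x σ⟩
      rwa [abs_neg, ← GraphArc.flip_endDist]
  refine ⟨κ, hκ, Γ', ρ, hρ, ?_, fun k => (himg k).symm ▸ hM k, ?_, ?_⟩
  · simpa only [himg] using hcov
  · intro k x σ h0 h1
    by_cases hu : up k
    · simp only [Γ', if_pos hu] at h1 ⊢
      exact hu x σ h0 h1
    · simp only [Γ', if_neg hu, GraphArc.flip_endDist, GraphArc.flip_pt] at h1 ⊢
      rcases hor k with h | h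
      · exact absurd h hu
      · exact h (-x) (-σ) (by linarith) (by linarith)
  · intro k l x y σ τ hσ hτ heq
    obtain ⟨x', σ', h1, h2⟩ := hpt k x σ hσ
    obtain ⟨y', τ', h3, h4⟩ := hpt l y τ hτ
    exact hlens k l x' y' σ' τ' h1 h3 (by rw [← h2, ← h4, heq])

/-! ### Length of the boundary -/

namespace GraphArc

/-- The speed `√(1 + g'²)` of the parametrization of the graph. -/
def w (Γ : GraphArc) (x : ℝ) : ℝ := √(1 + deriv Γ.g x ^ 2)

/-- The arclength along the graph, measured from the left endpoint. -/
def arclen (Γ : GraphArc) (x : ℝ) : ℝ := ∫ y in Γ.a..x, Γ.w y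

lemma one_le_w (Γ : GraphArc) (x : ℝ) : 1 ≤ Γ.w x := by
  rw [w, Real.one_le_sqrt]
  linarith [sq_nonneg (deriv Γ.g x)]

lemma w_pos (Γ : GraphArc) (x : ℝ) : 0 < Γ.w x := zero_lt_one.trans_le (Γ.one_le_w x)

lemma w_sq (Γ : GraphArc) (x : ℝ) : Γ.w x ^ 2 = 1 + deriv Γ.g x ^ 2 :=
  Real.sq_sqrt (by positivity)

lemma contDiff_deriv_g (Γ : GraphArc) : ContDiff ℝ 1 (deriv Γ.g) :=
  (contDiff_succ_iff_deriv.1 (show ContDiff ℝ (1 + 1) Γ.g by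
    rw [one_add_one_eq_two]; exact Γ.contDiff_g)).2.2

lemma contDiff_w (Γ : GraphArc) : ContDiff ℝ 1 Γ.w := by
  have h := Γ.contDiff_deriv_g
  have : ∀ x, 1 + deriv Γ.g x ^ 2 ≠ 0 := fun x => by positivity
  exact ContDiff.sqrt (contDiff_const.add (h.pow 2)) this

lemma hasDerivAt_g (Γ : GraphArc) (x : ℝ) : HasDerivAt Γ.g (deriv Γ.g x) x :=
  (Γ.contDiff_g.differentiable (by simp) x).hasDerivAt

lemma hasDerivAt_arclen (Γ : GraphArc) (x : ℝ) : HasDerivAt Γ.arclen (Γ.w x) x :=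
  intervalIntegral.integral_hasDerivAt_right (Γ.contDiff_w.continuous.intervalIntegrable _ _)
    (Γ.contDiff_w.continuous.stronglyMeasurableAtFilter _ _) Γ.contDiff_w.continuous.continuousAt

lemma strictMono_arclen (Γ : GraphArc) : StrictMono Γ.arclen :=
  strictMono_of_deriv_pos fun x => by
    rw [(Γ.hasDerivAt_arclen x).deriv]; exact Γ.w_pos x

lemma arclen_a (Γ : GraphArc) : Γ.arclen Γ.a = 0 := intervalIntegral.integral_same

/-- A chord is not longer than the arc it subtends. -/
lemma norm_curve_sub_le (Γ : GraphArc) {x y : ℝ} (hxy : y ≤ x) :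
    ‖Γ.curve x - Γ.curve y‖ ≤ Γ.arclen x - Γ.arclen y := by
  set D := ‖Γ.curve x - Γ.curve y‖ with hD
  have hsq : D ^ 2 = (x - y) ^ 2 + (Γ.g x - Γ.g y) ^ 2 := by
    rw [hD, Γ.norm_sub_sq, X_curve, X_curve]
    simp [curve]
  have hmono : Monotone fun z => D * Γ.arclen z - (x - y) * z - (Γ.g x - Γ.g y) * Γ.g z := by
    have hd : ∀ z, HasDerivAt (fun z => D * Γ.arclen z - (x - y) * z - (Γ.g x - Γ.g y) * Γ.g z)
        (D * Γ.w z - (x - y) * 1 - (Γ.g x - Γ.g y) * deriv Γ.g z) z := fun z =>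
      (((Γ.hasDerivAt_arclen z).const_mul D).sub ((hasDerivAt_id z).const_mul (x - y))).sub
        ((Γ.hasDerivAt_g z).const_mul _)
    refine monotone_of_deriv_nonneg (fun z => (hd z).differentiableAt) fun z => ?_
    rw [(hd z).deriv]
    have : (x - y) * 1 + (Γ.g x - Γ.g y) * deriv Γ.g z ≤ D * Γ.w z := by
      apply le_of_sq_le_sq _ (mul_nonneg (norm_nonneg _) (Γ.w_pos z).le)
      rw [mul_pow, hsq, Γ.w_sq]
      nlinarith [sq_nonneg ((x - y) * deriv Γ.g z - (Γ.g x - Γ.g y))]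
    linarith
  have h := hmono hxy
  simp only at h
  have h2 : D * D ≤ D * (Γ.arclen x - Γ.arclen y) := by nlinarith
  rcases (norm_nonneg (Γ.curve x - Γ.curve y)).eq_or_lt with h0 | h0
  · rw [hD, ← h0, sub_nonneg]; exact Γ.strictMono_arclen.monotone hxy
  · exact le_of_mul_le_mul_left h2 h0

lemma hausdorffMeasure_image_le (Γ : GraphArc) :
    Measure.hausdorffMeasure (1 : ℝ) Γ.image ≤ ENNReal.ofReal (Γ.arclen Γ.b) := by
  have hinv : ∀ x, Function.invFun Γ.arclen (Γ.arclen x) = x :=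
    Function.leftInverse_invFun Γ.strictMono_arclen.injective
  have himage : Γ.image = (Γ.curve ∘ Function.invFun Γ.arclen) '' (Γ.arclen '' Icc Γ.a Γ.b) := by
    rw [image_image, image]
    refine image_congr fun x _ => ?_
    rw [Function.comp_apply, hinv]
  have hlip : LipschitzOnWith 1 (Γ.curve ∘ Function.invFun Γ.arclen)
      (Γ.arclen '' Icc Γ.a Γ.b) := by
    rw [lipschitzOnWith_iff_dist_le_mul]
    rintro _ ⟨x, -, rfl⟩ _ ⟨y, -, rfl⟩
    rw [Function.comp_apply, Function.comp_apply, hinv, hinv, NNReal.coe_one, one_mul]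
    rcases le_total y x with h | h
    · rw [dist_eq_norm, Real.dist_eq]
      exact (Γ.norm_curve_sub_le h).trans (le_abs_self _)
    · rw [dist_comm, dist_eq_norm, dist_comm, Real.dist_eq]
      exact (Γ.norm_curve_sub_le h).trans (le_abs_self _)
  have h1 := hlip.hausdorffMeasure_image_le zero_le_one
  rw [← himage, ENNReal.coe_one, ENNReal.one_rpow, one_mul, hausdorffMeasure_real] at h1
  refine h1.trans ((measure_mono (t := Icc (Γ.arclen Γ.a) (Γ.arclen Γ.b)) ?_).trans ?_)
  · rintro _ ⟨x, hx, rfl⟩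
    exact ⟨Γ.strictMono_arclen.monotone hx.1, Γ.strictMono_arclen.monotone hx.2⟩
  · rw [Real.volume_Icc, arclen_a, sub_zero]

end GraphArc

lemma perimeter_le_sum_arclen {Ω : Set Plane} {κ : Type} [Fintype κ] (Γ : κ → GraphArc)
    (h : frontier Ω ⊆ ⋃ k, (Γ k).image) : perimeter Ω ≤ ∑ k, (Γ k).arclen (Γ k).b := by
  have h0 : ∀ k, 0 ≤ (Γ k).arclen (Γ k).b := fun k => by
    rw [← (Γ k).arclen_a]; exact (Γ k).strictMono_arclen.monotone (Γ k).lt.le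
  refine ENNReal.toReal_le_of_le_ofReal (Finset.sum_nonneg fun k _ => h0 k) ?_
  rw [ENNReal.ofReal_sum_of_nonneg fun k _ => h0 k]
  refine (measure_mono h).trans ((measure_iUnion_fintype_le _ _).trans ?_)
  exact Finset.sum_le_sum fun k _ => (Γ k).hausdorffMeasure_image_le

/-! ### Test configurations glued from disjoint pieces -/

/-- A function which is `C¹` on an open set has its classical derivatives as weak derivatives. -/
lemma hasWeakDeriv_of_contDiffOn {F : Type*} [NormedAddCommGroup F] [NormedSpace ℝ F]
    {U : Set Plane} (hU : IsOpen U) {f : Plane → F} (hf : ContDiffOn ℝ 1 f U) (v : Plane) :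
    HasWeakDeriv U v f (fun r => fderiv ℝ f r v) := by
  intro φ hφ hc hs
  have hφ1 : ContDiff ℝ 1 φ := hφ.of_le (by exact_mod_cast le_top)
  have hd : ContinuousOn (fun r => fderiv ℝ f r v) U :=
    (hf.continuousOn_fderiv_of_isOpen hU le_rfl).clm_apply continuousOn_const
  have hdφ : Continuous fun r => fderiv ℝ φ r v :=
    (hφ1.continuous_fderiv one_ne_zero).clm_apply continuous_const
  have hφ0 : ∀ r ∉ tsupport φ, φ r = 0 := fun r hr => image_eq_zero_of_notMem_tsupport hr
  have hdφ0 : ∀ r ∉ tsupport φ, fderiv ℝ φ r v = 0 := fun r hr => by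
    have : fderiv ℝ φ r = 0 := by
      by_contra h
      exact hr (support_fderiv_subset ℝ h)
    rw [this]; rfl
  have hint : ∀ h : Plane → ℝ, ∀ k : Plane → F, Continuous h → ContinuousOn k U →
      (∀ r ∉ tsupport φ, h r = 0) → Integrable (fun r => h r • k r) := by
    intro h k hh hk h0
    rw [← integrableOn_iff_integrable_of_support_subset (s := tsupport φ)]
    · exact (hh.continuousOn.smul (hk.mono hs)).integrableOn_compact hc
    · intro r hr
      by_contra hr'
      exact hr (by simp only [h0 r hr', zero_smul])
  have e1 : ∫ r in U, fderiv ℝ φ r v • f r = ∫ r, fderiv ℝ φ r v • f r :=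
    setIntegral_eq_integral_of_forall_compl_eq_zero fun r hr => by
      rw [hdφ0 r fun h => hr (hs h), zero_smul]
  have e2 : ∫ r in U, φ r • fderiv ℝ f r v = ∫ r, φ r • fderiv ℝ f r v :=
    setIntegral_eq_integral_of_forall_compl_eq_zero fun r hr => by
      rw [hφ0 r fun h => hr (hs h), zero_smul]
  rw [e1, e2]
  have key := integral_bilinear_hasFDerivAt_right_eq_neg_left_of_integrable (μ := volume)
    (f := f) (f' := fderiv ℝ f) (g := φ) (g' := fderiv ℝ φ) (v := v)
    (B := (ContinuousLinearMap.lsmul ℝ ℝ : ℝ →L[ℝ] F →L[ℝ] F).flip)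
    (by simpa using hint φ _ hφ.continuous hd hφ0)
    (by simpa using hint _ f hdφ hf.continuousOn hdφ0)
    (by simpa using hint φ f hφ.continuous hf.continuousOn hφ0)
    (fun r hr => ((hf.differentiableOn one_ne_zero r (hs hr)).differentiableAt
      (hU.mem_nhds (hs hr))).hasFDerivAt)
    (fun r _ => (hφ1.differentiable one_ne_zero r).hasFDerivAt)
  simpa using key

/-- The vector potential of the constant unit magnetic field, in the symmetric gauge. -/
def vecPot (r : Plane) : Plane := framePt 0 (1 / 2) (r 0) (r 1)

/-- The vector potential as a linear map. -/
def vecPotCLM : Plane →L[ℝ] Plane :=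
  LinearMap.toContinuousLinearMap
    { toFun := vecPot
      map_add' := fun x y => by
        ext j; fin_cases j <;> simp [vecPot] <;> ring
      map_smul' := fun x y => by
        ext j; fin_cases j <;> simp [vecPot] <;> ring }

/-- The energy density of an order parameter in the constant unit magnetic field. -/
def density (b ε : ℝ) (Ψ : Plane → ℂ) (r : Plane) : ℝ :=
  (∑ j : Fin 2, ‖fderiv ℝ Ψ r (e j) + Complex.I * ((vecPot r j / ε ^ 2 : ℝ) : ℂ) * Ψ r‖ ^ 2)
    - 1 / (2 * b * ε ^ 2) * (2 * ‖Ψ r‖ ^ 2 - ‖Ψ r‖ ^ 4)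

lemma continuous_density (b ε : ℝ) {Ψ : Plane → ℂ} (h : ContDiff ℝ 1 Ψ) :
    Continuous (density b ε Ψ) := by
  have h1 := h.continuous
  have h2 : ∀ j : Fin 2, Continuous fun r => fderiv ℝ Ψ r (e j) := fun j =>
    (h.continuous_fderiv one_ne_zero).clm_apply continuous_const
  have h3 : ∀ j : Fin 2, Continuous fun r => vecPot r j := fun j =>
    (EuclideanSpace.proj j : Plane →L[ℝ] ℝ).continuous.comp vecPotCLM.continuous
  unfold density
  refine Continuous.sub (continuous_finsetSum _ fun j _ => ?_) (by fun_prop)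
  have := h2 j
  have := h3 j
  fun_prop

lemma density_congr (b ε : ℝ) {Ψ Ψ' : Plane → ℂ} {r : Plane} (h : Ψ =ᶠ[𝓝 r] Ψ') :
    density b ε Ψ r = density b ε Ψ' r := by
  simp only [density, h.fderiv_eq, h.self_of_nhds]

lemma density_zero (b ε : ℝ) (r : Plane) : density b ε (fun _ => 0) r = 0 := by
  simp [density]

/-- The energy is bounded below on a set of finite measure, since `2 x² - x⁴ ≤ 1`. -/
lemma bddBelow_range_energy {Ω : Set Plane} (hfin : volume Ω ≠ ⊤) {b ε : ℝ} (hb : 0 < b) :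
    BddBelow (range fun c : Config Ω => c.energy b ε) := by
  refine ⟨-(1 / (2 * b * ε ^ 2) * volume.real Ω), ?_⟩
  rintro _ ⟨c, rfl⟩
  have hq : 0 ≤ 1 / (2 * b * ε ^ 2) := by positivity
  have h2 : 0 ≤ 1 / ε ^ 4 * ∫ r, |c.curl r - 1| ^ 2 :=
    mul_nonneg (by positivity) (integral_nonneg fun r => by positivity)
  have h1 : -(1 / (2 * b * ε ^ 2) * volume.real Ω) ≤
      ∫ r in Ω, ((∑ j : Fin 2, ‖c.magGrad ε j r‖ ^ 2)
      - 1 / (2 * b * ε ^ 2) * (2 * ‖c.ψ r‖ ^ 2 - ‖c.ψ r‖ ^ 4)) := by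
    by_cases hint : Integrable (fun r => (∑ j : Fin 2, ‖c.magGrad ε j r‖ ^ 2)
      - 1 / (2 * b * ε ^ 2) * (2 * ‖c.ψ r‖ ^ 2 - ‖c.ψ r‖ ^ 4)) (volume.restrict Ω)
    · have hci : Integrable (fun _ : Plane => -(1 / (2 * b * ε ^ 2))) (volume.restrict Ω) :=
        integrableOn_const hfin
      have := integral_mono hci hint fun r => by
        have h3 : 0 ≤ ∑ j : Fin 2, ‖c.magGrad ε j r‖ ^ 2 :=
          Finset.sum_nonneg fun _ _ => by positivity
        have h4 : 2 * ‖c.ψ r‖ ^ 2 - ‖c.ψ r‖ ^ 4 ≤ 1 := by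
          nlinarith [sq_nonneg (‖c.ψ r‖ ^ 2 - 1)]
        have := mul_le_mul_of_nonneg_left h4 hq
        simp only
        linarith
      rw [setIntegral_const, smul_eq_mul] at this
      linarith
    · rw [integral_undef hint, neg_nonpos]
      positivity
  simp only [Config.energy]
  linarith

/-- Test functions for the ground state energy glued from finitely many pieces `Ψ k`, each of them
`C¹` and used only on `S k`: as the part of `S k` where `Ψ k` does not vanish stays away from the
rest of the domain, no jump is created inside `Ω`, and the energies of the pieces add up. -/
lemma groundEnergy_le_sum_density {Ω : Set Plane} (hΩ : IsOpen Ω) (hbdd : Bornology.IsBounded Ω)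
    {b ε : ℝ} (hb : 0 < b) {κ : Type} [Fintype κ] (S K : κ → Set Plane) (Ψ : κ → Plane → ℂ)
    (hΨ : ∀ k, ContDiff ℝ 1 (Ψ k)) (hS : ∀ k, IsOpen (S k)) (hSΩ : ∀ k, S k ⊆ Ω)
    (hdisj : Pairwise fun k l => Disjoint (S k) (S l)) (hK : ∀ k, IsClosed (K k))
    (hKS : ∀ k, K k ∩ Ω ⊆ S k) (h0 : ∀ k, ∀ r ∈ S k, r ∉ K k → Ψ k r = 0) :
    groundEnergy Ω b ε ≤ ∑ k, ∫ r in S k, density b ε (Ψ k) r := by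
  classical
  have hfin : volume Ω ≠ ⊤ := hbdd.measure_lt_top.ne
  have : IsFiniteMeasure (volume.restrict Ω) := ⟨by simpa using hbdd.measure_lt_top⟩
  set ψ : Plane → ℂ := fun r => ∑ k, (S k).indicator (Ψ k) r with hψ
  have hψS : ∀ k, ∀ r ∈ S k, ψ r = Ψ k r := by
    intro k r hr
    rw [hψ]
    simp only
    rw [Finset.sum_eq_single k, indicator_of_mem hr]
    · intro l _ hl
      exact indicator_of_notMem (fun h => (hdisj hl).le_bot ⟨h, hr⟩) _
    · simp
  have hev : ∀ k, ∀ r ∈ S k, ψ =ᶠ[𝓝 r] Ψ k := fun k r hr =>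
    Filter.eventuallyEq_of_mem ((hS k).mem_nhds hr) (hψS k)
  have hev0 : ∀ r ∈ Ω, (∀ k, r ∉ S k) → ψ =ᶠ[𝓝 r] fun _ => 0 := by
    intro r hr hrS
    have : ∀ᶠ r' in 𝓝 r, ∀ k, r' ∉ K k := by
      rw [eventually_all]
      intro k
      exact (hK k).isOpen_compl.mem_nhds fun h => hrS k (hKS k ⟨h, hr⟩)
    filter_upwards [this] with r' hr'
    refine Finset.sum_eq_zero fun k _ => ?_
    by_cases h : r' ∈ S k
    · rw [indicator_of_mem h, h0 k r' h (hr' k)]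
    · exact indicator_of_notMem h _
  have hcd : ContDiffOn ℝ 1 ψ Ω := by
    intro r hr
    apply ContDiffAt.contDiffWithinAt
    by_cases h : ∃ k, r ∈ S k
    · obtain ⟨k, hk⟩ := h
      exact (hΨ k).contDiffAt.congr_of_eventuallyEq (hev k r hk)
    · push Not at h
      exact contDiffAt_const.congr_of_eventuallyEq (hev0 r hr h)
  have hdc : ∀ j, ContinuousOn (fun r => fderiv ℝ ψ r (e j)) Ω := fun j =>
    (hcd.continuousOn_fderiv_of_isOpen hΩ le_rfl).clm_apply continuousOn_const
  have hbound : ∀ f : Plane → ℂ, ∀ F : κ → Plane → ℂ, (∀ k, Continuous (F k)) →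
      (∀ k, ∀ r ∈ S k, f r = F k r) → (∀ r ∈ Ω, (∀ k, r ∉ S k) → f r = 0) →
      ∃ C, ∀ r ∈ Ω, ‖f r‖ ≤ C := by
    intro f F hF h1 h2
    have hcomp : IsCompact (closure Ω) := hbdd.isCompact_closure
    choose C hC using fun k => hcomp.exists_bound_of_continuousOn (hF k).continuousOn
    refine ⟨∑ k, |C k|, fun r hr => ?_⟩
    by_cases h : ∃ k, r ∈ S k
    · obtain ⟨k, hk⟩ := h
      rw [h1 k r hk]
      exact ((hC k r (subset_closure hr)).trans (le_abs_self _)).trans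
        (Finset.single_le_sum (f := fun k => |C k|) (fun _ _ => abs_nonneg _) (Finset.mem_univ k))
    · push Not at h
      rw [h2 r hr h, norm_zero]
      exact Finset.sum_nonneg fun _ _ => abs_nonneg _
  have hmem : ∀ f : Plane → ℂ, ContinuousOn f Ω → (∃ C, ∀ r ∈ Ω, ‖f r‖ ≤ C) →
      MemLp f 2 (volume.restrict Ω) := by
    rintro f hf ⟨C, hC⟩
    exact MemLp.of_bound (hf.aestronglyMeasurable hΩ.measurableSet) C
      (ae_restrict_of_forall_mem hΩ.measurableSet hC)
  have hdA : ∀ (j : Fin 2) (r : Plane), fderiv ℝ vecPot r (e j) = vecPot (e j) := fun j r => by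
    have : fderiv ℝ vecPot r = vecPotCLM := vecPotCLM.fderiv
    rw [this]; rfl
  let c : Config Ω :=
    { ψ := ψ
      dψ := fun j r => fderiv ℝ ψ r (e j)
      A := vecPot
      dA := fun j _ => vecPot (e j)
      memLp_ψ := hmem _ hcd.continuousOn (hbound _ Ψ (fun k => (hΨ k).continuous) hψS
        fun r hr h => (hev0 r hr h).self_of_nhds)
      memLp_dψ := fun j => hmem _ (hdc j) (hbound _ (fun k r => fderiv ℝ (Ψ k) r (e j))
        (fun k => ((hΨ k).continuous_fderiv one_ne_zero).clm_apply continuous_const)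
        (fun k r hr => by rw [(hev k r hr).fderiv_eq])
        fun r hr h => by rw [(hev0 r hr h).fderiv_eq]; simp)
      weakDeriv_ψ := fun j => hasWeakDeriv_of_contDiffOn hΩ hcd (e j)
      memLp_A := fun K hK => by
        have := isFiniteMeasure_restrict.2 (hK.measure_lt_top (μ := volume)).ne
        obtain ⟨C, hC⟩ := hK.exists_bound_of_continuousOn vecPotCLM.continuous.continuousOn
        exact MemLp.of_bound vecPotCLM.continuous.aestronglyMeasurable C
          (ae_restrict_of_forall_mem hK.measurableSet hC)
      memLp_dA := fun j K hK => by
        have := isFiniteMeasure_restrict.2 (hK.measure_lt_top (μ := volume)).ne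
        exact memLp_const _
      weakDeriv_A := fun j => by
        have := hasWeakDeriv_of_contDiffOn isOpen_univ (vecPotCLM.contDiff (n := 1)).contDiffOn (e j)
        simp only [ContinuousLinearMap.fderiv] at this
        exact this
      memLp_curl := by
        have : (fun _ : Plane => vecPot (e 0) 1 - vecPot (e 1) 0 - 1) = fun _ => (0 : ℝ) := by
          funext r
          simp [vecPot, e]
          norm_num
        rw [this]
        exact MemLp.zero' }
  have hcurl : ∀ r, c.curl r - 1 = 0 := fun r => by
    simp [Config.curl, c, vecPot, e]
    norm_num
  have henergy : c.energy b ε = ∫ r in Ω, density b ε ψ r := by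
    simp only [Config.energy, hcurl]
    simp only [abs_zero, ne_eq, OfNat.ofNat_ne_zero, not_false_eq_true, zero_pow, integral_zero,
      mul_zero, add_zero]
    rfl
  refine (ciInf_le (bddBelow_range_energy hfin hb) c).trans ?_
  rw [henergy, setIntegral_eq_of_subset_of_forall_sdiff_eq_zero hΩ.measurableSet
    (iUnion_subset hSΩ) (f := density b ε ψ)]
  · rw [integral_iUnion_fintype (fun k => (hS k).measurableSet) hdisj]
    · refine Finset.sum_le_sum fun k _ => le_of_eq ?_
      exact setIntegral_congr_fun (hS k).measurableSet fun r hr => density_congr b ε (hev k r hr)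
    · intro k
      have : IntegrableOn (density b ε (Ψ k)) (S k) :=
        ((continuous_density b ε (hΨ k)).continuousOn.integrableOn_compact
          hbdd.isCompact_closure).mono_set ((hSΩ k).trans subset_closure)
      exact this.congr_fun (fun r hr => (density_congr b ε (hev k r hr)).symm) (hS k).measurableSet
  · rintro r ⟨hr, hrS⟩
    rw [mem_iUnion, not_exists] at hrS
    rw [density_congr b ε (hev0 r hr hrS), density_zero]

/-! ### Energy density in the frame of an arc -/

lemma contDiff_one_of_hasDerivAt {f f' : ℝ → ℝ} (h : ∀ x, HasDerivAt f (f' x) x)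
    (hf' : Continuous f') : ContDiff ℝ 1 f := by
  rw [contDiff_one_iff_deriv]
  refine ⟨fun x => (h x).differentiableAt, ?_⟩
  rwa [show deriv f = f' from funext fun x => (h x).deriv]

lemma hasDerivAt_of_contDiff {f : ℝ → ℝ} (h : ContDiff ℝ 1 f) (x : ℝ) :
    HasDerivAt f (deriv f x) x := (h.differentiable one_ne_zero x).hasDerivAt

namespace GraphArc

/-- The first frame coordinate as a linear form. -/
def LX (Γ : GraphArc) : Plane →L[ℝ] ℝ :=
  Γ.c • (EuclideanSpace.proj 0 : Plane →L[ℝ] ℝ) + Γ.s • (EuclideanSpace.proj 1 : Plane →L[ℝ] ℝ)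

/-- The second frame coordinate as a linear form. -/
def LY (Γ : GraphArc) : Plane →L[ℝ] ℝ :=
  (-Γ.s) • (EuclideanSpace.proj 0 : Plane →L[ℝ] ℝ) + Γ.c • (EuclideanSpace.proj 1 : Plane →L[ℝ] ℝ)

lemma hasFDerivAt_X (Γ : GraphArc) (r : Plane) : HasFDerivAt Γ.X Γ.LX r := Γ.LX.hasFDerivAt
lemma hasFDerivAt_Y (Γ : GraphArc) (r : Plane) : HasFDerivAt Γ.Y Γ.LY r := Γ.LY.hasFDerivAt
lemma contDiff_X (Γ : GraphArc) : ContDiff ℝ 1 Γ.X := Γ.LX.contDiff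
lemma contDiff_Y (Γ : GraphArc) : ContDiff ℝ 1 Γ.Y := Γ.LY.contDiff

lemma hasFDerivAt_comp_X (Γ : GraphArc) {f : ℝ → ℝ} {f' : ℝ} {r : Plane}
    (h : HasDerivAt f f' (Γ.X r)) : HasFDerivAt (fun r => f (Γ.X r)) (f' • Γ.LX) r :=
  h.comp_hasFDerivAt r (Γ.hasFDerivAt_X r)

@[simp] lemma LX_e_zero (Γ : GraphArc) : Γ.LX (e 0) = Γ.c := by simp [LX, e]
@[simp] lemma LX_e_one (Γ : GraphArc) : Γ.LX (e 1) = Γ.s := by simp [LX, e]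
@[simp] lemma LY_e_zero (Γ : GraphArc) : Γ.LY (e 0) = -Γ.s := by simp [LY, e]
@[simp] lemma LY_e_one (Γ : GraphArc) : Γ.LY (e 1) = Γ.c := by simp [LY, e]

/-- The energy density of an order parameter in polar form, in the frame of an arc. -/
lemma density_polar (Γ : GraphArc) (b ε : ℝ) {a θ : Plane → ℝ} {r : Plane} {P Q θx θy : ℝ}
    (ha : HasFDerivAt a (P • Γ.LX + Q • Γ.LY) r) (hθ : HasFDerivAt θ (θx • Γ.LX + θy • Γ.LY) r) :
    density b ε (fun r => (a r : ℂ) * Complex.exp ((θ r : ℂ) * Complex.I)) r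
      = P ^ 2 + Q ^ 2 + a r ^ 2 * ((θx - Γ.Y r / (2 * ε ^ 2)) ^ 2 + (θy + Γ.X r / (2 * ε ^ 2)) ^ 2)
        - 1 / (2 * b * ε ^ 2) * (2 * a r ^ 2 - a r ^ 4) := by
  have ha' := Complex.ofRealCLM.hasFDerivAt.comp r ha
  have hθ' := ((Complex.ofRealCLM.hasFDerivAt.comp r hθ).mul_const Complex.I).cexp
  have hd : ∀ v : Plane, fderiv ℝ (fun r => (a r : ℂ) * Complex.exp ((θ r : ℂ) * Complex.I)) r v
      = (((P * Γ.LX v + Q * Γ.LY v : ℝ) : ℂ)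
        + ((a r * (θx * Γ.LX v + θy * Γ.LY v) : ℝ) : ℂ) * Complex.I)
          * Complex.exp ((θ r : ℂ) * Complex.I) := by
    intro v
    have h : HasFDerivAt (fun r => (a r : ℂ) * Complex.exp ((θ r : ℂ) * Complex.I)) _ r :=
      ha'.mul hθ'
    rw [h.fderiv]
    simp
    ring
  have hnorm : ‖Complex.exp ((θ r : ℂ) * Complex.I)‖ = 1 := Complex.norm_exp_ofReal_mul_I _
  have hj : ∀ v : Plane, ∀ y : ℝ,
      ‖fderiv ℝ (fun r => (a r : ℂ) * Complex.exp ((θ r : ℂ) * Complex.I)) r v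
        + Complex.I * (y : ℂ) * ((a r : ℂ) * Complex.exp ((θ r : ℂ) * Complex.I))‖ ^ 2
      = (P * Γ.LX v + Q * Γ.LY v) ^ 2 + (a r * (θx * Γ.LX v + θy * Γ.LY v + y)) ^ 2 := by
    intro v y
    rw [hd]
    have : (((P * Γ.LX v + Q * Γ.LY v : ℝ) : ℂ)
        + ((a r * (θx * Γ.LX v + θy * Γ.LY v) : ℝ) : ℂ) * Complex.I)
          * Complex.exp ((θ r : ℂ) * Complex.I)
        + Complex.I * (y : ℂ) * ((a r : ℂ) * Complex.exp ((θ r : ℂ) * Complex.I))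
        = (((P * Γ.LX v + Q * Γ.LY v : ℝ) : ℂ)
          + ((a r * (θx * Γ.LX v + θy * Γ.LY v + y) : ℝ) : ℂ) * Complex.I)
          * Complex.exp ((θ r : ℂ) * Complex.I) := by
      push_cast; ring
    rw [this, norm_mul, hnorm, mul_one, ← Complex.normSq_eq_norm_sq, Complex.normSq_add_mul_I]
  have hna : ‖(a r : ℂ) * Complex.exp ((θ r : ℂ) * Complex.I)‖ ^ 2 = a r ^ 2 := by
    rw [norm_mul, hnorm, mul_one, Complex.norm_real, Real.norm_eq_abs, sq_abs]
  have hna4 : ‖(a r : ℂ) * Complex.exp ((θ r : ℂ) * Complex.I)‖ ^ 4 = a r ^ 4 := by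
    rw [show (4 : ℕ) = 2 * 2 from rfl, pow_mul, hna, ← pow_mul]
  simp only [density]
  rw [hna, hna4, Fin.sum_univ_two, hj, hj]
  have h1 := Γ.unit
  simp only [LX_e_zero, LX_e_one, LY_e_zero, LY_e_one, vecPot, framePt_zero, framePt_one]
  have h0 : (0 * r 0 - 1 / 2 * r 1) / ε ^ 2
      = -Γ.c * (Γ.Y r / (2 * ε ^ 2)) - Γ.s * (Γ.X r / (2 * ε ^ 2)) := by
    simp only [X, Y]
    linear_combination (r 1 / (2 * ε ^ 2)) * h1
  have h0' : (1 / 2 * r 0 + 0 * r 1) / ε ^ 2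
      = -Γ.s * (Γ.Y r / (2 * ε ^ 2)) + Γ.c * (Γ.X r / (2 * ε ^ 2)) := by
    simp only [X, Y]
    linear_combination (-r 0 / (2 * ε ^ 2)) * h1
  rw [h0, h0']
  generalize Γ.Y r / (2 * ε ^ 2) = y
  generalize Γ.X r / (2 * ε ^ 2) = x
  linear_combination (P ^ 2 + Q ^ 2 + a r ^ 2 * ((θx - y) ^ 2 + (θy + x) ^ 2)) * h1

/-- The coefficient `g' / w ^ 2`. -/
def p (Γ : GraphArc) (x : ℝ) : ℝ := deriv Γ.g x * (Γ.w x)⁻¹ ^ 2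

/-- The slope `g' / w` of the arc with respect to arclength. -/
def q (Γ : GraphArc) (x : ℝ) : ℝ := deriv Γ.g x * (Γ.w x)⁻¹

/-- The inverse speed. -/
def winv (Γ : GraphArc) (x : ℝ) : ℝ := (Γ.w x)⁻¹

lemma contDiff_winv (Γ : GraphArc) : ContDiff ℝ 1 Γ.winv :=
  Γ.contDiff_w.inv fun x => (Γ.w_pos x).ne'

lemma contDiff_p (Γ : GraphArc) : ContDiff ℝ 1 Γ.p :=
  Γ.contDiff_deriv_g.mul (Γ.contDiff_winv.pow 2)

lemma contDiff_q (Γ : GraphArc) : ContDiff ℝ 1 Γ.q :=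
  Γ.contDiff_deriv_g.mul Γ.contDiff_winv

/-- The rescaled height `(Y - g(X)) / (ε w)` above the arc; to leading order it is the distance to
the boundary in units of `ε`. -/
def ht (Γ : GraphArc) (ε : ℝ) (r : Plane) : ℝ := (Γ.Y r - Γ.g (Γ.X r)) * Γ.winv (Γ.X r) / ε

/-- The phase of the trial state. It gauges the symmetric potential into the potential
`-(t + α) / ε` along the boundary, up to errors of order one. -/
def phase (Γ : GraphArc) (ε α : ℝ) (r : Plane) : ℝ :=
  1 / ε ^ 2 * (-(Γ.X r * Γ.Y r) / 2 + (∫ y in (0 : ℝ)..Γ.X r, Γ.g y)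
      - Γ.p (Γ.X r) * (Γ.Y r - Γ.g (Γ.X r)) ^ 2 / 2)
    - α / ε * (Γ.arclen (Γ.X r) + Γ.q (Γ.X r) * (Γ.Y r - Γ.g (Γ.X r)))

/-- The derivative of the rescaled height in the first frame coordinate. -/
def htx (Γ : GraphArc) (ε : ℝ) (r : Plane) : ℝ :=
  -Γ.q (Γ.X r) / ε + Γ.w (Γ.X r) * deriv Γ.winv (Γ.X r) * Γ.ht ε r

lemma contDiff_height (Γ : GraphArc) : ContDiff ℝ 1 fun r => Γ.Y r - Γ.g (Γ.X r) :=
  Γ.contDiff_Y.sub ((Γ.contDiff_g.of_le one_le_two).comp Γ.contDiff_X)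

lemma contDiff_ht (Γ : GraphArc) (ε : ℝ) : ContDiff ℝ 1 (Γ.ht ε) :=
  (Γ.contDiff_height.mul (Γ.contDiff_winv.comp Γ.contDiff_X)).div_const ε

lemma hasDerivAt_primitive_g (Γ : GraphArc) (x : ℝ) :
    HasDerivAt (fun x => ∫ y in (0 : ℝ)..x, Γ.g y) (Γ.g x) x :=
  intervalIntegral.integral_hasDerivAt_right (Γ.contDiff_g.continuous.intervalIntegrable _ _)
    (Γ.contDiff_g.continuous.stronglyMeasurableAtFilter _ _) Γ.contDiff_g.continuous.continuousAt

lemma contDiff_phase (Γ : GraphArc) (ε α : ℝ) : ContDiff ℝ 1 (Γ.phase ε α) := by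
  have h1 := Γ.contDiff_X
  have h2 := Γ.contDiff_Y
  have h3 := Γ.contDiff_height
  have h4 : ContDiff ℝ 1 fun r => ∫ y in (0 : ℝ)..Γ.X r, Γ.g y :=
    (contDiff_one_of_hasDerivAt Γ.hasDerivAt_primitive_g Γ.contDiff_g.continuous).comp h1
  have h5 : ContDiff ℝ 1 fun r => Γ.arclen (Γ.X r) :=
    (contDiff_one_of_hasDerivAt Γ.hasDerivAt_arclen Γ.contDiff_w.continuous).comp h1
  have h6 : ContDiff ℝ 1 fun r => Γ.p (Γ.X r) := Γ.contDiff_p.comp h1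
  have h7 : ContDiff ℝ 1 fun r => Γ.q (Γ.X r) := Γ.contDiff_q.comp h1
  exact (contDiff_const.mul ((((h1.mul h2).neg.div_const 2).add h4).sub
    ((h6.mul (h3.pow 2)).div_const 2))).sub (contDiff_const.mul (h5.add (h7.mul h3)))

lemma hasFDerivAt_height (Γ : GraphArc) (r : Plane) :
    HasFDerivAt (fun r => Γ.Y r - Γ.g (Γ.X r)) (Γ.LY - deriv Γ.g (Γ.X r) • Γ.LX) r :=
  (Γ.hasFDerivAt_Y r).sub (Γ.hasFDerivAt_comp_X (Γ.hasDerivAt_g _))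

lemma height_eq (Γ : GraphArc) {ε : ℝ} (hε : ε ≠ 0) (r : Plane) :
    Γ.Y r - Γ.g (Γ.X r) = ε * Γ.w (Γ.X r) * Γ.ht ε r := by
  have := (Γ.w_pos (Γ.X r)).ne'
  simp only [ht, winv]
  field_simp

lemma hasFDerivAt_ht (Γ : GraphArc) {ε : ℝ} (hε : ε ≠ 0) (r : Plane) :
    HasFDerivAt (Γ.ht ε) (Γ.htx ε r • Γ.LX + (Γ.winv (Γ.X r) / ε) • Γ.LY) r := by
  have h := ((Γ.hasFDerivAt_height r).mul (Γ.hasFDerivAt_comp_X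
    (hasDerivAt_of_contDiff Γ.contDiff_winv (Γ.X r)))).mul_const (1 / ε)
  have hfun : Γ.ht ε = fun r => (Γ.Y r - Γ.g (Γ.X r)) * Γ.winv (Γ.X r) * (1 / ε) := by
    funext r; simp only [ht]; ring
  rw [hfun]
  refine h.congr_fderiv ?_
  ext v
  simp only [htx, height_eq Γ hε r, q]
  simp [winv]
  field_simp
  ring

lemma hasFDerivAt_amplitude (Γ : GraphArc) {ε : ℝ} (hε : ε ≠ 0) {χ u : ℝ → ℝ}
    (hχ : ContDiff ℝ 1 χ) (hu : ContDiff ℝ 1 u) (r : Plane) :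
    HasFDerivAt (fun r => χ (Γ.X r) * u (Γ.ht ε r))
      ((deriv χ (Γ.X r) * u (Γ.ht ε r) + χ (Γ.X r) * deriv u (Γ.ht ε r) * Γ.htx ε r) • Γ.LX
        + (χ (Γ.X r) * deriv u (Γ.ht ε r) * (Γ.winv (Γ.X r) / ε)) • Γ.LY) r := by
  have h := (Γ.hasFDerivAt_comp_X (hasDerivAt_of_contDiff hχ (Γ.X r))).mul
    ((hasDerivAt_of_contDiff hu (Γ.ht ε r)).comp_hasFDerivAt r (Γ.hasFDerivAt_ht hε r))
  refine h.congr_fderiv ?_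
  ext v
  simp
  ring

lemma hasFDerivAt_phase (Γ : GraphArc) {ε : ℝ} (hε : ε ≠ 0) (α : ℝ) (r : Plane) :
    HasFDerivAt (Γ.phase ε α)
      ((Γ.Y r / (2 * ε ^ 2) - (Γ.ht ε r + α) * Γ.winv (Γ.X r) / ε
          - (deriv Γ.p (Γ.X r) * (Γ.w (Γ.X r) * Γ.ht ε r) ^ 2 / 2
            + α * deriv Γ.q (Γ.X r) * (Γ.w (Γ.X r) * Γ.ht ε r))) • Γ.LX
        + (-Γ.X r / (2 * ε ^ 2) - (Γ.ht ε r + α) * Γ.q (Γ.X r) / ε) • Γ.LY) r := by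
  have h3 := Γ.hasFDerivAt_height r
  have h4 := Γ.hasFDerivAt_comp_X (Γ.hasDerivAt_primitive_g (Γ.X r))
  have h5 := Γ.hasFDerivAt_comp_X (Γ.hasDerivAt_arclen (Γ.X r))
  have h6 := Γ.hasFDerivAt_comp_X (hasDerivAt_of_contDiff Γ.contDiff_p (Γ.X r))
  have h7 := Γ.hasFDerivAt_comp_X (hasDerivAt_of_contDiff Γ.contDiff_q (Γ.X r))
  have h := ((((((Γ.hasFDerivAt_X r).mul (Γ.hasFDerivAt_Y r)).const_mul (-(1 / 2))).add h4).sub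
    ((h6.mul (h3.pow 2)).const_mul (1 / 2))).const_mul (1 / ε ^ 2)).sub
    ((h5.add (h7.mul h3)).const_mul (α / ε))
  have hfun : Γ.phase ε α = fun r => 1 / ε ^ 2 * (-(1 / 2) * (Γ.X r * Γ.Y r)
      + (∫ y in (0 : ℝ)..Γ.X r, Γ.g y)
      - 1 / 2 * (Γ.p (Γ.X r) * (Γ.Y r - Γ.g (Γ.X r)) ^ 2))
    - α / ε * (Γ.arclen (Γ.X r) + Γ.q (Γ.X r) * (Γ.Y r - Γ.g (Γ.X r))) := by
    funext r; simp only [phase]; ring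
  rw [hfun]
  refine h.congr_fderiv ?_
  have hw := Γ.w_pos (Γ.X r)
  have hw2 := Γ.w_sq (Γ.X r)
  have hY : Γ.Y r = Γ.g (Γ.X r) + ε * Γ.w (Γ.X r) * Γ.ht ε r := by
    rw [← height_eq Γ hε r]; ring
  have hg2 : deriv Γ.g (Γ.X r) ^ 2 = Γ.w (Γ.X r) ^ 2 - 1 := by linarith
  ext v
  simp [height_eq Γ hε r]
  rw [hY]
  simp only [p, q, winv]
  generalize deriv (Γ.p) (Γ.X r) = p'
  generalize deriv (Γ.q) (Γ.X r) = q'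
  generalize deriv Γ.g (Γ.X r) = g' at *
  generalize Γ.w (Γ.X r) = w at *
  generalize Γ.ht ε r = t at *
  field_simp
  linear_combination (2 * ε * (t + α) * Γ.LX v) * hg2

end GraphArc

/-! ### Pointwise comparison with the one-dimensional energy -/

/-- The density of the one-dimensional energy at `t`, in terms of the values `u`, `v` of the profile
and of its derivative. -/
def profileDensity (b α t u v : ℝ) : ℝ :=
  v ^ 2 + (t + α) ^ 2 * u ^ 2 - 1 / (2 * b) * (2 * u ^ 2 - u ^ 4)

set_option maxHeartbeats 800000 in
/-- The energy density of the trial state is, up to relative errors of order `ε`, that of its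
profile. The variables stand for the values at one point: `x`, `x'` of the tangential cut-off and of
its derivative, `u`, `v` of the profile and of its derivative. -/
lemma trial_density_bound {b ε α M c₁ c₂ c₃ R t x x' u v s q k ζ : ℝ} (hb : 0 < b) (hε : 0 < ε)
    (hR : 1 ≤ R) (hεR : ε * R ≤ 1) (ht : 0 ≤ t) (hs : s ^ 2 + q ^ 2 = 1) (hc₁ : |k| ≤ c₁)
    (hc₂ : |ζ| ≤ c₂ * (1 + t) ^ 2) (hα : |α| ≤ M) (hx : 0 ≤ x) (hx1 : x ≤ 1)
    (hc₃0 : 0 ≤ c₃) (hc₃ : x' ^ 2 ≤ c₃ / ε * |x'|) (hu : R ≤ t → u = 0 ∧ v = 0) :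
    (x' * u + x * v * (-q / ε + k * t)) ^ 2 + (x * v * (s / ε)) ^ 2
      + (x * u) ^ 2 * (((t + α) * s / ε + ζ) ^ 2 + ((t + α) * q / ε) ^ 2)
      - 1 / (2 * b * ε ^ 2) * (2 * (x * u) ^ 2 - (x * u) ^ 4)
    ≤ 1 / ε ^ 2 * x ^ 2 * profileDensity b α t u v
      + (1 + 2 * c₁ + 2 * c₁ ^ 2 + 2 * c₃ + 2 * (1 + M) * c₂ + c₂ ^ 2) / ε * (1 + |x'|)
        * ((1 + t) ^ 4 * u ^ 2 + R * v ^ 2) := by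
  rcases le_or_gt R t with h | htR
  · obtain ⟨rfl, rfl⟩ := hu h
    simp [profileDensity]
  have hc₁0 : 0 ≤ c₁ := (abs_nonneg _).trans hc₁
  have hM0 : 0 ≤ M := (abs_nonneg _).trans hα
  have hε1 : ε ≤ 1 := (le_mul_of_one_le_right hε.le hR).trans hεR
  have hc₂0 : 0 ≤ c₂ := by
    have h := (abs_nonneg _).trans hc₂
    exact nonneg_of_mul_nonneg_left h (by positivity)
  have hq : |q| ≤ 1 := abs_le_one_iff_mul_self_le_one.2 (by nlinarith [sq_nonneg s])
  have hsa : |s| ≤ 1 := abs_le_one_iff_mul_self_le_one.2 (by nlinarith [sq_nonneg q])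
  have hinv : 1 ≤ 1 / ε := by rw [le_div_iff₀ hε]; linarith
  set z := x' * u + x * v * (k * t) with hz
  -- the tangential error term
  have hkt : |k * t| ≤ c₁ * R := by
    rw [abs_mul, abs_of_nonneg ht]; gcongr
  have hza : |z| ≤ |x'| * |u| + |v| * (c₁ * R) := by
    refine (abs_add_le _ _).trans ?_
    rw [abs_mul, abs_mul, abs_mul, abs_of_nonneg hx]
    have : x * |v| ≤ |v| := mul_le_of_le_one_left (abs_nonneg _) hx1
    gcongr
  have b1 : 2 * z * (x * v) * (-q / ε) ≤ 1 / ε * (|x'| * (u ^ 2 + v ^ 2) + 2 * c₁ * R * v ^ 2) := by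
    have h1 : z * (x * v) * (-q) ≤ |z| * |v| := by
      refine (le_abs_self _).trans ?_
      rw [abs_mul, abs_mul, abs_mul, abs_neg, abs_of_nonneg hx]
      have : x * |v| ≤ |v| := mul_le_of_le_one_left (abs_nonneg _) hx1
      calc |z| * (x * |v|) * |q| ≤ |z| * |v| * 1 := by gcongr
        _ = _ := mul_one _
    have h2 : |z| * |v| ≤ (|x'| * |u| + |v| * (c₁ * R)) * |v| := by gcongr
    have h3 : 2 * (|u| * |v|) ≤ u ^ 2 + v ^ 2 := by
      have := two_mul_le_add_sq |u| |v|
      rw [sq_abs, sq_abs] at this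
      linarith
    have h4 : |x'| * (2 * (|u| * |v|)) ≤ |x'| * (u ^ 2 + v ^ 2) := by gcongr
    have h5 : |v| * |v| = v ^ 2 := abs_mul_abs_self v ▸ (sq v).symm
    have : 2 * z * (x * v) * (-q / ε) = 1 / ε * (2 * (z * (x * v) * (-q))) := by ring
    rw [this]
    gcongr
    have : (|x'| * |u| + |v| * (c₁ * R)) * |v| = |x'| * (|u| * |v|) + c₁ * R * (|v| * |v|) := by ring
    rw [h5] at this
    linarith
  have b2 : z ^ 2 ≤ 1 / ε * (2 * c₃ * |x'| * u ^ 2 + 2 * c₁ ^ 2 * R * v ^ 2) := by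
    have h1 : z ^ 2 ≤ 2 * (x' ^ 2 * u ^ 2) + 2 * ((c₁ * R) ^ 2 * v ^ 2) := by
      have h2 : z ^ 2 ≤ (|x'| * |u| + |v| * (c₁ * R)) ^ 2 :=
        sq_le_sq.2 (hza.trans (le_abs_self _))
      have h4 : (|x'| * |u|) ^ 2 = x' ^ 2 * u ^ 2 := by rw [mul_pow, sq_abs, sq_abs]
      have h5 : (|v| * (c₁ * R)) ^ 2 = (c₁ * R) ^ 2 * v ^ 2 := by rw [mul_pow, sq_abs]; ring
      rw [← h4, ← h5]
      exact h2.trans (add_sq_le.trans (le_of_eq (mul_add _ _ _)))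
    have h2 : x' ^ 2 * u ^ 2 ≤ c₃ / ε * |x'| * u ^ 2 := by gcongr
    have h3 : R ^ 2 ≤ 1 / ε * R := by
      rw [div_mul_eq_mul_div, one_mul, le_div_iff₀ hε]
      calc R ^ 2 * ε = R * (ε * R) := by ring
        _ ≤ R * 1 := by gcongr
        _ = R := mul_one R
    have h4 : (c₁ * R) ^ 2 * v ^ 2 ≤ c₁ ^ 2 * (1 / ε * R) * v ^ 2 := by
      rw [mul_pow]; gcongr
    have : 1 / ε * (2 * c₃ * |x'| * u ^ 2 + 2 * c₁ ^ 2 * R * v ^ 2)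
      = 2 * (c₃ / ε * |x'| * u ^ 2) + 2 * (c₁ ^ 2 * (1 / ε * R) * v ^ 2) := by ring
    linarith
  -- the error terms in the potential
  have hxu : (x * u) ^ 2 ≤ u ^ 2 := by
    rw [mul_pow]
    exact mul_le_of_le_one_left (sq_nonneg _) (pow_le_one₀ hx hx1)
  have hta : |t + α| ≤ (1 + M) * (1 + t) := by
    refine (abs_add_le _ _).trans ?_
    rw [abs_of_nonneg ht]
    linarith [mul_nonneg hM0 ht]
  have ht34 : (1 + t) ^ 3 ≤ (1 + t) ^ 4 := pow_le_pow_right₀ (by linarith) (by norm_num)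
  have b3 : (x * u) ^ 2 * (2 * ((t + α) * s / ε) * ζ)
      ≤ 1 / ε * (2 * (1 + M) * c₂ * ((1 + t) ^ 4 * u ^ 2)) := by
    have h1 : (t + α) * s * ζ ≤ (1 + M) * c₂ * (1 + t) ^ 4 := by
      refine (le_abs_self _).trans ?_
      rw [abs_mul, abs_mul]
      calc |t + α| * |s| * |ζ| ≤ ((1 + M) * (1 + t)) * 1 * (c₂ * (1 + t) ^ 2) := by gcongr
        _ = (1 + M) * c₂ * (1 + t) ^ 3 := by ring
        _ ≤ _ := by gcongr
    have h2 : (x * u) ^ 2 * ((t + α) * s * ζ) ≤ u ^ 2 * ((1 + M) * c₂ * (1 + t) ^ 4) :=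
      (mul_le_mul_of_nonneg_left h1 (sq_nonneg _)).trans
        (mul_le_mul_of_nonneg_right hxu (by positivity))
    have : (x * u) ^ 2 * (2 * ((t + α) * s / ε) * ζ)
      = 1 / ε * (2 * ((x * u) ^ 2 * ((t + α) * s * ζ))) := by ring
    rw [this]
    refine mul_le_mul_of_nonneg_left ?_ (by positivity)
    linarith
  have b4 : (x * u) ^ 2 * ζ ^ 2 ≤ 1 / ε * (c₂ ^ 2 * ((1 + t) ^ 4 * u ^ 2)) := by
    have h1 : ζ ^ 2 ≤ (c₂ * (1 + t) ^ 2) ^ 2 := sq_le_sq.2 (hc₂.trans (le_abs_self _))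
    have h2 : (x * u) ^ 2 * ζ ^ 2 ≤ u ^ 2 * (c₂ * (1 + t) ^ 2) ^ 2 := by gcongr
    have h3 : u ^ 2 * (c₂ * (1 + t) ^ 2) ^ 2 = 1 * (c₂ ^ 2 * ((1 + t) ^ 4 * u ^ 2)) := by ring
    rw [h3] at h2
    exact h2.trans (by gcongr)
  have b5 : (x * u) ^ 4 ≤ x ^ 2 * u ^ 4 := by
    rw [mul_pow]
    have : x ^ 4 ≤ x ^ 2 := pow_le_pow_of_le_one hx hx1 (by norm_num)
    gcongr
  have b6 : 1 / (2 * b * ε ^ 2) * (x * u) ^ 4 ≤ 1 / (2 * b * ε ^ 2) * (x ^ 2 * u ^ 4) := by gcongr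
  have hid : (x' * u + x * v * (-q / ε + k * t)) ^ 2 + (x * v * (s / ε)) ^ 2
      + (x * u) ^ 2 * (((t + α) * s / ε + ζ) ^ 2 + ((t + α) * q / ε) ^ 2)
      - 1 / (2 * b * ε ^ 2) * (2 * (x * u) ^ 2 - (x * u) ^ 4)
      = 1 / ε ^ 2 * x ^ 2 * profileDensity b α t u v
        + (2 * z * (x * v) * (-q / ε) + z ^ 2 + (x * u) ^ 2 * (2 * ((t + α) * s / ε) * ζ)
          + (x * u) ^ 2 * ζ ^ 2)
        + (1 / (2 * b * ε ^ 2) * (x * u) ^ 4 - 1 / (2 * b * ε ^ 2) * (x ^ 2 * u ^ 4)) := by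
    rw [hz]
    simp only [profileDensity]
    have : 1 / (2 * b * ε ^ 2) = 1 / (2 * b) * (1 / ε ^ 2) := by rw [one_div_mul_one_div]
    rw [this]
    linear_combination
      (1 / ε ^ 2 * x ^ 2 * v ^ 2 + (x * u) ^ 2 * ((t + α) ^ 2 / ε ^ 2)) * hs
  rw [hid]
  have hx'0 := abs_nonneg x'
  set A := (1 + t) ^ 4 * u ^ 2 with hA
  set B := R * v ^ 2 with hB
  have hA0 : 0 ≤ A := by positivity
  have hB0 : 0 ≤ B := by positivity
  have huA : u ^ 2 ≤ A := le_mul_of_one_le_left (sq_nonneg _) (one_le_pow₀ (by linarith))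
  have hvB : v ^ 2 ≤ B := le_mul_of_one_le_left (sq_nonneg _) hR
  have hle : A + B ≤ (1 + |x'|) * (A + B) :=
    le_mul_of_one_le_left (by positivity) (by linarith)
  have hAAB : A ≤ (1 + |x'|) * (A + B) := by linarith
  have hBAB : B ≤ (1 + |x'|) * (A + B) := by linarith
  have d1 : |x'| * (u ^ 2 + v ^ 2) ≤ (1 + |x'|) * (A + B) := by gcongr; linarith
  have d2 : 2 * c₁ * R * v ^ 2 ≤ 2 * c₁ * ((1 + |x'|) * (A + B)) := by
    rw [mul_assoc]
    exact mul_le_mul_of_nonneg_left hBAB (by positivity)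
  have d3 : 2 * c₃ * |x'| * u ^ 2 ≤ 2 * c₃ * ((1 + |x'|) * (A + B)) := by
    rw [mul_assoc]
    gcongr <;> linarith
  have d4 : 2 * c₁ ^ 2 * R * v ^ 2 ≤ 2 * c₁ ^ 2 * ((1 + |x'|) * (A + B)) := by
    rw [mul_assoc]
    exact mul_le_mul_of_nonneg_left hBAB (by positivity)
  have d5 : 2 * (1 + M) * c₂ * A ≤ 2 * (1 + M) * c₂ * ((1 + |x'|) * (A + B)) := by gcongr
  have d6 : c₂ ^ 2 * A ≤ c₂ ^ 2 * ((1 + |x'|) * (A + B)) := by gcongr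
  have hsum : 2 * z * (x * v) * (-q / ε) + z ^ 2 + (x * u) ^ 2 * (2 * ((t + α) * s / ε) * ζ)
          + (x * u) ^ 2 * ζ ^ 2
      ≤ 1 / ε * ((1 + 2 * c₁ + 2 * c₁ ^ 2 + 2 * c₃ + 2 * (1 + M) * c₂ + c₂ ^ 2)
        * ((1 + |x'|) * (A + B))) := by
    refine (add_le_add (add_le_add (add_le_add b1 b2) b3) b4).trans ?_
    rw [← mul_add, ← mul_add, ← mul_add]
    gcongr
    linarith
  have : (1 + 2 * c₁ + 2 * c₁ ^ 2 + 2 * c₃ + 2 * (1 + M) * c₂ + c₂ ^ 2) / ε * (1 + |x'|) * (A + B)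
      = 1 / ε * ((1 + 2 * c₁ + 2 * c₁ ^ 2 + 2 * c₃ + 2 * (1 + M) * c₂ + c₂ ^ 2)
        * ((1 + |x'|) * (A + B))) := by ring
  rw [this]
  linarith

/-! ### The trial state of an arc and tangential cut-offs -/

namespace GraphArc

/-- The trial state attached to a boundary arc: a profile `u` in the direction normal to the arc, cut
off tangentially by `χ`, with the phase adapted to the magnetic field. -/
def trial (Γ : GraphArc) (ε α : ℝ) (χ u : ℝ → ℝ) (r : Plane) : ℂ :=
  ((χ (Γ.X r) * u (Γ.ht ε r) : ℝ) : ℂ) * Complex.exp ((Γ.phase ε α r : ℂ) * Complex.I)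

lemma contDiff_trial (Γ : GraphArc) (ε α : ℝ) {χ u : ℝ → ℝ} (hχ : ContDiff ℝ 1 χ)
    (hu : ContDiff ℝ 1 u) : ContDiff ℝ 1 (Γ.trial ε α χ u) := by
  have h1 : ContDiff ℝ 1 fun r => χ (Γ.X r) * u (Γ.ht ε r) :=
    (hχ.comp Γ.contDiff_X).mul (hu.comp (Γ.contDiff_ht ε))
  exact (Complex.ofRealCLM.contDiff.comp h1).mul
    (((Complex.ofRealCLM.contDiff.comp (Γ.contDiff_phase ε α)).mul contDiff_const).cexp)

/-- Upper bound for the energy density of the trial state over the base interval of the arc. -/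
lemma exists_density_trial_le (Γ : GraphArc) {b M c₃ : ℝ} (hb : 0 < b) (hM : 0 ≤ M)
    (hc₃ : 0 ≤ c₃) :
    ∃ C, 0 ≤ C ∧ ∀ (ε α R : ℝ) (χ u : ℝ → ℝ), 0 < ε → 1 ≤ R → ε * R ≤ 1 → |α| ≤ M →
      ContDiff ℝ 1 χ → ContDiff ℝ 1 u → (∀ x, 0 ≤ χ x) → (∀ x, χ x ≤ 1) →
      (∀ x, |deriv χ x| ≤ c₃ / ε) → (∀ t, R ≤ t → u t = 0) →
      ∀ r, Γ.X r ∈ Icc Γ.a Γ.b → 0 ≤ Γ.ht ε r →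
        density b ε (Γ.trial ε α χ u) r ≤
          1 / ε ^ 2 * χ (Γ.X r) ^ 2
            * profileDensity b α (Γ.ht ε r) (u (Γ.ht ε r)) (deriv u (Γ.ht ε r))
          + C / ε * (1 + |deriv χ (Γ.X r)|) * ((1 + Γ.ht ε r) ^ 4 * u (Γ.ht ε r) ^ 2
            + R * deriv u (Γ.ht ε r) ^ 2) := by
  have hw := Γ.contDiff_w.continuous
  have hwi := Γ.contDiff_winv.continuous_deriv le_rfl
  have hp := Γ.contDiff_p.continuous_deriv le_rfl
  have hq := Γ.contDiff_q.continuous_deriv le_rfl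
  obtain ⟨c₁, hc₁⟩ := isCompact_Icc.exists_bound_of_continuousOn (s := Icc Γ.a Γ.b)
    (f := fun x => Γ.w x * deriv Γ.winv x) (by fun_prop)
  obtain ⟨c₂, hc₂⟩ := isCompact_Icc.exists_bound_of_continuousOn (s := Icc Γ.a Γ.b)
    (f := fun x => deriv Γ.p x * Γ.w x ^ 2 / 2) (by fun_prop)
  obtain ⟨c₄, hc₄⟩ := isCompact_Icc.exists_bound_of_continuousOn (s := Icc Γ.a Γ.b)
    (f := fun x => deriv Γ.q x * Γ.w x) (by fun_prop)
  have hc₁0 : 0 ≤ c₁ := (norm_nonneg _).trans (hc₁ Γ.a (left_mem_Icc.2 Γ.lt.le))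
  have hc₂0 : 0 ≤ c₂ := (norm_nonneg _).trans (hc₂ Γ.a (left_mem_Icc.2 Γ.lt.le))
  have hc₄0 : 0 ≤ c₄ := (norm_nonneg _).trans (hc₄ Γ.a (left_mem_Icc.2 Γ.lt.le))
  refine ⟨1 + 2 * c₁ + 2 * c₁ ^ 2 + 2 * c₃ + 2 * (1 + M) * (c₂ + M * c₄) + (c₂ + M * c₄) ^ 2,
    by positivity, ?_⟩
  intro ε α R χ u hε hR hεR hα hχ hu hχ0 hχ1 hχ' hu0 r hr ht
  have hws := Γ.w_pos (Γ.X r)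
  have hpol := Γ.density_polar b ε (Γ.hasFDerivAt_amplitude hε.ne' hχ hu r)
    (Γ.hasFDerivAt_phase hε.ne' α r)
  have key := trial_density_bound (b := b) (ε := ε) (α := α) (M := M) (c₁ := c₁)
    (c₂ := c₂ + M * c₄) (c₃ := c₃) (R := R) (t := Γ.ht ε r) (x := χ (Γ.X r))
    (x' := deriv χ (Γ.X r)) (u := u (Γ.ht ε r)) (v := deriv u (Γ.ht ε r)) (s := Γ.winv (Γ.X r))
    (q := Γ.q (Γ.X r)) (k := Γ.w (Γ.X r) * deriv Γ.winv (Γ.X r))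
    (ζ := deriv Γ.p (Γ.X r) * (Γ.w (Γ.X r) * Γ.ht ε r) ^ 2 / 2
            + α * deriv Γ.q (Γ.X r) * (Γ.w (Γ.X r) * Γ.ht ε r))
    hb hε hR hεR ht ?_ (hc₁ _ hr) ?_ hα (hχ0 _) (hχ1 _) hc₃ ?_
    (fun h => ⟨hu0 _ h, deriv_eq_zero_of_eq_zero_Ici hu hu0 _ h⟩)
  · refine le_trans (le_of_eq ?_) key
    refine hpol.trans ?_
    simp only [htx]
    ring
  · simp only [winv, q]
    have := Γ.w_sq (Γ.X r)
    field_simp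
    linarith
  · have h1 := hc₂ _ hr
    have h2 := hc₄ _ hr
    rw [Real.norm_eq_abs] at h1 h2
    have e1 : deriv Γ.p (Γ.X r) * (Γ.w (Γ.X r) * Γ.ht ε r) ^ 2 / 2
            + α * deriv Γ.q (Γ.X r) * (Γ.w (Γ.X r) * Γ.ht ε r)
        = deriv Γ.p (Γ.X r) * Γ.w (Γ.X r) ^ 2 / 2 * Γ.ht ε r ^ 2
          + α * (deriv Γ.q (Γ.X r) * Γ.w (Γ.X r)) * Γ.ht ε r := by ring
    rw [e1]
    refine (abs_add_le _ _).trans ?_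
    rw [abs_mul, abs_mul, abs_mul, abs_of_nonneg (sq_nonneg (Γ.ht ε r)), abs_of_nonneg ht]
    have h3 : Γ.ht ε r ^ 2 ≤ (1 + Γ.ht ε r) ^ 2 := by gcongr; linarith
    have h4 : Γ.ht ε r ≤ (1 + Γ.ht ε r) ^ 2 := by nlinarith
    calc _ ≤ c₂ * (1 + Γ.ht ε r) ^ 2 + M * c₄ * (1 + Γ.ht ε r) ^ 2 := by gcongr
      _ = _ := by ring
  · rw [← sq_abs, sq]
    exact mul_le_mul_of_nonneg_right (hχ' _) (abs_nonneg _)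

end GraphArc

/-- Cut-off functions vanishing near the endpoints of an interval. -/
lemma exists_endpoint_cutoff : ∃ c : ℝ, 0 < c ∧ ∀ a b η : ℝ, 0 < η → ∃ χ : ℝ → ℝ,
    ContDiff ℝ 1 χ ∧ (∀ x, 0 ≤ χ x) ∧ (∀ x, χ x ≤ 1) ∧ (∀ x, χ x ≠ 0 → x ∈ Icc (a + η) (b - η)) ∧
    (∀ x ∈ Icc (a + 2 * η) (b - 2 * η), χ x = 1) ∧ (∀ x, |deriv χ x| ≤ c / η) ∧
    (∀ x ∈ Icc (a + 2 * η) (b - 2 * η), deriv χ x = 0) := by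
  obtain ⟨C, hC1, hC⟩ := exists_bound_deriv_smoothTransition
  refine ⟨2 * C, by linarith, fun a b η hη => ?_⟩
  have hd1 : ∀ x, HasDerivAt (fun x => Real.smoothTransition ((x - (a + η)) / η))
      (deriv Real.smoothTransition ((x - (a + η)) / η) * (1 / η)) x := fun x =>
    (hasDerivAt_smoothTransition _).comp x (((hasDerivAt_id x).sub_const _).div_const η)
  have hd2 : ∀ x, HasDerivAt (fun x => Real.smoothTransition ((b - η - x) / η))
      (deriv Real.smoothTransition ((b - η - x) / η) * (-1 / η)) x := fun x =>
    (hasDerivAt_smoothTransition _).comp x (((hasDerivAt_id x).const_sub (b - η)).div_const η)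
  have hd := fun x => (hd1 x).mul (hd2 x)
  have hs0 := Real.smoothTransition.nonneg
  have hs1 := Real.smoothTransition.le_one
  refine ⟨fun x => Real.smoothTransition ((x - (a + η)) / η)
      * Real.smoothTransition ((b - η - x) / η), ?_, fun x => mul_nonneg (hs0 _) (hs0 _),
      fun x => mul_le_one₀ (hs1 _) (hs0 _) (hs1 _), ?_, ?_, ?_, ?_⟩
  · have : ContDiff ℝ 1 Real.smoothTransition := Real.smoothTransition.contDiff
    exact (this.comp ((contDiff_id.sub contDiff_const).div_const η)).mul
      (this.comp ((contDiff_const.sub contDiff_id).div_const η))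
  · intro x hx
    constructor
    · by_contra h
      exact hx (by
        simp only
        rw [Real.smoothTransition.zero_of_nonpos, zero_mul]
        exact div_nonpos_of_nonpos_of_nonneg (by linarith) hη.le)
    · by_contra h
      exact hx (by
        simp only
        rw [Real.smoothTransition.zero_of_nonpos (x := (b - η - x) / η), mul_zero]
        exact div_nonpos_of_nonpos_of_nonneg (by linarith) hη.le)
  · intro x hx
    simp only
    rw [Real.smoothTransition.one_of_one_le, Real.smoothTransition.one_of_one_le, mul_one]
    · rw [le_div_iff₀ hη]; linarith [hx.2]
    · rw [le_div_iff₀ hη]; linarith [hx.1]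
  · intro x
    refine le_trans (le_of_eq (congrArg _ (hd x).deriv)) ?_
    refine (abs_add_le _ _).trans ?_
    rw [abs_mul, abs_mul, abs_mul, abs_mul, abs_of_nonneg (hs0 _), abs_of_nonneg (hs0 _), abs_div,
      abs_div, abs_neg, abs_one, abs_of_pos hη]
    have h1 := hC ((x - (a + η)) / η)
    have h2 := hC ((b - η - x) / η)
    calc _ ≤ C * (1 / η) * 1 + 1 * (C * (1 / η)) := by
          gcongr
          · exact hs0 _
          · exact hs1 _
          · exact hs1 _
      _ = _ := by ring
  · intro x hx
    refine (hd x).deriv.trans ?_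
    rw [deriv_smoothTransition_eq_zero (Or.inr _), deriv_smoothTransition_eq_zero (Or.inr _)]
    · simp
    · rw [le_div_iff₀ hη]; linarith [hx.2]
    · rw [le_div_iff₀ hη]; linarith [hx.1]

lemma integral_le_of_eq_zero_middle {f : ℝ → ℝ} (hf : Continuous f) {a b η c : ℝ} (hη : 0 ≤ η)
    (hab : 4 * η ≤ b - a) (hc : ∀ x ∈ Icc a b, |f x| ≤ c)
    (h0 : ∀ x ∈ Icc (a + 2 * η) (b - 2 * η), f x = 0) : ∫ x in a..b, f x ≤ 4 * η * c := by
  have hi : ∀ p q, IntervalIntegrable f volume p q := fun p q => hf.intervalIntegrable p q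
  rw [← intervalIntegral.integral_add_adjacent_intervals (hi a (a + 2 * η)) (hi _ b),
    ← intervalIntegral.integral_add_adjacent_intervals (hi (a + 2 * η) (b - 2 * η)) (hi _ b)]
  have h1 : ∫ x in (a + 2 * η)..(b - 2 * η), f x = 0 := by
    rw [intervalIntegral.integral_congr (g := fun _ => 0), intervalIntegral.integral_zero]
    intro x hx
    rw [uIcc_of_le (by linarith)] at hx
    exact h0 x hx
  have h2 := intervalIntegral.norm_integral_le_of_norm_le_const (f := f) (a := a) (b := a + 2 * η)
    (C := c) fun x hx => by
      rw [uIoc_of_le (by linarith)] at hx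
      exact hc x ⟨hx.1.le, by linarith [hx.2]⟩
  have h3 := intervalIntegral.norm_integral_le_of_norm_le_const (f := f) (a := b - 2 * η) (b := b)
    (C := c) fun x hx => by
      rw [uIoc_of_le (by linarith)] at hx
      exact hc x ⟨by linarith [hx.1], hx.2⟩
  have h4 := (le_abs_self _).trans h2
  have h5 := (le_abs_self _).trans h3
  rw [abs_of_nonneg (by linarith)] at h4 h5
  rw [h1]
  linarith

/-! ### Integration in boundary coordinates -/

namespace GraphArc

/-- The frame coordinates as an isometry of the plane. -/
def frameIsometry (Γ : GraphArc) : Plane ≃ₗᵢ[ℝ] Plane :=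
  LinearIsometry.toLinearIsometryEquiv
    { toFun := fun r => framePt 1 0 (Γ.X r) (Γ.Y r)
      map_add' := fun x y => by
        ext j; fin_cases j <;> simp [X, Y] <;> ring
      map_smul' := fun t x => by
        ext j; fin_cases j <;> simp [X, Y] <;> ring
      norm_map' := fun r => by
        have h : ‖framePt 1 0 (Γ.X r) (Γ.Y r)‖ ^ 2 = ‖r‖ ^ 2 := by
          rw [norm_sq_eq, norm_sq_eq]
          simp only [framePt_zero, framePt_one, X, Y]
          linear_combination (r 0 ^ 2 + r 1 ^ 2) * Γ.unit
        exact (pow_left_inj₀ (norm_nonneg _) (norm_nonneg _) two_ne_zero).1 h }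
    rfl

/-- The frame coordinates as a measurable equivalence with `ℝ × ℝ`. -/
def frameEquiv (Γ : GraphArc) : Plane ≃ᵐ ℝ × ℝ :=
  (Γ.frameIsometry.toHomeomorph.toMeasurableEquiv.trans
    (MeasurableEquiv.toLp 2 (Fin 2 → ℝ)).symm).trans MeasurableEquiv.finTwoArrow

lemma frameEquiv_apply (Γ : GraphArc) (r : Plane) : Γ.frameEquiv r = (Γ.X r, Γ.Y r) := by
  have : Γ.frameEquiv r = (framePt 1 0 (Γ.X r) (Γ.Y r) 0, framePt 1 0 (Γ.X r) (Γ.Y r) 1) := rfl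
  rw [this]
  simp

lemma measurePreserving_frameEquiv (Γ : GraphArc) : MeasurePreserving Γ.frameEquiv :=
  (volume_preserving_finTwoArrow ℝ).comp
    ((EuclideanSpace.volume_preserving_symm_measurableEquiv_toLp (Fin 2)).comp
      Γ.frameIsometry.measurePreserving)

/-- The strip above the arc. -/
def strip (Γ : GraphArc) : Set Plane := {r | Γ.X r ∈ Ioo Γ.a Γ.b ∧ 0 < Γ.Y r - Γ.g (Γ.X r)}

lemma continuous_height (Γ : GraphArc) : Continuous fun r => Γ.Y r - Γ.g (Γ.X r) :=
  Γ.contDiff_height.continuous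

lemma isOpen_strip (Γ : GraphArc) : IsOpen Γ.strip :=
  (isOpen_Ioo.preimage Γ.continuous_X).inter (isOpen_lt continuous_const Γ.continuous_height)

lemma ht_pos_iff (Γ : GraphArc) {ε : ℝ} (hε : 0 < ε) (r : Plane) :
    0 < Γ.ht ε r ↔ 0 < Γ.Y r - Γ.g (Γ.X r) := by
  rw [Γ.height_eq hε.ne' r, mul_pos_iff_of_pos_left (mul_pos hε (Γ.w_pos _))]

lemma exists_w_le (Γ : GraphArc) : ∃ W, 1 ≤ W ∧ ∀ x ∈ Icc Γ.a Γ.b, Γ.w x ≤ W := by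
  obtain ⟨W, hW⟩ := isCompact_Icc.exists_bound_of_continuousOn (s := Icc Γ.a Γ.b)
    Γ.contDiff_w.continuous.continuousOn
  have h : ∀ x ∈ Icc Γ.a Γ.b, Γ.w x ≤ W := fun x hx => (le_abs_self _).trans (hW x hx)
  exact ⟨W, (Γ.one_le_w _).trans (h Γ.a (left_mem_Icc.2 Γ.lt.le)), h⟩

lemma integrableOn_strip (Γ : GraphArc) {ε R : ℝ} (hε : 0 < ε) {F : Plane → ℝ}
    (hF : Continuous F) (h0 : ∀ r, R ≤ Γ.ht ε r → F r = 0) : IntegrableOn F Γ.strip := by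
  obtain ⟨W, hW1, hW⟩ := Γ.exists_w_le
  have hK : IsCompact ((fun z : ℝ × ℝ => Γ.pt z.1 z.2) '' (Icc Γ.a Γ.b ×ˢ Icc 0 (ε * W * R))) :=
    (isCompact_Icc.prod isCompact_Icc).image Γ.continuous_pt
  refine (hF.continuousOn.integrableOn_compact hK).of_forall_sdiff_eq_zero
    Γ.isOpen_strip.measurableSet fun r hr => h0 r ?_
  by_contra hlt
  rw [not_le] at hlt
  have ht := (Γ.ht_pos_iff hε r).2 hr.1.2
  refine hr.2 ⟨(Γ.X r, Γ.Y r - Γ.g (Γ.X r)), ⟨Ioo_subset_Icc_self hr.1.1, hr.1.2.le, ?_⟩,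
    Γ.pt_X_Y r⟩
  rw [Γ.height_eq hε.ne' r]
  have := hW _ (Ioo_subset_Icc_self hr.1.1)
  exact mul_le_mul (mul_le_mul_of_nonneg_left this hε.le) hlt.le ht.le (by positivity)

/-- Integration in boundary coordinates: the Jacobian of `(x, t) ↦ (x, g x + ε w t)` is `ε w`. -/
lemma integral_strip (Γ : GraphArc) {ε R : ℝ} (hε : 0 < ε) {f k : ℝ → ℝ} (hf : Continuous f)
    (hk : Continuous k) (h0 : ∀ t, R ≤ t → k t = 0) :
    ∫ r in Γ.strip, f (Γ.X r) * k (Γ.ht ε r)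
      = ε * (∫ x in Γ.a..Γ.b, f x * Γ.w x) * ∫ t in Ioi 0, k t := by
  set G : ℝ × ℝ → ℝ := fun z => (Ioo Γ.a Γ.b).indicator f z.1
    * (Ioi 0).indicator k ((z.2 - Γ.g z.1) * (Γ.winv z.1 / ε)) with hG
  have hGr : ∀ r, G (Γ.frameEquiv r)
      = Γ.strip.indicator (fun r => f (Γ.X r) * k (Γ.ht ε r)) r := by
    intro r
    rw [frameEquiv_apply, hG]
    have hht : (Γ.Y r - Γ.g (Γ.X r)) * (Γ.winv (Γ.X r) / ε) = Γ.ht ε r := by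
      simp only [ht]; ring
    simp only [hht]
    by_cases h1 : Γ.X r ∈ Ioo Γ.a Γ.b
    · by_cases h2 : 0 < Γ.ht ε r
      · rw [indicator_of_mem h1, indicator_of_mem (show Γ.ht ε r ∈ Ioi 0 from h2),
          indicator_of_mem (show r ∈ Γ.strip from ⟨h1, (Γ.ht_pos_iff hε r).1 h2⟩)]
      · rw [indicator_of_notMem (show Γ.ht ε r ∉ Ioi 0 from h2), mul_zero,
          indicator_of_notMem]
        exact fun h => h2 ((Γ.ht_pos_iff hε r).2 h.2)
    · rw [indicator_of_notMem h1, zero_mul, indicator_of_notMem]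
      exact fun h => h1 h.1
  have hint : IntegrableOn (fun r => f (Γ.X r) * k (Γ.ht ε r)) Γ.strip :=
    Γ.integrableOn_strip hε (R := R) ((hf.comp Γ.continuous_X).mul
      (hk.comp (Γ.contDiff_ht ε).continuous)) fun r hr => by rw [h0 _ hr, mul_zero]
  have hGint : Integrable G (volume.prod volume) := by
    refine (Γ.measurePreserving_frameEquiv.integrable_comp_emb
      Γ.frameEquiv.measurableEmbedding).1 ?_
    have : G ∘ Γ.frameEquiv = Γ.strip.indicator (fun r => f (Γ.X r) * k (Γ.ht ε r)) :=
      funext hGr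
    rw [this]
    exact hint.integrable_indicator Γ.isOpen_strip.measurableSet
  have h1 : ∫ r in Γ.strip, f (Γ.X r) * k (Γ.ht ε r) = ∫ z, G z ∂(volume.prod volume) := by
    rw [← integral_indicator Γ.isOpen_strip.measurableSet, ← integral_congr_ae (ae_of_all _ hGr)]
    exact Γ.measurePreserving_frameEquiv.integral_comp Γ.frameEquiv.measurableEmbedding G
  have hinner : ∀ x, ∫ y, G (x, y) = (Ioo Γ.a Γ.b).indicator (fun x => f x * Γ.w x) x
      * (ε * ∫ t in Ioi 0, k t) := by
    intro x
    simp only [hG]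
    rw [integral_const_mul,
      integral_sub_right_eq_self (fun y => (Ioi 0).indicator k (y * (Γ.winv x / ε))) (Γ.g x),
      Measure.integral_comp_mul_right, integral_indicator measurableSet_Ioi, smul_eq_mul]
    have hw := Γ.w_pos x
    have : |(Γ.winv x / ε)⁻¹| = Γ.w x * ε := by
      rw [winv, inv_div, div_inv_eq_mul, mul_comm, abs_of_pos (by positivity)]
    rw [this]
    by_cases hx : x ∈ Ioo Γ.a Γ.b
    · rw [indicator_of_mem hx, indicator_of_mem hx]; ring
    · rw [indicator_of_notMem hx, indicator_of_notMem hx, zero_mul, zero_mul]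
  rw [h1, integral_prod _ hGint]
  simp only [hinner]
  rw [integral_mul_const, integral_indicator measurableSet_Ioo,
    intervalIntegral.integral_of_le Γ.lt.le, integral_Ioc_eq_integral_Ioo]
  ring

end GraphArc

/-! ### Energy of the trial state of an arc -/

namespace GraphArc

/-- The upper half of the lens of opening `ρ` around an arc. -/
def lens (Γ : GraphArc) (ρ : ℝ) : Set Plane :=
  {r | 0 < Γ.Y r - Γ.g (Γ.X r) ∧ Γ.Y r - Γ.g (Γ.X r) < ρ * Γ.endDist (Γ.X r)}

lemma isOpen_lens (Γ : GraphArc) (ρ : ℝ) : IsOpen (Γ.lens ρ) :=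
  (isOpen_lt continuous_const Γ.continuous_height).inter
    (isOpen_lt Γ.continuous_height (continuous_const.mul (Γ.continuous_endDist.comp Γ.continuous_X)))

lemma lens_subset_strip (Γ : GraphArc) {ρ : ℝ} (hρ : 0 < ρ) : Γ.lens ρ ⊆ Γ.strip := fun _ hr =>
  ⟨Γ.endDist_pos.1 ((mul_pos_iff_of_pos_left hρ).1 (hr.1.trans hr.2)), hr.1⟩

/-- The integral over the strip of the pointwise bound for the energy density of the trial state: the
main term is proportional to the length of the arc, and the ends of the arc, of size `ε R`,
contribute an error of order `R`. -/
lemma exists_strip_bound (Γ : GraphArc) {b M C c W : ℝ} (hM : 0 ≤ M) (hC : 0 ≤ C)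
    (hc : 0 ≤ c) (hW0 : 0 ≤ W) (hW : ∀ x ∈ Icc Γ.a Γ.b, Γ.w x ≤ W) {ε α R η : ℝ} {χ u : ℝ → ℝ}
    (hε : 0 < ε) (hR : 1 ≤ R) (hη : 0 < η) (hη4 : 4 * η ≤ Γ.b - Γ.a)
    (hχ : ContDiff ℝ 1 χ) (hχ0 : ∀ x, 0 ≤ χ x) (hχ1 : ∀ x, χ x ≤ 1)
    (hχm : ∀ x ∈ Icc (Γ.a + 2 * η) (Γ.b - 2 * η), χ x = 1) (hχ' : ∀ x, |deriv χ x| ≤ c / η)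
    (hχm' : ∀ x ∈ Icc (Γ.a + 2 * η) (Γ.b - 2 * η), deriv χ x = 0)
    (hu : ContDiff ℝ 1 u) (hu0 : ∀ t, R ≤ t → u t = 0) (hE : |halfLineEnergy b α u| ≤ M)
    (hI1 : ∫ t in Ioi 0, deriv u t ^ 2 ≤ M) (hI4 : ∫ t in Ioi 0, (1 + t) ^ 4 * u t ^ 2 ≤ M)
    {D : Plane → ℝ} (hDint : IntegrableOn D Γ.strip)
    (hD : ∀ r ∈ Γ.strip, D r ≤ 1 / ε ^ 2 * χ (Γ.X r) ^ 2
            * profileDensity b α (Γ.ht ε r) (u (Γ.ht ε r)) (deriv u (Γ.ht ε r))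
          + C / ε * (1 + |deriv χ (Γ.X r)|) * ((1 + Γ.ht ε r) ^ 4 * u (Γ.ht ε r) ^ 2
            + R * deriv u (Γ.ht ε r) ^ 2)) :
    ∫ r in Γ.strip, D r ≤ Γ.arclen Γ.b * halfLineEnergy b α u / ε
      + 4 * η * W * M / ε + C * (Γ.arclen Γ.b + 4 * c * W) * (2 * R * M) := by
  have hu0' := deriv_eq_zero_of_eq_zero_Ici hu hu0
  have huc := hu.continuous
  have hudc := hu.continuous_deriv le_rfl
  have hχc := hχ.continuous
  have hχdc := hχ.continuous_deriv le_rfl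
  have hwc := Γ.contDiff_w.continuous
  set k₁ : ℝ → ℝ := fun t => profileDensity b α t (u t) (deriv u t) with hk₁
  set k₂ : ℝ → ℝ := fun t => (1 + t) ^ 4 * u t ^ 2 + R * deriv u t ^ 2 with hk₂
  have hk₁c : Continuous k₁ := by simp only [hk₁, profileDensity]; fun_prop
  have hk₂c : Continuous k₂ := by simp only [hk₂]; fun_prop
  have hk₁0 : ∀ t, R ≤ t → k₁ t = 0 := fun t ht => by
    simp [hk₁, profileDensity, hu0 t ht, hu0' t ht]
  have hk₂0 : ∀ t, R ≤ t → k₂ t = 0 := fun t ht => by simp [hk₂, hu0 t ht, hu0' t ht]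
  set f₁ : ℝ → ℝ := fun x => 1 / ε ^ 2 * χ x ^ 2 with hf₁
  set f₂ : ℝ → ℝ := fun x => C / ε * (1 + |deriv χ x|) with hf₂
  have hf₁c : Continuous f₁ := by fun_prop
  have hf₂c : Continuous f₂ := by simp only [hf₂]; fun_prop
  have hi : ∀ f k : ℝ → ℝ, Continuous f → Continuous k → (∀ t, R ≤ t → k t = 0) →
      IntegrableOn (fun r => f (Γ.X r) * k (Γ.ht ε r)) Γ.strip := fun f k hf hk h0 =>
    Γ.integrableOn_strip hε (R := R) ((hf.comp Γ.continuous_X).mul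
      (hk.comp (Γ.contDiff_ht ε).continuous)) fun r hr => by rw [h0 _ hr, mul_zero]
  have hi₁ := hi f₁ k₁ hf₁c hk₁c hk₁0
  have hi₂ := hi f₂ k₂ hf₂c hk₂c hk₂0
  have h1 : ∫ r in Γ.strip, D r
      ≤ ∫ r in Γ.strip, (f₁ (Γ.X r) * k₁ (Γ.ht ε r) + f₂ (Γ.X r) * k₂ (Γ.ht ε r)) :=
    setIntegral_mono_on hDint (hi₁.add hi₂) Γ.isOpen_strip.measurableSet hD
  rw [integral_add hi₁ hi₂, Γ.integral_strip hε hf₁c hk₁c hk₁0,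
    Γ.integral_strip hε hf₂c hk₂c hk₂0] at h1
  refine h1.trans ?_
  have hlen : ∫ x in Γ.a..Γ.b, Γ.w x = Γ.arclen Γ.b := rfl
  have hL0 : 0 ≤ Γ.arclen Γ.b := by
    rw [← Γ.arclen_a]; exact Γ.strictMono_arclen.monotone Γ.lt.le
  have hk₁E : ∫ t in Ioi 0, k₁ t = halfLineEnergy b α u := rfl
  have hk₂I : ∫ t in Ioi 0, k₂ t ≤ 2 * R * M := by
    simp only [hk₂]
    rw [integral_add, integral_const_mul]
    · have := mul_le_mul_of_nonneg_left hI1 (zero_le_one.trans hR)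
      have := mul_le_mul_of_nonneg_right hR hM
      linarith
    · exact integrableOn_Ioi_of_eq_zero_Ici (N := R) (by fun_prop) fun t ht => by simp [hu0 t ht]
    · exact integrableOn_Ioi_of_eq_zero_Ici (N := R) (by fun_prop) fun t ht => by simp [hu0' t ht]
  have hk₂n : 0 ≤ ∫ t in Ioi 0, k₂ t := integral_nonneg fun t => by
    simp only [hk₂]; positivity
  have hii : ∀ f : ℝ → ℝ, Continuous f → IntervalIntegrable f volume Γ.a Γ.b := fun f hf =>
    hf.intervalIntegrable _ _
  -- the tangential integral in the main term
  set J := ∫ x in Γ.a..Γ.b, (1 - χ x ^ 2) * Γ.w x with hJ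
  have hχsq : ∀ x, χ x ^ 2 ≤ 1 := fun x => pow_le_one₀ (hχ0 x) (hχ1 x)
  have hJ1 : J ≤ 4 * η * W := by
    refine integral_le_of_eq_zero_middle (by fun_prop) hη.le hη4 (fun x hx => ?_) fun x hx => ?_
    · rw [abs_of_nonneg (mul_nonneg (by linarith [hχsq x]) (Γ.w_pos x).le)]
      exact (mul_le_of_le_one_left (Γ.w_pos x).le (by linarith [sq_nonneg (χ x)])).trans (hW x hx)
    · rw [hχm x hx]; ring
  have hJ0 : 0 ≤ J := intervalIntegral.integral_nonneg Γ.lt.le fun x _ =>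
    mul_nonneg (by linarith [hχsq x]) (Γ.w_pos x).le
  have hf₁I : ∫ x in Γ.a..Γ.b, f₁ x * Γ.w x = 1 / ε ^ 2 * (Γ.arclen Γ.b - J) := by
    rw [hJ, ← hlen, ← intervalIntegral.integral_sub (hii _ hwc) (hii _ (by fun_prop)),
      ← intervalIntegral.integral_const_mul]
    refine intervalIntegral.integral_congr fun x _ => ?_
    simp only [hf₁]; ring
  -- the tangential integral in the error term
  set J' := ∫ x in Γ.a..Γ.b, |deriv χ x| * Γ.w x with hJ'
  have hJ'1 : J' ≤ 4 * c * W := by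
    have : 4 * η * (c / η * W) = 4 * c * W := by field_simp
    rw [← this]
    refine integral_le_of_eq_zero_middle (by fun_prop) hη.le hη4 (fun x hx => ?_) fun x hx => ?_
    · rw [abs_of_nonneg (mul_nonneg (abs_nonneg _) (Γ.w_pos x).le)]
      exact mul_le_mul (hχ' x) (hW x hx) (Γ.w_pos x).le (by positivity)
    · rw [hχm' x hx]; simp
  have hf₂I : ∫ x in Γ.a..Γ.b, f₂ x * Γ.w x = C / ε * (Γ.arclen Γ.b + J') := by
    rw [hJ', ← hlen, ← intervalIntegral.integral_add (hii _ hwc) (hii _ (by fun_prop)),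
      ← intervalIntegral.integral_const_mul]
    refine intervalIntegral.integral_congr fun x _ => ?_
    simp only [hf₂]; ring
  rw [hf₁I, hf₂I, hk₁E]
  have hmain : ε * (1 / ε ^ 2 * (Γ.arclen Γ.b - J)) * halfLineEnergy b α u
      ≤ Γ.arclen Γ.b * halfLineEnergy b α u / ε + 4 * η * W * M / ε := by
    have h2 : -(J * halfLineEnergy b α u) ≤ 4 * η * W * M := by
      refine (neg_le_abs _).trans ?_
      rw [abs_mul, abs_of_nonneg hJ0]
      exact mul_le_mul hJ1 hE (abs_nonneg _) (by positivity)
    have h3 : ε * (1 / ε ^ 2 * (Γ.arclen Γ.b - J)) * halfLineEnergy b α u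
        = (Γ.arclen Γ.b * halfLineEnergy b α u + -(J * halfLineEnergy b α u)) / ε := by
      field_simp
      ring
    rw [h3, ← add_div]
    gcongr
  have herr : ε * (C / ε * (Γ.arclen Γ.b + J')) * ∫ t in Ioi 0, k₂ t
      ≤ C * (Γ.arclen Γ.b + 4 * c * W) * (2 * R * M) := by
    have h3 : ε * (C / ε * (Γ.arclen Γ.b + J')) = C * (Γ.arclen Γ.b + J') := by
      field_simp
    rw [h3]
    gcongr
  linarith

/-- The trial state of an arc: a state concentrated in the part of the lens of the arc that stays
away from the rest of the boundary, with energy close to the one-dimensional energy of the profile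
times the length of the arc. -/
lemma exists_trial_state (Γ : GraphArc) {ρ b M : ℝ} (hρ : 0 < ρ) (hb : 0 < b) (hM : 0 ≤ M)
    (hbdd : Bornology.IsBounded (Γ.lens ρ)) :
    ∃ C δ : ℝ, 0 < δ ∧ 0 ≤ C ∧ ∀ (ε α R : ℝ) (u : ℝ → ℝ), 0 < ε → 1 ≤ R → ε * R ≤ δ → |α| ≤ M →
      ContDiff ℝ 1 u → (∀ t, R ≤ t → u t = 0) → |halfLineEnergy b α u| ≤ M →
      ∫ t in Ioi 0, deriv u t ^ 2 ≤ M → ∫ t in Ioi 0, (1 + t) ^ 4 * u t ^ 2 ≤ M →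
      ∃ (Ψ : Plane → ℂ) (K : Set Plane), ContDiff ℝ 1 Ψ ∧ IsClosed K ∧ K ⊆ Γ.lens ρ ∪ Γ.image ∧
        (∀ r ∈ Γ.lens ρ, r ∉ K → Ψ r = 0) ∧
        ∫ r in Γ.lens ρ, density b ε Ψ r ≤ Γ.arclen Γ.b * halfLineEnergy b α u / ε + C * R := by
  obtain ⟨c, hc, hcut⟩ := exists_endpoint_cutoff
  obtain ⟨W, hW1, hW⟩ := Γ.exists_w_le
  -- the cut-off length is `η = l ε R`
  set l := (W + 1) / ρ with hl
  have hl0 : 0 < l := by positivity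
  obtain ⟨C, hC, hdens⟩ := Γ.exists_density_trial_le (c₃ := c / l) hb hM (by positivity)
  have hlt := Γ.lt
  have hL0 : 0 ≤ Γ.arclen Γ.b := by
    rw [← Γ.arclen_a]; exact Γ.strictMono_arclen.monotone Γ.lt.le
  refine ⟨4 * l * W * M + C * (Γ.arclen Γ.b + 4 * c * W) * (2 * M),
    min 1 ((Γ.b - Γ.a) / (4 * l)), lt_min one_pos (div_pos (by linarith) (by positivity)),
    by positivity, ?_⟩
  intro ε α R u hε hR hεR hα hu hu0 hE hI1 hI4
  have hR0 : 0 < R := by linarith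
  have hεR1 : ε * R ≤ 1 := hεR.trans (min_le_left _ _)
  have hεR2 : ε * R ≤ (Γ.b - Γ.a) / (4 * l) := hεR.trans (min_le_right _ _)
  set η := l * (ε * R) with hη
  have hη0 : 0 < η := by positivity
  have hη4 : 4 * η ≤ Γ.b - Γ.a := by
    rw [le_div_iff₀ (by positivity)] at hεR2
    rw [hη]; linarith
  obtain ⟨χ, hχ, hχ0, hχ1, hχs, hχm, hχ', hχm'⟩ := hcut Γ.a Γ.b η hη0
  set K : Set Plane := {r | Γ.X r ∈ Icc (Γ.a + η) (Γ.b - η) ∧ Γ.ht ε r ∈ Icc 0 R} with hK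
  have hKc : IsClosed K := (isClosed_Icc.preimage Γ.continuous_X).inter
    (isClosed_Icc.preimage (Γ.contDiff_ht ε).continuous)
  have hKsub : K ⊆ Γ.lens ρ ∪ Γ.image := by
    rintro r ⟨hx, ht⟩
    have hxI : Γ.X r ∈ Icc Γ.a Γ.b := ⟨by linarith [hx.1], by linarith [hx.2]⟩
    rcases ht.1.eq_or_lt with h0 | h0
    · right
      refine ⟨Γ.X r, hxI, ?_⟩
      have := Γ.height_eq hε.ne' r
      rw [← h0, mul_zero] at this
      rw [curve, ← this, Γ.pt_X_Y]
    · left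
      refine ⟨(Γ.ht_pos_iff hε r).1 h0, ?_⟩
      rw [Γ.height_eq hε.ne' r]
      have h1 : ε * Γ.w (Γ.X r) * Γ.ht ε r ≤ ε * W * R :=
        mul_le_mul (mul_le_mul_of_nonneg_left (hW _ hxI) hε.le) ht.2 ht.1 (by positivity)
      have h2 : ρ * η ≤ ρ * Γ.endDist (Γ.X r) :=
        mul_le_mul_of_nonneg_left (le_min (by linarith [hx.1]) (by linarith [hx.2])) hρ.le
      have h3 : ρ * η = ε * W * R + ε * R := by
        rw [hη, hl]; field_simp
      have := mul_pos hε hR0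
      linarith
  have hzero : ∀ r ∈ Γ.strip, r ∉ K → Γ.trial ε α χ u r = 0 := by
    intro r hr hrK
    have : χ (Γ.X r) * u (Γ.ht ε r) = 0 := by
      by_contra h
      refine hrK ⟨hχs _ (left_ne_zero_of_mul h), ((Γ.ht_pos_iff hε r).2 hr.2).le, ?_⟩
      by_contra h'
      exact right_ne_zero_of_mul h (hu0 _ (not_le.1 h').le)
    rw [trial, this]
    simp
  have hlens := Γ.lens_subset_strip hρ
  have hΨ := Γ.contDiff_trial ε α hχ hu
  have hdz : ∀ r ∈ Γ.strip \ Γ.lens ρ, density b ε (Γ.trial ε α χ u) r = 0 := by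
    rintro r ⟨hr, hrl⟩
    have hrK : r ∉ K := fun h => by
      rcases hKsub h with h | ⟨x, -, rfl⟩
      · exact hrl h
      · have := hr.2
        rw [X_curve, curve, Y_pt] at this
        simp at this
    have hev : Γ.trial ε α χ u =ᶠ[𝓝 r] fun _ => 0 := by
      filter_upwards [Γ.isOpen_strip.mem_nhds hr, hKc.isOpen_compl.mem_nhds hrK] with r' h1 h2
      exact hzero r' h1 h2
    rw [density_congr b ε hev, density_zero]
  have hDl : IntegrableOn (density b ε (Γ.trial ε α χ u)) (Γ.lens ρ) :=
    ((continuous_density b ε hΨ).continuousOn.integrableOn_compact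
      hbdd.isCompact_closure).mono_set subset_closure
  have hDint : IntegrableOn (density b ε (Γ.trial ε α χ u)) Γ.strip :=
    hDl.of_forall_sdiff_eq_zero Γ.isOpen_strip.measurableSet hdz
  refine ⟨Γ.trial ε α χ u, K, hΨ, hKc, hKsub, fun r hr => hzero r (hlens hr), ?_⟩
  rw [← setIntegral_eq_of_subset_of_forall_sdiff_eq_zero Γ.isOpen_strip.measurableSet hlens hdz]
  have hχ'' : ∀ x, |deriv χ x| ≤ c / l / ε := fun x => (hχ' x).trans (by
    rw [div_div, hη]
    gcongr
    exact le_mul_of_one_le_right hε.le hR)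
  have key := Γ.exists_strip_bound hM hC hc.le (by linarith) hW hε hR hη0 hη4 hχ hχ0 hχ1 hχm hχ' hχm'
    hu hu0 hE hI1 hI4 hDint fun r hr => hdens ε α R χ u hε hR hεR1 hα hχ hu hχ0 hχ1 hχ'' hu0 r
      (Ioo_subset_Icc_self hr.1) ((Γ.ht_pos_iff hε r).2 hr.2).le
  refine key.trans (le_of_eq ?_)
  rw [hη]
  field_simp
  ring

end GraphArc

/-! ### The upper bound -/

/-- The energy of the normal state `ψ = 0` is zero. -/
lemma groundEnergy_nonpos {Ω : Set Plane} (hΩ : IsOpen Ω) (hbdd : Bornology.IsBounded Ω)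
    {b ε : ℝ} (hb : 0 < b) : groundEnergy Ω b ε ≤ 0 := by
  have h := groundEnergy_le_sum_density hΩ hbdd (ε := ε) hb (κ := Empty) (fun _ => ∅) (fun _ => ∅)
    (fun _ _ => 0) (fun k => k.elim) (fun k => k.elim) (fun k => k.elim) (fun k => k.elim)
    (fun k => k.elim) (fun k => k.elim) (fun k => k.elim)
  simpa using h

/-- A truncation index of order `|log ε|` making the truncation error smaller than `ε`. -/
lemma exists_truncation_index (K : ℝ) (hK : 0 ≤ K) : ∃ c : ℝ, 0 < c ∧ ∀ ε : ℝ, 0 < ε → ε < 1 / 2 →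
    ∃ m : ℕ, (1 / 2 : ℝ) ^ m ≤ ε ∧ K + m ≤ c * |Real.log ε| := by
  have hlog2 : 0 < Real.log 2 := Real.log_pos one_lt_two
  refine ⟨(K + 2) / Real.log 2, by positivity, fun ε hε hε2 => ?_⟩
  have hlogε : Real.log ε ≤ -Real.log 2 := by
    have := Real.log_le_log hε hε2.le
    rwa [one_div, Real.log_inv] at this
  have habs : |Real.log ε| = -Real.log ε := abs_of_neg (by linarith)
  have h1 : 1 ≤ |Real.log ε| / Real.log 2 := by
    rw [le_div_iff₀ hlog2, habs]; linarith
  refine ⟨⌈|Real.log ε| / Real.log 2⌉₊, ?_, ?_⟩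
  · rw [← Real.log_le_log_iff (by positivity) hε, Real.log_pow, one_div, Real.log_inv]
    have h2 := Nat.le_ceil (|Real.log ε| / Real.log 2)
    rw [div_le_iff₀ hlog2] at h2
    linarith
  · have h2 := (Nat.ceil_lt_add_one (zero_le_one.trans h1)).le
    have h3 : K ≤ K * (|Real.log ε| / Real.log 2) := le_mul_of_one_le_right hK h1
    have h4 : (K + 2) / Real.log 2 * |Real.log ε| = K * (|Real.log ε| / Real.log 2)
        + 2 * (|Real.log ε| / Real.log 2) := by ring
    rw [h4]
    linarith

/-- The upper bound with the trial states of all the arcs glued together, the profile being truncated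
at a length of order `|log ε|`. -/
lemma exists_groundEnergy_le_of_neg {Ω : Set Plane} (hΩ : IsOpen Ω) (hbdd : Bornology.IsBounded Ω)
    (hpoly : IsSmoothCurvilinearPolygon Ω) {b : ℝ} (hb : 1 < b) (hneg : oneDGroundEnergy b < 0) :
    ∃ C ε₀ : ℝ, 0 < ε₀ ∧ ∀ ε : ℝ, 0 < ε → ε < ε₀ →
      groundEnergy Ω b ε ≤ perimeter Ω * oneDGroundEnergy b / ε + C * |Real.log ε| := by
  have hb0 : 0 < b := by linarith
  obtain ⟨κ, hfin, Γ, ρ, hρ, hcover, himage, hlensΩ, hdisj⟩ := exists_lens_arcs hΩ hbdd hpoly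
  have := Fintype.ofFinite κ
  obtain ⟨K, M, hK, hM, hprof⟩ := exists_truncated_near_minimizer hb hneg
  set E := oneDGroundEnergy b with hE
  set M' := M + |E| with hM'
  have hM'0 : 0 ≤ M' := by positivity
  have hMM' : M ≤ M' := le_add_of_nonneg_right (abs_nonneg _)
  have hpt : ∀ k r, r = (Γ k).pt ((Γ k).X r) ((Γ k).Y r - (Γ k).g ((Γ k).X r)) := fun k r =>
    ((Γ k).pt_X_Y r).symm
  have hsub : ∀ k, (Γ k).lens ρ ⊆ Ω := fun k r hr => by
    rw [hpt k r]
    exact hlensΩ k _ _ hr.1 hr.2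
  have hdisj' : Pairwise fun k l => Disjoint ((Γ k).lens ρ) ((Γ l).lens ρ) := by
    intro k l hkl
    rw [Set.disjoint_left]
    intro r hk hl
    exact hkl (hdisj k l _ _ _ _ (by rw [abs_of_pos hk.1]; exact hk.2)
      (by rw [abs_of_pos hl.1]; exact hl.2) ((hpt k r).symm.trans (hpt l r)))
  choose C δ hδ hC htrial using fun k =>
    (Γ k).exists_trial_state hρ hb0 hM'0 (hbdd.subset (hsub k))
  obtain ⟨c, hc, hindex⟩ := exists_truncation_index (K + 1) (by linarith)
  -- the cut-off lengths are small for small `ε`, since `ε log ε → 0`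
  have hsmall : ∀ᶠ ε : ℝ in 𝓝[>] 0, ∀ k, ε * (c * |Real.log ε|) ≤ δ k := by
    rw [eventually_all]
    intro k
    have h1 : Tendsto (fun ε : ℝ => ε * (c * |Real.log ε|)) (𝓝[>] 0) (𝓝 0) := by
      have h2 : Tendsto (fun ε : ℝ => Real.log ε * ε) (𝓝[>] 0) (𝓝 0) := by
        simpa using tendsto_log_mul_rpow_nhdsGT_zero one_pos
      have h3 := h2.abs.const_mul c
      rw [abs_zero, mul_zero] at h3
      refine h3.congr' ?_
      filter_upwards [self_mem_nhdsWithin] with ε hε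
      rw [abs_mul, abs_of_pos (show 0 < ε from hε)]
      ring
    exact (h1.eventually_lt_const (hδ k)).mono fun ε h => h.le
  obtain ⟨ε₁, hε₁, hsm⟩ := mem_nhdsGT_iff_exists_Ioo_subset.1 hsmall
  have hL0 : ∀ k, 0 ≤ (Γ k).arclen (Γ k).b := fun k => by
    rw [← (Γ k).arclen_a]; exact (Γ k).strictMono_arclen.monotone (Γ k).lt.le
  set L := ∑ k, (Γ k).arclen (Γ k).b with hL
  have hLn : 0 ≤ L := Finset.sum_nonneg fun k _ => hL0 k
  have hCn : 0 ≤ ∑ k, C k := Finset.sum_nonneg fun k _ => hC k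
  refine ⟨L * M * c + (∑ k, C k) * c, min ε₁ (1 / 2), lt_min hε₁ (by norm_num),
    fun ε hε hεlt => ?_⟩
  obtain ⟨m, hm, hmR⟩ := hindex ε hε (hεlt.trans_le (min_le_right _ _))
  obtain ⟨α, u, hα, hu, hu0, hEu, hI1, hI4⟩ := hprof m
  set R : ℝ := K + 1 + m with hR
  have hR1 : 1 ≤ R := by
    have : (0 : ℝ) ≤ m := m.cast_nonneg
    linarith
  have hu0R : ∀ t, R ≤ t → u t = 0 := fun t ht => hu0 t (by linarith)
  have hEge : E ≤ halfLineEnergy b α u := oneDGroundEnergy_le_halfLineEnergy hb.le α hu hu0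
  have hpow : (1 / 2 : ℝ) ^ m ≤ 1 := pow_le_one₀ (by norm_num) (by norm_num)
  have hEabs : |halfLineEnergy b α u| ≤ M' := by
    have h1 : M * (1 / 2 : ℝ) ^ m ≤ M := mul_le_of_le_one_right hM.le hpow
    rw [abs_le]
    constructor
    · linarith [neg_abs_le E]
    · linarith [le_abs_self E]
  have hεR : ∀ k, ε * R ≤ δ k := fun k =>
    (mul_le_mul_of_nonneg_left hmR hε.le).trans
      (hsm ⟨hε, hεlt.trans_le (min_le_left _ _)⟩ k)
  choose Ψ S hΨ hS hSsub hΨ0 hen using fun k => htrial k ε α R u hε hR1 (hεR k) (hα.trans hMM') hu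
    hu0R hEabs (hI1.trans hMM') (hI4.trans hMM')
  have hglue := groundEnergy_le_sum_density hΩ hbdd (ε := ε) hb0 (fun k => (Γ k).lens ρ) S Ψ hΨ
    (fun k => (Γ k).isOpen_lens ρ) hsub hdisj' hS (fun k r hr => by
      refine (hSsub k hr.1).resolve_right fun h => ?_
      have h2 : r ∈ Ω ∩ frontier Ω := ⟨hr.2, himage k h⟩
      rw [hΩ.inter_frontier_eq] at h2
      exact h2) hΨ0
  refine hglue.trans ((Finset.sum_le_sum fun k _ => hen k).trans ?_)
  rw [Finset.sum_add_distrib, ← Finset.sum_mul, ← Finset.sum_div, ← Finset.sum_mul, ← hL]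
  have hEu' : halfLineEnergy b α u ≤ E + M * ε :=
    hEu.trans (by gcongr)
  have h1 : L * halfLineEnergy b α u / ε ≤ perimeter Ω * E / ε + L * M := by
    have h2 : L * halfLineEnergy b α u ≤ L * (E + M * ε) := mul_le_mul_of_nonneg_left hEu' hLn
    have h3 : L * E ≤ perimeter Ω * E :=
      mul_le_mul_of_nonpos_right (perimeter_le_sum_arclen Γ hcover) hneg.le
    rw [div_add' _ _ _ hε.ne']
    gcongr
    linarith
  have hlog : 1 ≤ c * |Real.log ε| := hR1.trans hmR
  have h4 : L * M ≤ L * M * (c * |Real.log ε|) := le_mul_of_one_le_right (by positivity) hlog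
  have h5 : (∑ k, C k) * R ≤ (∑ k, C k) * (c * |Real.log ε|) :=
    mul_le_mul_of_nonneg_left hmR hCn
  linarith

end GinzburgLandau

end

theorem proposition2p1 (Ω : Set GinzburgLandau.Plane) (hΩ : GinzburgLandau.IsCornerDomain Ω)
    (b : ℝ) (hb₁ : 1 < b) (hb₂ : b < GinzburgLandau.deGennes⁻¹) :
    ∃ C ε₀ : ℝ, 0 < ε₀ ∧ ∀ ε : ℝ, 0 < ε → ε < ε₀ →
      GinzburgLandau.groundEnergy Ω b ε
        ≤ GinzburgLandau.perimeter Ω * GinzburgLandau.oneDGroundEnergy b / ε + C * |Real.log ε| := by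
  rcases lt_or_ge (GinzburgLandau.oneDGroundEnergy b) 0 with hneg | hnonneg
  · exact GinzburgLandau.exists_groundEnergy_le_of_neg hΩ.isOpen hΩ.isBounded hΩ.polygon hb₁ hneg
  · refine ⟨0, 1, one_pos, fun ε hε _ => ?_⟩
    rw [zero_mul, add_zero]
    exact (GinzburgLandau.groundEnergy_nonpos hΩ.isOpen hΩ.isBounded (by linarith)).trans
      (div_nonneg (mul_nonneg ENNReal.toReal_nonneg hnonneg) hε.le)
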